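/- Let $(\mathcal X,\preceq_{\mathcal X})$ and $(\mathcal Y,\preceq_{\mathcal Y})$ be finite partially ordered sets and let $p$ be a joint pmf on $\mathcal X\times\mathcal Y$ such that neither of the random variables $X,Y$ with law $p$ is almost surely constant. The generalized concordant monotone correlation (CMC) is $$\rho_r(X;Y)=\max_{f,g}\frac{\mathrm{Cov}(f(X),g(Y))}{\sqrt{\mathrm{Var}(f(X))\,\mathrm{Var}(g(Y))}},$$ where the maximum is over all functions $f:\mathcal X\to\mathbb R$, $g:\mathcal Y\to\mathbb R$ of positive variance that are monotone, i.e. $f(x)\le f(x')$ for $x\preceq_{\mathcal X}x'$ and $g(y)\le g(y')$ for $y\preceq_{\mathcal Y}y'$. Put $R_{\mathcal X}=\{(x,x'):x\ne x',\ x\preceq_{\mathcal X}x'\}$ and define $R_{\mathcal Y}$ similarly. For $S_{\mathcal X}\subseteq R_{\mathcal X}$ and $S_{\mathcal Y}\subseteq R_{\mathcal Y}$ consider the relaxed problem of maximizing $\mathrm{Cov}(f(X),g(Y))$ subject to $\mathrm{Var}(f(X))=\mathrm{Var}(g(Y))=1$, $f(x)=f(x')$ for $(x,x')\in S_{\mathcal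 X}$ and $g(y)=g(y')$ for $(y,y')\in S_{\mathcal Y}$ (the ordinary maximal correlation after merging symbols). 1. The maximum defining $\rho_r(X;Y)$ is attained, and so is the maximum in every relaxed problem that has a feasible point. 2. For every $(S_{\mathcal X},S_{\mathcal Y})$ whose relaxed problem has a feasible point, let an arbitrary optimizer $(\tilde f,\tilde g)$ of it be chosen. Then $\rho_r(X;Y)$ is the largest of the values $\mathrm{Cov}(\varepsilon\tilde f(X),\delta\tilde g(Y))$, over all such $(S_{\mathcal X},S_{\mathcal Y})$ and all signs $\varepsilon,\delta\in\{1,-1\}$ for which $\varepsilon\tilde f$ and $\delta\tilde g$ are monotone on the sets of symbols of positive probability. If $\rho_r(X;Y)>0$, then this remains true when only equal signs $\varepsilon=\delta$ are tested. 3. There is one program for a real-number random access machine that, for all $\mathcal X,\mathcal Y,p$ as above, given the table of $p$ and the tables of the two orders (with respect to arbitrary listings of $\mathcal X$ and $\mathcal Y$), halts with the exact value $\rho_r(X;Y)$ after at most $$C\,(|\mathcal X|\,|\mathcal Y|)^{k}\;2^{\,|R_{\mathcal X}|+|R_{\mathcal Y}|}$$ steps, where $C$ and $k$ are absolute constants.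 Here a step is an arithmetic operation ($+,-,\times,\div$) or comparison of real numbers, an addition, truncated subtraction or comparison of indices, an assignment or a memory access; the only real constants of a program are $0$ and $1$; and the $j$-th smallest real root of a polynomial of degree at most $d$ with given coefficients can be extracted in $d+1$ steps. -/

import Mathlib

/-! Finite joint distributions, monotone correlation, and the subset-enumeration procedure. -/

namespace MonoCorr

section Correlation

variable {X Y : Type*} [Fintype X] [Fintype Y]

/-- `p` is a joint probability mass function on `X × Y`. -/
structure IsJointPMF (p : X → Y → ℝ) : Prop where
  nonneg : ∀ x y, 0 ≤ p x y
  sum_eq_one : ∑ x, ∑ y, p x y = 1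

/-- The law of the first coordinate. -/
def margX (p : X → Y → ℝ) (x : X) : ℝ := ∑ y, p x y

/-- The law of the second coordinate. -/
def margY (p : X → Y → ℝ) (y : Y) : ℝ := ∑ x, p x y

/-- Neither coordinate is almost surely constant (otherwise every variance is zero and the
correlation coefficients do not make sense). -/
def Nondegenerate (p : X → Y → ℝ) : Prop :=
  (∃ x x', x ≠ x' ∧ 0 < margX p x ∧ 0 < margX p x') ∧
  (∃ y y', y ≠ y' ∧ 0 < margY p y ∧ 0 < margY p y')

/-- Expectation of `h (X, Y)`. -/
def mean (p : X → Y → ℝ) (h : X → Y → ℝ) : ℝ := ∑ x, ∑ y, p x y * h x y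

/-- `Cov (f X, g Y)`. -/
def cov (p : X → Y → ℝ) (f : X → ℝ) (g : Y → ℝ) : ℝ :=
  mean p fun x y => (f x - mean p fun x' _ => f x') * (g y - mean p fun _ y' => g y')

/-- `Var (f X)`. -/
def varX (p : X → Y → ℝ) (f : X → ℝ) : ℝ :=
  mean p fun x _ => (f x - mean p fun x' _ => f x') ^ 2

/-- `Var (g Y)`. -/
def varY (p : X → Y → ℝ) (g : Y → ℝ) : ℝ :=
  mean p fun _ y => (g y - mean p fun _ y' => g y') ^ 2

/-- The Pearson coefficients of all `f X`, `g Y` with `f`, `g` monotone for the partial orders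
and of positive variance. -/
def cmcSet [PartialOrder X] [PartialOrder Y] (p : X → Y → ℝ) : Set ℝ :=
  {c | ∃ (f : X → ℝ) (g : Y → ℝ), Monotone f ∧ Monotone g ∧ 0 < varX p f ∧ 0 < varY p g ∧
    c = cov p f g / Real.sqrt (varX p f * varY p g)}

/-- The generalized concordant monotone correlation. -/
noncomputable def cmc [PartialOrder X] [PartialOrder Y] (p : X → Y → ℝ) : ℝ := sSup (cmcSet p)

/-- The pairs of a partial order in strict relation. -/
def strictRel (Z : Type*) [PartialOrder Z] : Set (Z × Z) := {q | q.1 < q.2}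

/-- Pairs `(f, g)` of unit variance that are constant on the symbols merged by `SX` and `SY`. -/
def feasible (p : X → Y → ℝ) (SX : Set (X × X)) (SY : Set (Y × Y)) :
    Set ((X → ℝ) × (Y → ℝ)) :=
  {fg | varX p fg.1 = 1 ∧ varY p fg.2 = 1 ∧
    (∀ q ∈ SX, fg.1 q.1 = fg.1 q.2) ∧ (∀ q ∈ SY, fg.2 q.1 = fg.2 q.2)}

/-- `(f, g)` attains the ordinary maximal correlation of the merged symbols. -/
def IsOptimizer (p : X → Y → ℝ) (SX : Set (X × X)) (SY : Set (Y × Y))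
    (f : X → ℝ) (g : Y → ℝ) : Prop :=
  (f, g) ∈ feasible p SX SY ∧ ∀ fg ∈ feasible p SX SY, cov p fg.1 fg.2 ≤ cov p f g

/-- `F`, `G` select one optimizer of each relaxed problem that has a feasible point. -/
def IsSelection [PartialOrder X] [PartialOrder Y] (p : X → Y → ℝ)
    (F : Set (X × X) → Set (Y × Y) → X → ℝ) (G : Set (X × X) → Set (Y × Y) → Y → ℝ) : Prop :=
  ∀ SX ⊆ strictRel X, ∀ SY ⊆ strictRel Y, (feasible p SX SY).Nonempty →
    IsOptimizer p SX SY (F SX SY) (G SX SY)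

/-- `(f, g)` is monotone, symbols of probability zero being disregarded. -/
def MonoOnSupport [PartialOrder X] [PartialOrder Y] (p : X → Y → ℝ)
    (f : X → ℝ) (g : Y → ℝ) : Prop :=
  MonotoneOn f {x | 0 < margX p x} ∧ MonotoneOn g {y | 0 < margY p y}

/-- The covariances kept when all sets of strict relations are enumerated and one of
`(f, g)`, `(-f, -g)` is monotone, `(f, g)` being the selected optimizer. -/
def keptCommonSign [PartialOrder X] [PartialOrder Y] (p : X → Y → ℝ)
    (F : Set (X × X) → Set (Y × Y) → X → ℝ) (G : Set (X × X) → Set (Y × Y) → Y → ℝ) : Set ℝ :=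
  {c | ∃ SX ⊆ strictRel X, ∃ SY ⊆ strictRel Y, (feasible p SX SY).Nonempty ∧
    (MonoOnSupport p (F SX SY) (G SX SY) ∨ MonoOnSupport p (-F SX SY) (-G SX SY)) ∧
    c = cov p (F SX SY) (G SX SY)}

/-- The covariances kept when the signs of the two functions are tested independently. -/
def keptAllSigns [PartialOrder X] [PartialOrder Y] (p : X → Y → ℝ)
    (F : Set (X × X) → Set (Y × Y) → X → ℝ) (G : Set (X × X) → Set (Y × Y) → Y → ℝ) : Set ℝ :=
  {c | ∃ SX ⊆ strictRel X, ∃ SY ⊆ strictRel Y, (feasible p SX SY).Nonempty ∧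
    ∃ f g, (f = F SX SY ∨ f = -F SX SY) ∧ (g = G SX SY ∨ g = -G SX SY) ∧
      MonoOnSupport p f g ∧ c = cov p f g}

end Correlation

/-! A real-number random access machine, programmed in a small imperative language.
The only real constants of a program are `0` and `1`.  Real cells are addressed by an array name
and two computed indices. -/

/-- Memory: natural-number index variables and real arrays with two indices. -/
structure State where
  idx : ℕ → ℕ
  mem : ℕ → ℕ → ℕ → ℝ

/-- Index expressions. -/
inductive IExp where
  | lit (n : ℕ)
  | var (v : ℕ)
  | add (e₁ e₂ : IExp)
  | sub (e₁ e₂ : IExp)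

/-- Value of an index expression (subtraction is truncated at `0`). -/
def IExp.eval (s : State) : IExp → ℕ
  | .lit n => n
  | .var v => s.idx v
  | .add e₁ e₂ => e₁.eval s + e₂.eval s
  | .sub e₁ e₂ => e₁.eval s - e₂.eval s

/-- Number of operations in an index expression. -/
def IExp.cost : IExp → ℕ
  | .lit _ => 1
  | .var _ => 1
  | .add e₁ e₂ => e₁.cost + e₂.cost + 1
  | .sub e₁ e₂ => e₁.cost + e₂.cost + 1

/-- Real expressions. -/
inductive RExp where
  | zero
  | one
  | cell (a : ℕ) (i j : IExp)
  | add (e₁ e₂ : RExp)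
  | sub (e₁ e₂ : RExp)
  | mul (e₁ e₂ : RExp)
  | div (e₁ e₂ : RExp)

/-- Value of a real expression (a division by `0` returns `0`). -/
noncomputable def RExp.eval (s : State) : RExp → ℝ
  | .zero => 0
  | .one => 1
  | .cell a i j => s.mem a (i.eval s) (j.eval s)
  | .add e₁ e₂ => e₁.eval s + e₂.eval s
  | .sub e₁ e₂ => e₁.eval s - e₂.eval s
  | .mul e₁ e₂ => e₁.eval s * e₂.eval s
  | .div e₁ e₂ => e₁.eval s / e₂.eval s

/-- Number of operations in a real expression. -/
def RExp.cost : RExp → ℕ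
  | .zero => 1
  | .one => 1
  | .cell _ i j => i.cost + j.cost + 1
  | .add e₁ e₂ => e₁.cost + e₂.cost + 1
  | .sub e₁ e₂ => e₁.cost + e₂.cost + 1
  | .mul e₁ e₂ => e₁.cost + e₂.cost + 1
  | .div e₁ e₂ => e₁.cost + e₂.cost + 1

/-- Tests. -/
inductive BExp where
  | ilt (e₁ e₂ : IExp)
  | rlt (e₁ e₂ : RExp)
  | not (b : BExp)
  | and (b₁ b₂ : BExp)

/-- Truth of a test. -/
def BExp.Holds (s : State) : BExp → Prop
  | .ilt e₁ e₂ => e₁.eval s < e₂.eval s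
  | .rlt e₁ e₂ => e₁.eval s < e₂.eval s
  | .not b => ¬ b.Holds s
  | .and b₁ b₂ => b₁.Holds s ∧ b₂.Holds s

/-- Number of operations in a test. -/
def BExp.cost : BExp → ℕ
  | .ilt e₁ e₂ => e₁.cost + e₂.cost + 1
  | .rlt e₁ e₂ => e₁.cost + e₂.cost + 1
  | .not b => b.cost + 1
  | .and b₁ b₂ => b₁.cost + b₂.cost + 1

/-- The `k`-th (from `k = 0`, in increasing order with multiplicity) real root of the polynomial
`c 0 + c 1 T + ⋯ + c d T ^ d`, and `0` if there is none. -/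
noncomputable def kthRoot (c : ℕ → ℝ) (d k : ℕ) : ℝ :=
  ((∑ i ∈ Finset.range (d + 1), Polynomial.C (c i) * Polynomial.X ^ i :
    Polynomial ℝ).roots.sort (· ≤ ·)).getD k 0

/-- Programs.  `root a i j b r d k` writes into cell `(i, j)` of array `a` the `k`-th real root of
the polynomial of degree at most `d` whose coefficients are in row `r` of array `b`. -/
inductive Cmd where
  | skip
  | iset (v : ℕ) (e : IExp)
  | rset (a : ℕ) (i j : IExp) (e : RExp)
  | root (a : ℕ) (i j : IExp) (b : ℕ) (r d k : IExp)
  | seq (c₁ c₂ : Cmd)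
  | ite (b : BExp) (c₁ c₂ : Cmd)
  | loop (b : BExp) (c : Cmd)

/-- Assign an index variable. -/
def State.setIdx (s : State) (v n : ℕ) : State :=
  { s with idx := Function.update s.idx v n }

/-- Assign a real cell. -/
def State.setMem (s : State) (a i j : ℕ) (x : ℝ) : State :=
  { s with mem := fun a' i' j' => if a' = a ∧ i' = i ∧ j' = j then x else s.mem a' i' j' }

/-- `Exec c s t s'`: started in `s`, the program `c` halts in `s'` after `t` steps.  Every
operation on indices or reals, comparison and assignment counts as one step; extracting a root of
a polynomial of degree at most `d` counts as `d + 1` steps. -/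
inductive Exec : Cmd → State → ℕ → State → Prop where
  | skip (s : State) : Exec .skip s 1 s
  | iset (v : ℕ) (e : IExp) (s : State) :
      Exec (.iset v e) s (e.cost + 1) (s.setIdx v (e.eval s))
  | rset (a : ℕ) (i j : IExp) (e : RExp) (s : State) :
      Exec (.rset a i j e) s (i.cost + j.cost + e.cost + 1)
        (s.setMem a (i.eval s) (j.eval s) (e.eval s))
  | root (a : ℕ) (i j : IExp) (b : ℕ) (r d k : IExp) (s : State) :
      Exec (.root a i j b r d k) s
        (i.cost + j.cost + r.cost + d.cost + k.cost + (d.eval s + 1))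
        (s.setMem a (i.eval s) (j.eval s)
          (kthRoot (fun l => s.mem b (r.eval s) l) (d.eval s) (k.eval s)))
  | seq {c₁ c₂ : Cmd} {s₁ s₂ s₃ : State} {t₁ t₂ : ℕ} :
      Exec c₁ s₁ t₁ s₂ → Exec c₂ s₂ t₂ s₃ → Exec (.seq c₁ c₂) s₁ (t₁ + t₂) s₃
  | ite_true {b : BExp} {c₁ c₂ : Cmd} {s s' : State} {t : ℕ} :
      b.Holds s → Exec c₁ s t s' → Exec (.ite b c₁ c₂) s (b.cost + t) s'
  | ite_false {b : BExp} {c₁ c₂ : Cmd} {s s' : State} {t : ℕ} :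
      ¬ b.Holds s → Exec c₂ s t s' → Exec (.ite b c₁ c₂) s (b.cost + t) s'
  | loop_true {b : BExp} {c : Cmd} {s₁ s₂ s₃ : State} {t₁ t₂ : ℕ} :
      b.Holds s₁ → Exec c s₁ t₁ s₂ → Exec (.loop b c) s₂ t₂ s₃ →
        Exec (.loop b c) s₁ (b.cost + t₁ + t₂) s₃
  | loop_false {b : BExp} {c : Cmd} {s : State} :
      ¬ b.Holds s → Exec (.loop b c) s b.cost s

open Classical in
/-- The input, for listings of the elements of `X` and `Y`: the sizes in index variables `0` and
`1`, the table of `p` in array `0`, the tables (of zeros and ones) of the two partial orders in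
arrays `1` and `2`, and zero everywhere else. -/
noncomputable def inputState {X Y : Type*} [PartialOrder X] [PartialOrder Y] {m n : ℕ}
    (p : X → Y → ℝ) (eX : Fin m ≃ X) (eY : Fin n ≃ Y) : State where
  idx v := if v = 0 then m else if v = 1 then n else 0
  mem a i j :=
    if a = 0 then
      if h : i < m ∧ j < n then p (eX ⟨i, h.1⟩) (eY ⟨j, h.2⟩) else 0
    else if a = 1 then
      if h : i < m ∧ j < m then (if eX ⟨i, h.1⟩ ≤ eX ⟨j, h.2⟩ then 1 else 0) else 0
    else if a = 2 then
      if h : i < n ∧ j < n then (if eY ⟨i, h.1⟩ ≤ eY ⟨j, h.2⟩ then 1 else 0) else 0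
    else 0

end MonoCorr

set_option linter.unusedSectionVars false

open Filter Topology

/-! ### Optimality conditions for a correlation maximised over two polyhedral cones -/

namespace MonoCorr

/-! The point is that the relaxed problem is exact at a suitable optimum. Let `σ` be the maximal
correlation over the two cones of monotone functions and `(f, g)` a normalised maximiser, which
exists by compactness after centring. The directions along which the active order constraints stay
equalities form two subspaces (`PairForm.face`), and merging the strict relations between symbols of
positive probability on which `f`, `g` are constant gives a relaxed problem over exactly these
subspaces (`feasible_mergeSet_iff`). Small moves inside them, in either direction, stay in the
cones. Hence the first variation vanishes, `B v g = σ Q v f`, and the second variation bounds `B` on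
the complements of `f` and `g`. Cauchy–Schwarz combines the two into `|B v w| ≤ |σ| ‖v‖ ‖w‖` on the
faces (`Optimal.abs_B_le`). So for `σ > 0` the relaxed value is `σ`.

An arbitrary optimizer `(v, w)` of the relaxed problem must also be monotone. For this `(f, g)` is
chosen with as many active constraints as possible (`Tight`). If `(v, w)` left the cones, one could
follow `(f + s v, g + s w)` up to the first new active constraint. The pair there is still optimal,
because the pairing equals `σ` times the arithmetic mean of the two squared norms and so is at least
`σ` times the product of the norms; this contradicts maximality. The only escape is that one of the
two moving vectors becomes null, and then `(-v, -w)` lies in the cones (`Tight.mem_cones_of_pos`).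
For `σ ≤ 0` one function can be moved alone, so every face vector lies in the cone up to sign
(`Tight.mem_cone_of_nonpos`). Moreover `|B v w|` equals `|σ| ‖v‖ ‖w‖` on the faces, so any merged
pair with the right signs is optimal.

For the algorithm, a merging of symbols gives a symmetric matrix on the classes, the centred kernel
scaled by square roots of class weights. The tight pair is an eigenvector with eigenvalue `σ`
(`IsMerging.eigen`), and for `σ > 0` every eigenvector with that eigenvalue gives an optimal
monotone pair (`IsMerging.of_eigen`). Such an eigenvector is found exactly. A start vector `h` is
orthogonalised along its Krylov sequence until it gives zero, which yields a polynomial annihilating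
`h`. Its roots contain every eigenvalue that `h` sees, and applying `T - μ` for all roots `μ ≠ σ`
projects `h`, up to a nonzero factor, to the eigenspace (`deflate_eigen`, `deflate_ne_zero`). The
value `σ` is not known, so every root is tried; some unit vector works as a start. For `σ ≤ 0`
signed sums of two class indicators suffice (`IsMerging.of_nonpos`).

The program keeps a running maximum over all candidates that pass an explicit test of monotonicity
and positive variance. Soundness needs only the test (`safe_testProg`); completeness needs one good
candidate (`reach_roundProg`). All loops are polynomially bounded except the one over selections of
relations. -/

/-- Two positive semidefinite forms, a pairing, and two polyhedral cones. -/
structure PairForm (V W I J : Type*) [AddCommGroup V] [Module ℝ V] [AddCommGroup W]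
    [Module ℝ W] where
  Q : V →ₗ[ℝ] V →ₗ[ℝ] ℝ
  R : W →ₗ[ℝ] W →ₗ[ℝ] ℝ
  B : V →ₗ[ℝ] W →ₗ[ℝ] ℝ
  a : I → V →ₗ[ℝ] ℝ
  b : J → W →ₗ[ℝ] ℝ
  Q_symm : ∀ v v', Q v v' = Q v' v
  R_symm : ∀ w w', R w w' = R w' w
  Q_nonneg : ∀ v, 0 ≤ Q v v
  R_nonneg : ∀ w, 0 ≤ R w w
  -- The forms are only semidefinite, since almost surely constant functions have norm zero. The
  -- next four fields make null vectors invisible to the pairing and to the constraints, which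
  -- replaces a passage to quotient spaces.
  B_null_left : ∀ v w, Q v v = 0 → B v w = 0
  B_null_right : ∀ v w, R w w = 0 → B v w = 0
  a_null : ∀ v i, Q v v = 0 → a i v = 0
  b_null : ∀ w j, R w w = 0 → b j w = 0

namespace PairForm

variable {V W I J : Type*} [AddCommGroup V] [Module ℝ V] [AddCommGroup W] [Module ℝ W]
  (D : PairForm V W I J)

/-- Exchange of the two spaces. -/
def swap : PairForm W V J I where
  Q := D.R
  R := D.Q
  B := D.B.flip
  a := D.b
  b := D.a
  Q_symm := D.R_symm
  R_symm := D.Q_symm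
  Q_nonneg := D.R_nonneg
  R_nonneg := D.Q_nonneg
  B_null_left := fun v w h => D.B_null_right w v h
  B_null_right := fun v w h => D.B_null_left w v h
  a_null := D.b_null
  b_null := D.a_null

/-- `(f, g)` is a normalised maximiser of the correlation over the two cones, with value `σ`. -/
structure Optimal (σ : ℝ) (f : V) (g : W) : Prop where
  hf : ∀ i, 0 ≤ D.a i f
  hg : ∀ j, 0 ≤ D.b j g
  Qf : D.Q f f = 1
  Rg : D.R g g = 1
  Bfg : D.B f g = σ
  -- The bound is homogeneous and free of division, so perturbed pairs can be inserted without
  -- normalising them.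
  le : ∀ f' g', (∀ i, 0 ≤ D.a i f') → (∀ j, 0 ≤ D.b j g') → 0 < D.Q f' f' → 0 < D.R g' g' →
    D.B f' g' ≤ σ * (√(D.Q f' f') * √(D.R g' g'))

/-- The directions along which the active constraints at `f` stay active. -/
def face (f : V) : Submodule ℝ V where
  carrier := {v | ∀ i, D.a i f = 0 → D.a i v = 0}
  add_mem' := by
    intro x y hx hy i hi
    simp [hx i hi, hy i hi]
  zero_mem' := by intro i _; simp
  smul_mem' := by
    intro c x hx i hi
    simp [hx i hi]

variable {D} {σ : ℝ} {f : V} {g : W}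

theorem self_mem_face : f ∈ D.face f := fun _ h => h

theorem Optimal.swap (h : D.Optimal σ f g) : D.swap.Optimal σ g f where
  hf := h.hg
  hg := h.hf
  Qf := h.Rg
  Rg := h.Qf
  Bfg := h.Bfg
  le := by
    intro f' g' h1 h2 h3 h4
    have := h.le g' f' h2 h1 h4 h3
    rw [mul_comm (√(D.Q g' g'))] at this
    exact this

/-- Active constraints stay zero along a face direction, and the finitely many inactive ones keep
their strict sign for small `s`. The neighbourhood is two-sided, which later turns the first-order
inequality into an equality. -/
theorem eventually_mem_cone [Finite I] (hf : ∀ i, 0 ≤ D.a i f) {v : V} (hv : v ∈ D.face f) :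
    ∀ᶠ s in 𝓝 (0 : ℝ), ∀ i, 0 ≤ D.a i (f + s • v) := by
  rw [eventually_all]
  intro i
  rcases (hf i).eq_or_lt with h | h
  · refine Eventually.of_forall fun s => ?_
    simp [hv i h.symm, ← h]
  · have hc : ContinuousAt (fun s : ℝ => D.a i f + s * D.a i v) 0 := by fun_prop
    have : ∀ᶠ s in 𝓝 (0 : ℝ), 0 < D.a i f + s * D.a i v := by
      apply hc.eventually_const_lt
      simpa using h
    filter_upwards [this] with s hs
    simpa using hs.le

theorem Q_add_smul (u v : V) (s : ℝ) :
    D.Q (u + s • v) (u + s • v) = D.Q u u + 2 * s * D.Q u v + s ^ 2 * D.Q v v := by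
  simp only [map_add, map_smul, LinearMap.add_apply, LinearMap.smul_apply, smul_eq_mul]
  rw [D.Q_symm v u]
  ring

/-- Along `u` orthogonal to `f` the norm changes only to second order, whereas the pairing with `g`
changes by `s * B u g`. Since both signs of `s` are allowed, this linear term must vanish. -/
theorem Optimal.ortho_first_order [Finite I] (h : D.Optimal σ f g) {u : V} (hu : u ∈ D.face f)
    (hQ : D.Q f u = 0) : D.B u g = 0 := by
  set c := D.B u g
  set q := D.Q u u
  have hq : 0 ≤ q := D.Q_nonneg u
  -- The sign of `σ` is not known, so the square root is trapped between `1` and `1 + s ^ 2 * q`,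
  -- and `|σ|` is used.
  have key : ∀ᶠ s in 𝓝 (0 : ℝ), (0 : ℝ) ≤ |σ| * q * s ^ 2 - s * c := by
    filter_upwards [eventually_mem_cone h.hf hu] with s hs
    have hQs : D.Q (f + s • u) (f + s • u) = 1 + s ^ 2 * q := by
      rw [Q_add_smul, hQ, h.Qf]; ring
    have hp : 0 ≤ s ^ 2 * q := by positivity
    have := h.le (f + s • u) g hs h.hg (by rw [hQs]; positivity) (by rw [h.Rg]; norm_num)
    rw [hQs, h.Rg] at this
    simp only [map_add, map_smul, LinearMap.add_apply, LinearMap.smul_apply, smul_eq_mul,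
      h.Bfg, Real.sqrt_one, mul_one] at this
    have h1 : 1 ≤ √(1 + s ^ 2 * q) := Real.one_le_sqrt.2 (by linarith)
    have h2 : √(1 + s ^ 2 * q) ≤ 1 + s ^ 2 * q := by
      rw [Real.sqrt_le_left (by positivity)]
      nlinarith
    have h3 : σ * (√(1 + s ^ 2 * q) - 1) ≤ |σ| * (s ^ 2 * q) := by
      calc _ ≤ |σ| * (√(1 + s ^ 2 * q) - 1) :=
            mul_le_mul_of_nonneg_right (le_abs_self σ) (by linarith)
        _ ≤ _ := mul_le_mul_of_nonneg_left (by linarith) (abs_nonneg σ)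
    nlinarith
  have hmin : IsLocalMin (fun s : ℝ => |σ| * q * s ^ 2 - s * c) 0 := by
    filter_upwards [key] with s hs
    simpa using hs
  have hd : HasDerivAt (fun s : ℝ => |σ| * q * s ^ 2 - s * c) (-c) 0 := by
    have := (((hasDerivAt_id (0 : ℝ)).pow 2).const_mul (|σ| * q)).sub
      ((hasDerivAt_id (0 : ℝ)).mul_const c)
    refine (this.congr_deriv ?_).congr_of_eventuallyEq (Eventually.of_forall fun s => ?_) <;> simp
  have := hmin.hasDerivAt_eq_zero hd
  linarith

theorem sub_proj_ortho (hf : D.Q f f = 1) (v : V) : D.Q f (v - D.Q v f • f) = 0 := by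
  simp only [map_sub, map_smul, smul_eq_mul, hf, D.Q_symm v f]
  ring

theorem sub_proj_mem {v : V} (hv : v ∈ D.face f) (c : ℝ) : v - c • f ∈ D.face f :=
  Submodule.sub_mem _ hv (Submodule.smul_mem _ _ self_mem_face)

theorem Optimal.first_order [Finite I] (h : D.Optimal σ f g) {v : V} (hv : v ∈ D.face f) :
    D.B v g = σ * D.Q v f := by
  have := h.ortho_first_order (sub_proj_mem hv (D.Q v f)) (sub_proj_ortho h.Qf v)
  simp only [map_sub, map_smul, LinearMap.sub_apply, LinearMap.smul_apply, smul_eq_mul,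
    h.Bfg] at this
  linarith

theorem Optimal.first_order_right [Finite J] (h : D.Optimal σ f g) {w : W}
    (hw : w ∈ D.swap.face g) : D.B f w = σ * D.R w g :=
  h.swap.first_order hw

/-- When `u` and `k` have the same norm, the perturbed `f` and `g` do too, so the product of square
roots is a polynomial in `s`. The linear terms vanish by the first-order condition, and one small
positive `s` suffices. -/
theorem Optimal.second_order_eq [Finite I] [Finite J] (h : D.Optimal σ f g) {u : V} {k : W}
    (hu : u ∈ D.face f) (hk : k ∈ D.swap.face g) (hQ : D.Q f u = 0) (hR : D.R g k = 0)
    (hqq : D.Q u u = D.R k k) : D.B u k ≤ σ * D.Q u u := by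
  have hev := (eventually_mem_cone h.hf hu).and (eventually_mem_cone h.swap.hf hk)
  have hgt : ∀ᶠ s in 𝓝[>] (0 : ℝ), _ := (hev.filter_mono nhdsWithin_le_nhds).and
    self_mem_nhdsWithin
  obtain ⟨s, ⟨hs1, hs2⟩, hs0⟩ := hgt.exists
  have hs0 : 0 < s := hs0
  have hq := D.Q_nonneg u
  have hQs : D.Q (f + s • u) (f + s • u) = 1 + s ^ 2 * D.Q u u := by
    rw [Q_add_smul, hQ, h.Qf]; ring
  have hRs : D.R (g + s • k) (g + s • k) = 1 + s ^ 2 * D.Q u u := by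
    have : D.swap.Q (g + s • k) (g + s • k) = _ := Q_add_smul (D := D.swap) g k s
    rw [hqq]
    change D.R _ _ = D.R g g + 2 * s * D.R g k + s ^ 2 * D.R k k at this
    rw [this, hR, h.Rg]; ring
  have hp : 0 < 1 + s ^ 2 * D.Q u u := by positivity
  have := h.le (f + s • u) (g + s • k) hs1 hs2 (by rw [hQs]; exact hp) (by rw [hRs]; exact hp)
  rw [hQs, hRs, Real.mul_self_sqrt hp.le] at this
  have h1 := h.ortho_first_order hu hQ
  have h2 : D.B f k = 0 := h.swap.ortho_first_order hk hR
  simp only [map_add, map_smul, LinearMap.add_apply, LinearMap.smul_apply, smul_eq_mul,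
    h.Bfg, h1, h2] at this
  have h3 : s ^ 2 * D.B u k ≤ s ^ 2 * (σ * D.Q u u) := by nlinarith
  exact le_of_mul_le_mul_left h3 (by positivity)

theorem Optimal.second_order [Finite I] [Finite J] (h : D.Optimal σ f g) {u : V} {k : W}
    (hu : u ∈ D.face f) (hk : k ∈ D.swap.face g) (hQ : D.Q f u = 0) (hR : D.R g k = 0) :
    D.B u k ≤ σ * (√(D.Q u u) * √(D.R k k)) := by
  rcases (D.Q_nonneg u).eq_or_lt with h0 | h0
  · rw [D.B_null_left u k h0.symm, ← h0]; simp
  rcases (D.R_nonneg k).eq_or_lt with h1 | h1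
  · rw [D.B_null_right u k h1.symm, ← h1]; simp
  set x := √(D.Q u u) with hx
  set y := √(D.R k k) with hy
  have hx0 : 0 < x := Real.sqrt_pos.2 h0
  have hy0 : 0 < y := Real.sqrt_pos.2 h1
  have hxx : D.Q u u = x * x := (Real.mul_self_sqrt h0.le).symm
  have hyy : D.R k k = y * y := (Real.mul_self_sqrt h1.le).symm
  -- Cross-scaling by each other's norm makes the two norms equal.
  have := h.second_order_eq (u := y • u) (k := x • k) (Submodule.smul_mem _ _ hu)
    (Submodule.smul_mem _ _ hk) (by simp [hQ]) (by simp [hR])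
    (by simp only [map_smul, LinearMap.smul_apply, smul_eq_mul, hxx, hyy]; ring)
  simp only [map_smul, LinearMap.smul_apply, smul_eq_mul, hxx] at this
  have h3 : (x * y) * D.B u k ≤ (x * y) * (σ * (x * y)) := by nlinarith
  exact le_of_mul_le_mul_left h3 (by positivity)

theorem Q_decomp (hf : D.Q f f = 1) (v : V) :
    D.Q v v = D.Q v f ^ 2 + D.Q (v - D.Q v f • f) (v - D.Q v f • f) := by
  simp only [map_sub, map_smul, LinearMap.sub_apply, LinearMap.smul_apply, smul_eq_mul, hf,
    D.Q_symm f v]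
  ring

theorem Optimal.B_decomp [Finite I] [Finite J] (h : D.Optimal σ f g) {v : V} {w : W}
    (hv : v ∈ D.face f) (hw : w ∈ D.swap.face g) :
    D.B v w = σ * (D.Q v f * D.R w g) + D.B (v - D.Q v f • f) (w - D.R w g • g) := by
  simp only [map_sub, map_smul, LinearMap.sub_apply, LinearMap.smul_apply, smul_eq_mul,
    h.Bfg, h.first_order hv, h.first_order_right hw]
  ring

/-- Split `v` and `w` along `f`, `g` and their complements. The first-order condition removes the
mixed terms and the second-order condition bounds the remainder. -/
theorem Optimal.B_le [Finite I] [Finite J] (h : D.Optimal σ f g) {v : V} {w : W}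
    (hv : v ∈ D.face f) (hw : w ∈ D.swap.face g) :
    D.B v w ≤ |σ| * (√(D.Q v v) * √(D.R w w)) := by
  rw [h.B_decomp hv hw]
  have h1 := h.second_order (sub_proj_mem hv (D.Q v f)) (sub_proj_mem (D := D.swap) hw (D.R w g))
    (sub_proj_ortho h.Qf v) (sub_proj_ortho (D := D.swap) h.Rg w)
  have e1 := Q_decomp h.Qf v
  have e2 : D.R w w = D.R w g ^ 2 + D.R (w - D.R w g • g) (w - D.R w g • g) :=
    Q_decomp (D := D.swap) h.Rg w
  have n1 := D.Q_nonneg (v - D.Q v f • f)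
  have n2 := D.R_nonneg (w - D.R w g • g)
  rw [e1, e2]
  change D.B (v - D.Q v f • f) (w - D.R w g • g) ≤ _ at h1
  set q1 := D.Q (v - D.Q v f • f) (v - D.Q v f • f)
  set q2 := D.R (w - D.R w g • g) (w - D.R w g • g)
  set x := D.Q v f
  set y := D.R w g
  have h2 : σ * (√q1 * √q2) ≤ |σ| * (√q1 * √q2) :=
    mul_le_mul_of_nonneg_right (le_abs_self σ) (by positivity)
  have h3 : σ * (x * y) ≤ |σ| * |x * y| := by
    rw [← abs_mul]; exact le_abs_self _
  -- Cauchy–Schwarz in the plane for `(|x|, √q1)` and `(|y|, √q2)`.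
  have h4 : |x * y| + √q1 * √q2 ≤ √(x ^ 2 + q1) * √(y ^ 2 + q2) := by
    rw [← Real.sqrt_mul (show 0 ≤ x ^ 2 + q1 by positivity)]
    apply Real.le_sqrt_of_sq_le
    have a1 := Real.sq_sqrt n1
    have a2 := Real.sq_sqrt n2
    rw [abs_mul, ← sq_abs x, ← sq_abs y]
    nth_rw 2 [← a1]
    nth_rw 2 [← a2]
    nlinarith [sq_nonneg (|x| * √q2 - |y| * √q1)]
  nlinarith [mul_le_mul_of_nonneg_left h4 (abs_nonneg σ)]

theorem Optimal.abs_B_le [Finite I] [Finite J] (h : D.Optimal σ f g) {v : V} {w : W}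
    (hv : v ∈ D.face f) (hw : w ∈ D.swap.face g) :
    |D.B v w| ≤ |σ| * (√(D.Q v v) * √(D.R w w)) := by
  rw [abs_le']
  refine ⟨h.B_le hv hw, ?_⟩
  have := h.B_le (v := -v) (Submodule.neg_mem _ hv) hw
  simpa using this

/-- Adding a multiple of `u` orthogonal to `f` leaves the pairing with `g` unchanged and lengthens
`f`. A negative quotient would thereby increase, unless `u` is null. So for `σ < 0` the face is the
line of `f` modulo null vectors. -/
theorem Optimal.null_of_neg [Finite I] (h : D.Optimal σ f g) (hσ : σ < 0) {v : V}
    (hv : v ∈ D.face f) : D.Q (v - D.Q v f • f) (v - D.Q v f • f) = 0 := by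
  set u := v - D.Q v f • f
  have hu : u ∈ D.face f := sub_proj_mem hv _
  have hQ : D.Q f u = 0 := sub_proj_ortho h.Qf v
  have hgt : ∀ᶠ s in 𝓝[>] (0 : ℝ), _ :=
    ((eventually_mem_cone h.hf hu).filter_mono nhdsWithin_le_nhds).and self_mem_nhdsWithin
  obtain ⟨s, hs1, hs0⟩ := hgt.exists
  have hs0 : 0 < s := hs0
  have hq := D.Q_nonneg u
  have hQs : D.Q (f + s • u) (f + s • u) = 1 + s ^ 2 * D.Q u u := by
    rw [Q_add_smul, hQ, h.Qf]; ring
  have hp : 0 < 1 + s ^ 2 * D.Q u u := by positivity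
  have := h.le (f + s • u) g hs1 h.hg (by rw [hQs]; exact hp) (by rw [h.Rg]; norm_num)
  rw [hQs, h.Rg] at this
  simp only [map_add, map_smul, LinearMap.add_apply, LinearMap.smul_apply, smul_eq_mul,
    h.Bfg, h.ortho_first_order hu hQ, Real.sqrt_one, mul_one, mul_zero, add_zero] at this
  have h1 : √(1 + s ^ 2 * D.Q u u) ≤ 1 := by nlinarith
  have h2 : 1 + s ^ 2 * D.Q u u ≤ 1 := by simpa using (Real.sqrt_le_left zero_le_one).1 h1
  exact le_antisymm (nonpos_of_mul_nonpos_right (by linarith) (pow_pos hs0 2)) hq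

/-- For `σ = 0` the general bound already forces `B v w = 0`. For `σ < 0` both faces are lines
modulo null vectors, on which the correlation is `±σ`. -/
theorem Optimal.abs_B_of_nonpos [Finite I] [Finite J] (h : D.Optimal σ f g) (hσ : σ ≤ 0)
    {v : V} {w : W} (hv : v ∈ D.face f) (hw : w ∈ D.swap.face g) :
    |D.B v w| = |σ| * (√(D.Q v v) * √(D.R w w)) := by
  rcases hσ.eq_or_lt with h0 | h0
  · have := h.abs_B_le hv hw
    rw [h0] at this ⊢
    simp only [abs_zero, zero_mul] at this ⊢
    exact le_antisymm this (abs_nonneg _)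
  · have n1 := h.null_of_neg h0 hv
    have n2 : D.R (w - D.R w g • g) (w - D.R w g • g) = 0 := h.swap.null_of_neg h0 hw
    have e1 := Q_decomp h.Qf v
    have e2 : D.R w w = D.R w g ^ 2 + D.R (w - D.R w g • g) (w - D.R w g • g) :=
      Q_decomp (D := D.swap) h.Rg w
    rw [h.B_decomp hv hw, D.B_null_left _ _ n1, e1, e2, n1, n2]
    simp [abs_mul, Real.sqrt_sq_eq_abs]

/-! ### Optimal pairs with the largest number of active constraints -/

/-- First time at which a moving point leaves a polyhedral cone. -/
theorem exists_first_hit {ι : Type*} [Finite ι] (α β : ι → ℝ) (hα : ∀ i, 0 ≤ α i)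
    (hαβ : ∀ i, α i = 0 → β i = 0) (hβ : ∃ i, β i < 0) :
    ∃ s : ℝ, 0 < s ∧ (∀ i, 0 ≤ α i + s * β i) ∧ ∃ j, 0 < α j ∧ α j + s * β j = 0 := by
  have hfin : {i | β i < 0}.Finite := Set.toFinite _
  -- The hitting time is the least ratio `α i / -β i` over the decreasing constraints. It is
  -- positive because constraints with `α i = 0` do not move.
  obtain ⟨j, hj, hmin⟩ := Set.exists_min_image _ (fun i => α i / -β i) hfin hβ
  have hj : β j < 0 := hj
  have hαj : 0 < α j := lt_of_le_of_ne (hα j) fun h => by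
    rw [hαβ j h.symm] at hj
    exact lt_irrefl _ hj
  refine ⟨α j / -β j, div_pos hαj (by linarith), fun i => ?_, j, hαj, ?_⟩
  · rcases lt_or_ge (β i) 0 with hi | hi
    · have := hmin i hi
      rw [le_div_iff₀ (by linarith)] at this
      linarith
    · have := hα i
      have : 0 ≤ α j / -β j := (div_pos hαj (by linarith)).le
      positivity
  · have : β j ≠ 0 := hj.ne
    field_simp
    ring

/-- Number of active constraints. -/
noncomputable def active (D : PairForm V W I J) (f : V) (g : W) : ℕ :=
  {i | D.a i f = 0}.ncard + {j | D.b j g = 0}.ncard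

/-- An optimal pair with as many active constraints as possible. -/
structure Tight (D : PairForm V W I J) (σ : ℝ) (f : V) (g : W) : Prop
    extends D.Optimal σ f g where
  max_active : ∀ f' g', D.Optimal σ f' g' → D.active f' g' ≤ D.active f g

theorem Tight.swap (h : D.Tight σ f g) : D.swap.Tight σ g f where
  toOptimal := h.toOptimal.swap
  max_active := by
    intro f' g' h'
    have := h.max_active g' f' h'.swap
    unfold active at this ⊢
    rw [add_comm, add_comm (Set.ncard {i | D.swap.a i g = 0})]
    exact this

theorem Optimal.exists_tight [Finite I] [Finite J] (h : D.Optimal σ f g) :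
    ∃ f' g', D.Tight σ f' g' := by
  have hb : BddAbove {n | ∃ f g, D.Optimal σ f g ∧ D.active f g = n} := by
    refine ⟨Nat.card I + Nat.card J, ?_⟩
    rintro n ⟨f, g, -, rfl⟩
    exact add_le_add (Set.ncard_le_card _) (Set.ncard_le_card _)
  have hne : {n | ∃ f g, D.Optimal σ f g ∧ D.active f g = n}.Nonempty := ⟨_, f, g, h, rfl⟩
  obtain ⟨f', g', h', he⟩ := Nat.sSup_mem hne hb
  refine ⟨f', g', h', fun f'' g'' h'' => ?_⟩
  rw [he]
  exact le_csSup hb ⟨f'', g'', h'', rfl⟩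

/-- A normalised version of a feasible pair that is at least as good as the optimum. -/
theorem Optimal.of_ge (h : D.Optimal σ f g) {f' : V} {g' : W} (hf : ∀ i, 0 ≤ D.a i f')
    (hg : ∀ j, 0 ≤ D.b j g') (hQ : 0 < D.Q f' f') (hR : 0 < D.R g' g')
    (hB : σ * (√(D.Q f' f') * √(D.R g' g')) ≤ D.B f' g') :
    D.Optimal σ ((√(D.Q f' f'))⁻¹ • f') ((√(D.R g' g'))⁻¹ • g') := by
  have hx0 : 0 < √(D.Q f' f') := Real.sqrt_pos.2 hQ
  have hy0 : 0 < √(D.R g' g') := Real.sqrt_pos.2 hR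
  have hB := le_antisymm hB (h.le f' g' hf hg hQ hR)
  have hxx : D.Q f' f' = √(D.Q f' f') * √(D.Q f' f') := (Real.mul_self_sqrt hQ.le).symm
  have hyy : D.R g' g' = √(D.R g' g') * √(D.R g' g') := (Real.mul_self_sqrt hR.le).symm
  set x := √(D.Q f' f')
  set y := √(D.R g' g')
  refine ⟨fun i => ?_, fun j => ?_, ?_, ?_, ?_, h.le⟩
  · simp only [map_smul, smul_eq_mul]; exact mul_nonneg (inv_nonneg.2 hx0.le) (hf i)
  · simp only [map_smul, smul_eq_mul]; exact mul_nonneg (inv_nonneg.2 hy0.le) (hg j)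
  · simp only [map_smul, LinearMap.smul_apply, smul_eq_mul, hxx]; field_simp
  · simp only [map_smul, LinearMap.smul_apply, smul_eq_mul, hyy]; field_simp
  · simp only [map_smul, LinearMap.smul_apply, smul_eq_mul, ← hB]; field_simp

/-- The normalised pair is again optimal, and lying in the faces it keeps all active constraints of
`(f, g)`. Maximality of the count forces the active sets to coincide. -/
theorem Tight.not_more_active [Finite I] [Finite J] (h : D.Tight σ f g) {f' : V} {g' : W}
    (hf : ∀ i, 0 ≤ D.a i f') (hg : ∀ j, 0 ≤ D.b j g') (hQ : 0 < D.Q f' f') (hR : 0 < D.R g' g')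
    (hB : σ * (√(D.Q f' f') * √(D.R g' g')) ≤ D.B f' g')
    (hf1 : f' ∈ D.face f) (hg1 : g' ∈ D.swap.face g) :
    (∀ i, D.a i f' = 0 → D.a i f = 0) ∧ ∀ j, D.b j g' = 0 → D.b j g = 0 := by
  have := h.max_active _ _ (h.toOptimal.of_ge hf hg hQ hR hB)
  have hx0 : (√(D.Q f' f'))⁻¹ ≠ 0 := inv_ne_zero (Real.sqrt_pos.2 hQ).ne'
  have hy0 : (√(D.R g' g'))⁻¹ ≠ 0 := inv_ne_zero (Real.sqrt_pos.2 hR).ne'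
  unfold active at this
  simp only [map_smul, smul_eq_mul, mul_eq_zero, hx0, hy0, false_or] at this
  have s1 : {i | D.a i f = 0} ⊆ {i | D.a i f' = 0} := fun i hi => hf1 i hi
  have s2 : {j | D.b j g = 0} ⊆ {j | D.b j g' = 0} := fun j hj => hg1 j hj
  have c1 := Set.ncard_le_ncard s1 (Set.toFinite _)
  have c2 := Set.ncard_le_ncard s2 (Set.toFinite _)
  have e1 := Set.eq_of_subset_of_ncard_le s1 (by omega) (Set.toFinite _)
  have e2 := Set.eq_of_subset_of_ncard_le s2 (by omega) (Set.toFinite _)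
  exact ⟨fun i hi => e1.symm.subset hi, fun j hj => e2.symm.subset hj⟩

/-- Move `f` alone along `v` to the first new active constraint. For `σ ≤ 0` the pair stays optimal,
which tightness forbids, so the moved vector must be null; then every constraint takes opposite
signs on `f` and `v`, and `-v` is in the cone. -/
theorem Tight.mem_cone_of_nonpos [Finite I] [Finite J] (h : D.Tight σ f g) (hσ : σ ≤ 0) {v : V}
    (hv : v ∈ D.face f) : (∀ i, 0 ≤ D.a i v) ∨ ∀ i, 0 ≤ D.a i (-v) := by
  by_cases hβ : ∃ i, D.a i v < 0
  swap
  · left; push Not at hβ; exact hβ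
  right
  obtain ⟨s, hs, hcone, j, hj, hj0⟩ := exists_first_hit (fun i => D.a i f) (fun i => D.a i v)
    h.hf hv hβ
  have hcone' : ∀ i, 0 ≤ D.a i (f + s • v) := fun i => by simpa using hcone i
  rcases (D.Q_nonneg (f + s • v)).eq_or_lt with h0 | h0
  · intro i
    have := D.a_null _ i h0.symm
    have hf := h.hf i
    simp only [map_add, map_smul, smul_eq_mul, map_neg] at this ⊢
    have : 0 ≤ s * -(D.a i v) := by linarith
    exact nonneg_of_mul_nonneg_right this hs
  · exfalso
    have hmem : f + s • v ∈ D.face f :=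
      Submodule.add_mem _ self_mem_face (Submodule.smul_mem _ _ hv)
    -- Cauchy–Schwarz bounds `Q (f + s • v) f` by the norm of `f + s • v`, and multiplication by `σ
    -- ≤ 0` reverses the inequality in the useful direction.
    have hge : σ * (√(D.Q (f + s • v) (f + s • v)) * √(D.R g g)) ≤ D.B (f + s • v) g := by
      rw [h.first_order hmem, h.Rg, Real.sqrt_one, mul_one]
      apply mul_le_mul_of_nonpos_left _ hσ
      apply Real.le_sqrt_of_sq_le
      have := Q_decomp h.Qf (f + s • v)
      have := D.Q_nonneg (f + s • v - D.Q (f + s • v) f • f)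
      linarith
    have := (h.not_more_active hcone' h.hg h0 (by rw [h.Rg]; norm_num) hge hmem
      (self_mem_face (D := D.swap))).1 j (by simpa using hj0)
    exact hj.ne' this

/-- A null `f + s • v` with both vectors of norm one means `v = -f` modulo null vectors. Since `B v
w = σ` with `σ ≠ 0`, the splitting of `B` then gives `R w g = -1`, so `w = -g` modulo null vectors
as well. -/
theorem Optimal.neg_mem_of_null [Finite I] [Finite J] (h : D.Optimal σ f g) (hσ : 0 < σ) {v : V}
    {w : W} (hv : v ∈ D.face f) (hw : w ∈ D.swap.face g) (hQ : D.Q v v = 1) (hR : D.R w w = 1)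
    (hB : D.B v w = σ) {s : ℝ} (hs : 0 < s) (h0 : D.Q (f + s • v) (f + s • v) = 0) :
    (∀ i, 0 ≤ D.a i (-v)) ∧ ∀ j, 0 ≤ D.b j (-w) := by
  have hcs := Q_decomp h.Qf v
  have hnn := D.Q_nonneg (v - D.Q v f • f)
  have hexp := Q_add_smul (D := D) f v s
  rw [h0, h.Qf, hQ, D.Q_symm f v] at hexp
  -- The identity `1 + 2 s x + s ^ 2 = 0` with `s > 0` and `|x| ≤ 1` leaves only `x = -1`.
  have hx : D.Q v f = -1 := by nlinarith [sq_nonneg (s - 1), sq_nonneg (s * D.Q v f + 1)]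
  have h1 : ∀ i, D.a i f + s * D.a i v = 0 := fun i => by simpa using D.a_null _ i h0
  refine ⟨fun i => ?_, fun j => ?_⟩
  · have hf := h.hf i
    have : 0 ≤ s * -(D.a i v) := by linarith [h1 i]
    simpa using nonneg_of_mul_nonneg_right this hs
  · have hd := h.B_decomp hv hw
    have hz : D.Q (v - D.Q v f • f) (v - D.Q v f • f) = 0 := by
      rw [hQ, hx] at hcs; rw [hx]; linarith
    rw [D.B_null_left _ _ hz, hB, hx] at hd
    have hy : D.R w g = -1 := by
      have : σ * (D.R w g + 1) = 0 := by linarith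
      rcases mul_eq_zero.1 this with h | h <;> linarith
    have e2 : D.R w w = D.R w g ^ 2 + D.R (w - D.R w g • g) (w - D.R w g • g) :=
      Q_decomp (D := D.swap) h.Rg w
    rw [hR, hy] at e2
    have := D.b_null (w - (-1 : ℝ) • g) j (by linarith)
    have hg := h.hg j
    simp only [map_sub, map_smul, smul_eq_mul, map_neg] at this ⊢
    linarith

/-- Here both functions move at the same speed, so the sign found is common to `v` and `w`. This is
why equal signs suffice for a positive correlation. -/
theorem Tight.mem_cones_of_pos [Finite I] [Finite J] (h : D.Tight σ f g) (hσ : 0 < σ) {v : V}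
    {w : W} (hv : v ∈ D.face f) (hw : w ∈ D.swap.face g) (hQ : D.Q v v = 1) (hR : D.R w w = 1)
    (hB : D.B v w = σ) :
    ((∀ i, 0 ≤ D.a i v) ∧ ∀ j, 0 ≤ D.b j w) ∨
      ((∀ i, 0 ≤ D.a i (-v)) ∧ ∀ j, 0 ≤ D.b j (-w)) := by
  by_cases hβ : ∃ i, Sum.elim (fun i => D.a i v) (fun j => D.b j w) i < 0
  swap
  · left; push Not at hβ
    exact ⟨fun i => hβ (Sum.inl i), fun j => hβ (Sum.inr j)⟩
  right
  obtain ⟨s, hs, hcone, j, hj, hj0⟩ := exists_first_hit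
    (Sum.elim (fun i => D.a i f) fun j => D.b j g) (Sum.elim (fun i => D.a i v) fun j => D.b j w)
    (by rintro (i | j); exacts [h.hf i, h.hg j]) (by rintro (i | j); exacts [hv i, hw j]) hβ
  have hc1 : ∀ i, 0 ≤ D.a i (f + s • v) := fun i => by simpa using hcone (Sum.inl i)
  have hc2 : ∀ i, 0 ≤ D.b i (g + s • w) := fun i => by simpa using hcone (Sum.inr i)
  rcases (D.Q_nonneg (f + s • v)).eq_or_lt with h0 | h0
  · exact h.toOptimal.neg_mem_of_null hσ hv hw hQ hR hB hs h0.symm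
  rcases (D.R_nonneg (g + s • w)).eq_or_lt with h1 | h1
  · exact (h.toOptimal.swap.neg_mem_of_null hσ hw hv hR hQ hB hs h1.symm).symm
  exfalso
  have m1 : f + s • v ∈ D.face f :=
    Submodule.add_mem _ self_mem_face (Submodule.smul_mem _ _ hv)
  have m2 : g + s • w ∈ D.swap.face g :=
    Submodule.add_mem _ (self_mem_face (D := D.swap)) (Submodule.smul_mem _ _ hw)
  have q1 := Q_add_smul (D := D) f v s
  have q2 : D.R (g + s • w) (g + s • w) = D.R g g + 2 * s * D.R g w + s ^ 2 * D.R w w :=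
    Q_add_smul (D := D.swap) g w s
  -- The mixed terms `B v g` and `B f w` are `σ Q v f` and `σ R w g` by the first-order condition,
  -- and the pure terms are `σ` each. The pairing is therefore `σ` times the mean of the two squared
  -- norms, and the arithmetic–geometric mean inequality gives optimality.
  have hBe : D.B (f + s • v) (g + s • w) =
      σ * ((D.Q (f + s • v) (f + s • v) + D.R (g + s • w) (g + s • w)) / 2) := by
    rw [q1, q2, h.Qf, h.Rg, hQ, hR, D.Q_symm f v, D.R_symm g w]
    simp only [map_add, map_smul, LinearMap.add_apply, LinearMap.smul_apply, smul_eq_mul,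
      h.Bfg, hB, h.first_order hv, h.toOptimal.first_order_right hw]
    ring
  have hge : σ * (√(D.Q (f + s • v) (f + s • v)) * √(D.R (g + s • w) (g + s • w))) ≤
      D.B (f + s • v) (g + s • w) := by
    rw [hBe]
    apply mul_le_mul_of_nonneg_left _ hσ.le
    have a1 := Real.sq_sqrt h0.le
    have a2 := Real.sq_sqrt h1.le
    nlinarith [sq_nonneg (√(D.Q (f + s • v) (f + s • v)) - √(D.R (g + s • w) (g + s • w)))]
  have := h.not_more_active hc1 hc2 h0 h1 hge m1 m2
  rcases j with j | j
  · exact hj.ne' (this.1 j (by simpa using hj0))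
  · exact hj.ne' (this.2 j (by simpa using hj0))

end PairForm

end MonoCorr

open Filter Topology

namespace MonoCorr

/-! ### Covariance as a bilinear form, and attainment by compactness -/

section Covariance

variable {X Y : Type*} [Fintype X] [Fintype Y] {p : X → Y → ℝ}

theorem mean_add (F G : X → Y → ℝ) :
    mean p (fun x y => F x y + G x y) = mean p F + mean p G := by
  simp [mean, mul_add, Finset.sum_add_distrib]

theorem mean_mul_left (c : ℝ) (F : X → Y → ℝ) :
    mean p (fun x y => c * F x y) = c * mean p F := by
  simp only [mean, Finset.mul_sum]
  exact Finset.sum_congr rfl fun _ _ => Finset.sum_congr rfl fun _ _ => by ring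

theorem mean_const (hp : IsJointPMF p) (c : ℝ) : mean p (fun _ _ => c) = c := by
  simp only [mean, ← Finset.sum_mul, hp.sum_eq_one, one_mul]

theorem mean_sub (F G : X → Y → ℝ) :
    mean p (fun x y => F x y - G x y) = mean p F - mean p G := by
  simp [mean, mul_sub, Finset.sum_sub_distrib]

theorem mean_nonneg (hp : IsJointPMF p) {F : X → Y → ℝ} (hF : ∀ x y, 0 ≤ F x y) :
    0 ≤ mean p F :=
  Finset.sum_nonneg fun x _ => Finset.sum_nonneg fun y _ => mul_nonneg (hp.nonneg x y) (hF x y)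

theorem mean_congr {F G : X → Y → ℝ} (h : ∀ x y, p x y ≠ 0 → F x y = G x y) :
    mean p F = mean p G := by
  refine Finset.sum_congr rfl fun x _ => Finset.sum_congr rfl fun y _ => ?_
  by_cases h0 : p x y = 0
  · simp [h0]
  · rw [h x y h0]

theorem mean_swap (F : X → Y → ℝ) : mean (fun y x => p x y) (fun y x => F x y) = mean p F :=
  Finset.sum_comm

theorem IsJointPMF.swap (hp : IsJointPMF p) : IsJointPMF (fun y x => p x y) :=
  ⟨fun y x => hp.nonneg x y, by rw [Finset.sum_comm]; exact hp.sum_eq_one⟩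

theorem mean_swap_fst (g : Y → ℝ) :
    mean (fun y x => p x y) (fun y _ => g y) = mean p fun _ y => g y :=
  mean_swap fun _ y => g y

theorem mean_swap_snd (f : X → ℝ) :
    mean (fun y x => p x y) (fun _ x => f x) = mean p fun x _ => f x :=
  mean_swap fun x _ => f x

theorem cov_swap (f : X → ℝ) (g : Y → ℝ) : cov (fun y x => p x y) g f = cov p f g := by
  rw [cov, cov, mean_swap_fst (p := p) g, mean_swap_snd (p := p) f]
  simp only [mul_comm (g _ - _)]
  exact mean_swap (p := p) fun x y =>
    (f x - mean p fun x' _ => f x') * (g y - mean p fun _ y' => g y')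

theorem varX_swap (g : Y → ℝ) : varX (fun y x => p x y) g = varY p g := by
  rw [varX, varY, mean_swap_fst (p := p) g]
  exact mean_swap (p := p) fun _ y => (g y - mean p fun _ y' => g y') ^ 2

theorem margX_nonneg (hp : IsJointPMF p) (x : X) : 0 ≤ margX p x :=
  Finset.sum_nonneg fun y _ => hp.nonneg x y

theorem margX_pos_of_ne (hp : IsJointPMF p) {x : X} {y : Y} (h : p x y ≠ 0) : 0 < margX p x :=
  lt_of_lt_of_le (lt_of_le_of_ne (hp.nonneg x y) h.symm)
    (Finset.single_le_sum (fun y _ => hp.nonneg x y) (Finset.mem_univ y))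

theorem margY_pos_of_ne (hp : IsJointPMF p) {x : X} {y : Y} (h : p x y ≠ 0) : 0 < margY p y :=
  margX_pos_of_ne hp.swap h

theorem mean_fst (f : X → ℝ) : mean p (fun x _ => f x) = ∑ x, margX p x * f x := by
  simp [mean, margX, Finset.sum_mul]

/-- Covariance of two functions of the pair, as a bilinear form. -/
noncomputable def covForm (p : X → Y → ℝ) : (X → Y → ℝ) →ₗ[ℝ] (X → Y → ℝ) →ₗ[ℝ] ℝ :=
  LinearMap.mk₂ ℝ (fun F G => mean p fun x y => (F x y - mean p F) * (G x y - mean p G))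
    (by
      intro F F' G
      rw [← mean_add]
      congr 1; ext x y
      have := mean_add (p := p) F F'
      simp only [Pi.add_apply]
      change mean p (F + F') = _ at this
      rw [this]; ring)
    (by
      intro c F G
      rw [smul_eq_mul, ← mean_mul_left]
      congr 1; ext x y
      have := mean_mul_left (p := p) c F
      simp only [Pi.smul_apply, smul_eq_mul]
      change mean p (c • F) = _ at this
      rw [this]; ring)
    (by
      intro G F F'
      rw [← mean_add]
      congr 1; ext x y
      have := mean_add (p := p) F F'
      simp only [Pi.add_apply]
      change mean p (F + F') = _ at this
      rw [this]; ring)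
    (by
      intro c G F
      rw [smul_eq_mul, ← mean_mul_left]
      congr 1; ext x y
      have := mean_mul_left (p := p) c F
      simp only [Pi.smul_apply, smul_eq_mul]
      change mean p (c • F) = _ at this
      rw [this]; ring)

theorem covForm_apply (F G : X → Y → ℝ) :
    covForm p F G = mean p fun x y => (F x y - mean p F) * (G x y - mean p G) := rfl

theorem covForm_eq (hp : IsJointPMF p) (F G : X → Y → ℝ) :
    covForm p F G = mean p (fun x y => F x y * G x y) - mean p F * mean p G := by
  have : ∀ x y, (F x y - mean p F) * (G x y - mean p G) =
      (F x y * G x y - mean p F * G x y) - (mean p G * F x y - mean p F * mean p G) := by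
    intros; ring
  simp only [covForm_apply, this, mean_sub, mean_mul_left, mean_const hp]
  ring

theorem covForm_symm (F G : X → Y → ℝ) : covForm p F G = covForm p G F := by
  simp only [covForm_apply, mul_comm]

theorem covForm_self_nonneg (hp : IsJointPMF p) (F : X → Y → ℝ) : 0 ≤ covForm p F F :=
  mean_nonneg hp fun _ _ => mul_self_nonneg _

theorem eq_mean_of_covForm_self (hp : IsJointPMF p) {F : X → Y → ℝ} (h : covForm p F F = 0)
    {x : X} {y : Y} (hxy : p x y ≠ 0) : F x y = mean p F := by
  have hnn : ∀ x y, 0 ≤ p x y * ((F x y - mean p F) * (F x y - mean p F)) :=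
    fun x y => mul_nonneg (hp.nonneg x y) (mul_self_nonneg _)
  rw [covForm_apply, mean, Finset.sum_eq_zero_iff_of_nonneg
    (fun x _ => Finset.sum_nonneg fun y _ => hnn x y)] at h
  have h1 := h x (Finset.mem_univ x)
  rw [Finset.sum_eq_zero_iff_of_nonneg (fun y _ => hnn x y)] at h1
  have h2 := h1 y (Finset.mem_univ y)
  rcases mul_eq_zero.1 h2 with h3 | h3
  · exact absurd h3 hxy
  · have := mul_self_eq_zero.1 h3; linarith

theorem covForm_null (hp : IsJointPMF p) {F : X → Y → ℝ} (h : covForm p F F = 0)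
    (G : X → Y → ℝ) : covForm p F G = 0 := by
  rw [covForm_apply, mean_congr (G := fun _ _ => 0), mean_const hp]
  intro x y hxy
  rw [eq_mean_of_covForm_self hp h hxy]; simp

/-- A function of the first coordinate, as a function of the pair. -/
def liftX (X Y : Type*) : (X → ℝ) →ₗ[ℝ] (X → Y → ℝ) where
  toFun f := fun x _ => f x
  map_add' _ _ := rfl
  map_smul' _ _ := rfl

/-- A function of the second coordinate, as a function of the pair. -/
def liftY (X Y : Type*) : (Y → ℝ) →ₗ[ℝ] (X → Y → ℝ) where
  toFun g := fun _ y => g y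
  map_add' _ _ := rfl
  map_smul' _ _ := rfl

theorem cov_eq (f : X → ℝ) (g : Y → ℝ) : cov p f g = covForm p (liftX X Y f) (liftY X Y g) := rfl

theorem varX_eq (f : X → ℝ) : varX p f = covForm p (liftX X Y f) (liftX X Y f) := by
  simp only [varX, pow_two]; rfl

theorem varY_eq (g : Y → ℝ) : varY p g = covForm p (liftY X Y g) (liftY X Y g) := by
  simp only [varY, pow_two]; rfl

theorem eq_mean_of_varX (hp : IsJointPMF p) {f : X → ℝ} (h : varX p f = 0) {x : X}
    (hx : 0 < margX p x) : f x = mean p fun x _ => f x := by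
  obtain ⟨y, -, hy⟩ := Finset.exists_ne_zero_of_sum_ne_zero hx.ne'
  rw [varX_eq] at h
  exact eq_mean_of_covForm_self hp h hy

theorem varX_eq_zero_iff (hp : IsJointPMF p) {f : X → ℝ} :
    varX p f = 0 ↔ ∀ x x', 0 < margX p x → 0 < margX p x' → f x = f x' := by
  refine ⟨fun h x x' hx hx' => (eq_mean_of_varX hp h hx).trans (eq_mean_of_varX hp h hx').symm,
    fun h => ?_⟩
  by_cases hX : ∃ x, 0 < margX p x
  · obtain ⟨x, hx⟩ := hX
    have h1 : mean p (fun x _ => f x) = f x := by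
      rw [mean_congr (G := fun _ _ => f x), mean_const hp]
      exact fun x' y hxy => h x' x (margX_pos_of_ne hp hxy) hx
    rw [varX, h1, mean_congr (G := fun _ _ => 0), mean_const hp]
    intro x' y hxy
    rw [h x' x (margX_pos_of_ne hp hxy) hx]; simp
  · rw [varX, mean_congr (G := fun _ _ => 0), mean_const hp]
    exact fun x y hxy => absurd ⟨x, margX_pos_of_ne hp hxy⟩ hX

theorem varX_congr (hp : IsJointPMF p) {f f' : X → ℝ} (h : ∀ x, 0 < margX p x → f x = f' x) :
    varX p f = varX p f' := by
  have : mean p (fun x _ => f x) = mean p fun x _ => f' x :=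
    mean_congr fun x y hxy => h x (margX_pos_of_ne hp hxy)
  unfold varX
  rw [this]
  exact mean_congr fun x y hxy => by rw [h x (margX_pos_of_ne hp hxy)]

theorem varY_congr (hp : IsJointPMF p) {g g' : Y → ℝ} (h : ∀ y, 0 < margY p y → g y = g' y) :
    varY p g = varY p g' := by
  rw [← varX_swap, ← varX_swap]
  exact varX_congr hp.swap h

theorem cov_congr (hp : IsJointPMF p) {f f' : X → ℝ} {g g' : Y → ℝ}
    (h : ∀ x, 0 < margX p x → f x = f' x) (h' : ∀ y, 0 < margY p y → g y = g' y) :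
    cov p f g = cov p f' g' := by
  have e1 : mean p (fun x _ => f x) = mean p fun x _ => f' x :=
    mean_congr fun x y hxy => h x (margX_pos_of_ne hp hxy)
  have e2 : mean p (fun _ y => g y) = mean p fun _ y => g' y :=
    mean_congr fun x y hxy => h' y (margY_pos_of_ne hp hxy)
  unfold cov
  rw [e1, e2]
  exact mean_congr fun x y hxy => by
    rw [h x (margX_pos_of_ne hp hxy), h' y (margY_pos_of_ne hp hxy)]

theorem cov_smul_smul (a b : ℝ) (f : X → ℝ) (g : Y → ℝ) :
    cov p (a • f) (b • g) = a * b * cov p f g := by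
  simp only [cov_eq, map_smul, LinearMap.smul_apply, smul_eq_mul]; ring

theorem varX_smul (a : ℝ) (f : X → ℝ) : varX p (a • f) = a ^ 2 * varX p f := by
  simp only [varX_eq, map_smul, LinearMap.smul_apply, smul_eq_mul]; ring

theorem varY_smul (a : ℝ) (g : Y → ℝ) : varY p (a • g) = a ^ 2 * varY p g := by
  simp only [varY_eq, map_smul, LinearMap.smul_apply, smul_eq_mul]; ring

theorem varX_nonneg (hp : IsJointPMF p) (f : X → ℝ) : 0 ≤ varX p f := by
  rw [varX_eq]; exact covForm_self_nonneg hp _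

theorem varY_nonneg (hp : IsJointPMF p) (g : Y → ℝ) : 0 ≤ varY p g := by
  rw [varY_eq]; exact covForm_self_nonneg hp _

theorem varX_neg (f : X → ℝ) : varX p (-f) = varX p f := by
  have := varX_smul (p := p) (-1) f
  simpa using this

theorem varY_neg (g : Y → ℝ) : varY p (-g) = varY p g := by
  have := varY_smul (p := p) (-1) g
  simpa using this

theorem cov_neg_neg (f : X → ℝ) (g : Y → ℝ) : cov p (-f) (-g) = cov p f g := by
  simp [cov_eq]

theorem sq_cov_le (hp : IsJointPMF p) (f : X → ℝ) (g : Y → ℝ) :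
    cov p f g ^ 2 ≤ varX p f * varY p g := by
  have h0 := covForm_self_nonneg hp (covForm p (liftY X Y g) (liftY X Y g) • liftX X Y f -
    covForm p (liftX X Y f) (liftY X Y g) • liftY X Y g)
  rw [cov_eq, varX_eq, varY_eq]
  rcases (covForm_self_nonneg hp (liftY X Y g)).eq_or_lt with h1 | h1
  · rw [covForm_symm, covForm_null hp h1.symm, ← h1]; simp
  · simp only [map_sub, map_smul, LinearMap.sub_apply, LinearMap.smul_apply, smul_eq_mul,
      covForm_symm (liftY X Y g) (liftX X Y f)] at h0
    by_contra! hlt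
    nlinarith

/-- The function `f` centred, and set to zero off the support. -/
noncomputable def centre (p : X → Y → ℝ) : (X → ℝ) →ₗ[ℝ] (X → ℝ) where
  toFun f := open Classical in
    fun x => if 0 < margX p x then f x - ∑ x', margX p x' * f x' else 0
  map_add' f g := by
    ext x
    by_cases h : 0 < margX p x
    · simp [h, mul_add, Finset.sum_add_distrib]; ring
    · simp [h]
  map_smul' c f := by
    ext x
    by_cases h : 0 < margX p x
    · simp only [h, if_true, Pi.smul_apply, smul_eq_mul, RingHom.id_apply, mul_sub,
        Finset.mul_sum]
      congr 1
      exact Finset.sum_congr rfl fun _ _ => by ring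
    · simp [h]

theorem centre_of_pos (f : X → ℝ) {x : X} (hx : 0 < margX p x) :
    centre p f x = f x - mean p fun x _ => f x := by
  rw [mean_fst]; simp [centre, hx]

theorem centre_of_not (f : X → ℝ) {x : X} (hx : ¬ 0 < margX p x) : centre p f x = 0 := by
  simp [centre, hx]

theorem mean_centre (hp : IsJointPMF p) (f : X → ℝ) : mean p (fun x _ => centre p f x) = 0 := by
  rw [mean_congr (G := fun x _ => f x - mean p fun x _ => f x), mean_sub, mean_const hp, sub_self]
  exact fun x y hxy => centre_of_pos f (margX_pos_of_ne hp hxy)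

theorem varX_sub_const (hp : IsJointPMF p) (f : X → ℝ) (c : ℝ) :
    varX p (fun x => f x - c) = varX p f := by
  unfold varX
  rw [mean_sub, mean_const hp]
  congr 1; ext x y; ring

theorem cov_sub_const_left (hp : IsJointPMF p) (f : X → ℝ) (g : Y → ℝ) (c : ℝ) :
    cov p (fun x => f x - c) g = cov p f g := by
  unfold cov
  rw [mean_sub, mean_const hp]
  congr 1; ext x y; ring

theorem varX_centre (hp : IsJointPMF p) (f : X → ℝ) : varX p (centre p f) = varX p f := by
  rw [← varX_sub_const hp f (mean p fun x _ => f x)]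
  exact varX_congr hp fun x hx => centre_of_pos f hx

theorem cov_centre_left (hp : IsJointPMF p) (f : X → ℝ) (g : Y → ℝ) :
    cov p (centre p f) g = cov p f g := by
  rw [← cov_sub_const_left hp f g (mean p fun x _ => f x)]
  exact cov_congr hp (fun x hx => centre_of_pos f hx) fun _ _ => rfl

theorem cov_centre_centre (hp : IsJointPMF p) (f : X → ℝ) (g : Y → ℝ) :
    cov p (centre p f) (centre (fun y x => p x y) g) = cov p f g := by
  rw [cov_centre_left hp, ← cov_swap, cov_centre_left hp.swap, cov_swap]

theorem centre_centre (hp : IsJointPMF p) (f : X → ℝ) : centre p (centre p f) = centre p f := by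
  ext x
  by_cases h : 0 < margX p x
  · rw [centre_of_pos _ h, mean_centre hp, sub_zero]
  · rw [centre_of_not _ h, centre_of_not _ h]

/-- The centred functions of unit variance that vanish off the support form a compact set. -/
theorem isCompact_centred (hp : IsJointPMF p) :
    IsCompact {f : X → ℝ | centre p f = f ∧ varX p f = 1} := by
  have hcont : Continuous fun f : X → ℝ => varX p f := by
    unfold varX mean; fun_prop
  have hcl : IsClosed {f : X → ℝ | centre p f = f ∧ varX p f = 1} :=
    (isClosed_eq (LinearMap.continuous_of_finiteDimensional _) continuous_id).inter
      (isClosed_eq hcont continuous_const)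
  -- Each term of `∑ margX * f ^ 2 = 1` gives `f x ^ 2 ≤ 1 / margX p x` on the support. The looser
  -- bound `1 + 1 / margX p x` on `|f x|` avoids square roots and remains a valid box where the
  -- marginal is zero, as `1 / 0 = 0`.
  refine IsCompact.of_isClosed_subset (isCompact_univ_pi fun x : X =>
    isCompact_Icc (a := -(1 + 1 / margX p x)) (b := 1 + 1 / margX p x)) hcl ?_
  rintro f ⟨hf, hv⟩ x -
  simp only [Set.mem_Icc, ← abs_le]
  by_cases h : 0 < margX p x
  · have h1 : varX p f = ∑ x, margX p x * f x ^ 2 := by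
      rw [← mean_fst, varX, ← hf, mean_centre hp]; simp
    rw [h1] at hv
    have h2 : margX p x * f x ^ 2 ≤ 1 := hv ▸ Finset.single_le_sum
      (f := fun x => margX p x * f x ^ 2)
      (fun x _ => mul_nonneg (margX_nonneg hp x) (sq_nonneg _)) (Finset.mem_univ x)
    have h3 : f x ^ 2 ≤ 1 / margX p x := by rw [le_div_iff₀ h]; linarith
    nlinarith [sq_nonneg (|f x| - 1), sq_abs (f x), abs_nonneg (f x)]
  · have : f x = 0 := by rw [← hf]; exact centre_of_not _ h
    rw [this, abs_zero]
    have := div_nonneg zero_le_one (margX_nonneg hp x)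
    linarith

theorem continuous_cov : Continuous fun fg : (X → ℝ) × (Y → ℝ) => cov p fg.1 fg.2 := by
  unfold cov mean; fun_prop

theorem exists_max_cov (hp : IsJointPMF p) {A : Set (X → ℝ)} {B : Set (Y → ℝ)} (hA : IsClosed A)
    (hB : IsClosed B) (hA' : ∀ f ∈ A, centre p f = f ∧ varX p f = 1)
    (hB' : ∀ g ∈ B, centre (fun y x => p x y) g = g ∧ varY p g = 1)
    (hAn : A.Nonempty) (hBn : B.Nonempty) :
    ∃ f ∈ A, ∃ g ∈ B, ∀ f' ∈ A, ∀ g' ∈ B, cov p f' g' ≤ cov p f g := by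
  have cA : IsCompact A := (isCompact_centred hp).of_isClosed_subset hA hA'
  have cB : IsCompact B := (isCompact_centred hp.swap).of_isClosed_subset hB fun g hg => by
    have := hB' g hg
    rwa [← varX_swap] at this
  obtain ⟨fg, hfg, hmax⟩ := (cA.prod cB).exists_isMaxOn (hAn.prod hBn)
    (continuous_cov (p := p)).continuousOn
  exact ⟨fg.1, hfg.1, fg.2, hfg.2, fun f' hf' g' hg' => hmax (Set.mk_mem_prod hf' hg')⟩

/-- The feasible set is unbounded, since constants and values off the support are free. Its images
under `centre` lie in a compact set, and the image of the subspace of merged functions is closed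
because the space is finite-dimensional. -/
theorem exists_isOptimizer (hp : IsJointPMF p) (SX : Set (X × X)) (SY : Set (Y × Y))
    (hne : (feasible p SX SY).Nonempty) : ∃ f g, IsOptimizer p SX SY f g := by
  let A : Submodule ℝ (X → ℝ) :=
    { carrier := {f | ∀ q ∈ SX, f q.1 = f q.2}
      add_mem' := fun hf hg q hq => by simp [hf q hq, hg q hq]
      zero_mem' := fun q _ => rfl
      smul_mem' := fun c f hf q hq => by simp [hf q hq] }
  let B : Submodule ℝ (Y → ℝ) :=
    { carrier := {f | ∀ q ∈ SY, f q.1 = f q.2}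
      add_mem' := fun hf hg q hq => by simp [hf q hq, hg q hq]
      zero_mem' := fun q _ => rfl
      smul_mem' := fun c f hf q hq => by simp [hf q hq] }
  have hX : ∀ f ∈ A, varX p f = 1 → centre p f ∈ (A.map (centre p) : Set (X → ℝ)) ∩
      {f | centre p f = f ∧ varX p f = 1} := fun f hf hv =>
    ⟨Submodule.mem_map_of_mem hf, centre_centre hp f, by rw [varX_centre hp, hv]⟩
  have hY : ∀ g ∈ B, varY p g = 1 → centre (fun y x => p x y) g ∈
      (B.map (centre fun y x => p x y) : Set (Y → ℝ)) ∩
      {g | centre (fun y x => p x y) g = g ∧ varY p g = 1} := fun g hg hv =>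
    ⟨Submodule.mem_map_of_mem hg, centre_centre hp.swap g, by
      rw [← varX_swap, varX_centre hp.swap, varX_swap, hv]⟩
  have cY := (isCompact_centred hp.swap).isClosed
  simp only [varX_swap] at cY
  obtain ⟨⟨f₀, g₀⟩, h1, h2, h3, h4⟩ := hne
  obtain ⟨u, ⟨hu1, hu2⟩, v, ⟨hv1, hv2⟩, hmax⟩ := exists_max_cov hp
    ((Submodule.closed_of_finiteDimensional _).inter (isCompact_centred hp).isClosed)
    ((Submodule.closed_of_finiteDimensional _).inter cY)
    (fun f hf => hf.2) (fun g hg => hg.2) ⟨_, hX f₀ h3 h1⟩ ⟨_, hY g₀ h4 h2⟩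
  -- The maximisers are lifted back to merged functions; a centred function itself may violate the
  -- merging constraints at symbols of probability zero.
  obtain ⟨f, hf, rfl⟩ := hu1
  obtain ⟨g, hg, rfl⟩ := hv1
  refine ⟨f, g, ⟨?_, ?_, hf, hg⟩, ?_⟩
  · rw [← varX_centre hp]; exact hu2.2
  · rw [← varX_swap, ← varX_centre hp.swap, varX_swap]; exact hv2.2
  · rintro ⟨f', g'⟩ ⟨h1, h2, h3, h4⟩
    have := hmax _ (hX f' h3 h1) _ (hY g' h4 h2)
    rwa [cov_centre_centre hp, cov_centre_centre hp] at this

end Covariance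

/-! ### The order cones, and exactness of the enumeration -/

section Order

variable {X Y : Type*} [Fintype X] [Fintype Y] [PartialOrder X] [PartialOrder Y] {p : X → Y → ℝ}

/-- The pairs of symbols of positive probability in strict relation. -/
abbrev SuppPair (p : X → Y → ℝ) : Type _ :=
  {q : X × X // q.1 < q.2 ∧ 0 < margX p q.1 ∧ 0 < margX p q.2}

/-- Covariances, and the cones of functions that are monotone on the support. -/
noncomputable def monoForm (hp : IsJointPMF p) :
    PairForm (X → ℝ) (Y → ℝ) (SuppPair p) (SuppPair fun y x => p x y) where
  Q := (covForm p).compl₁₂ (liftX X Y) (liftX X Y)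
  R := (covForm p).compl₁₂ (liftY X Y) (liftY X Y)
  B := (covForm p).compl₁₂ (liftX X Y) (liftY X Y)
  a q := (LinearMap.proj q.1.2 : (X → ℝ) →ₗ[ℝ] ℝ) - LinearMap.proj q.1.1
  b q := (LinearMap.proj q.1.2 : (Y → ℝ) →ₗ[ℝ] ℝ) - LinearMap.proj q.1.1
  Q_symm _ _ := covForm_symm _ _
  R_symm _ _ := covForm_symm _ _
  Q_nonneg _ := covForm_self_nonneg hp _
  R_nonneg _ := covForm_self_nonneg hp _
  B_null_left _ _ h := covForm_null hp h _
  B_null_right v w h := by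
    have := covForm_null hp h (liftX X Y v)
    rw [covForm_symm] at this
    exact this
  a_null v q h := by
    have h' : varX p v = 0 := by rw [varX_eq]; exact h
    have := (varX_eq_zero_iff hp).1 h' _ _ q.2.2.1 q.2.2.2
    exact sub_eq_zero.2 this.symm
  b_null w q h := by
    have h' : varX (fun y x => p x y) w = 0 := by rw [varX_swap, varY_eq]; exact h
    have := (varX_eq_zero_iff hp.swap).1 h' _ _ q.2.2.1 q.2.2.2
    exact sub_eq_zero.2 this.symm

variable (hp : IsJointPMF p)

theorem monoForm_Q (f : X → ℝ) : (monoForm hp).Q f f = varX p f := (varX_eq f).symm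

theorem monoForm_R (g : Y → ℝ) : (monoForm hp).R g g = varY p g := (varY_eq g).symm

theorem monoForm_B (f : X → ℝ) (g : Y → ℝ) : (monoForm hp).B f g = cov p f g := rfl

omit hp [Fintype X] [PartialOrder Y] in
theorem forall_suppPair (f : X → ℝ) : (∀ q : SuppPair p, 0 ≤ f q.1.2 - f q.1.1) ↔
    MonotoneOn f {x | 0 < margX p x} := by
  refine ⟨fun h x hx x' hx' hle => ?_, fun h q => ?_⟩
  · rcases hle.eq_or_lt with rfl | hlt
    · rfl
    · exact sub_nonneg.1 (h ⟨(x, x'), hlt, hx, hx'⟩)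
  · exact sub_nonneg.2 (h q.2.2.1 q.2.2.2 q.2.1.le)

theorem monoForm_a (f : X → ℝ) : (∀ q, 0 ≤ (monoForm hp).a q f) ↔
    MonotoneOn f {x | 0 < margX p x} := forall_suppPair f

theorem monoForm_b (g : Y → ℝ) : (∀ q, 0 ≤ (monoForm hp).b q g) ↔
    MonotoneOn g {y | 0 < margY p y} := forall_suppPair (p := fun y x => p x y) g

theorem monoForm_cones (f : X → ℝ) (g : Y → ℝ) :
    ((∀ q, 0 ≤ (monoForm hp).a q f) ∧ ∀ q, 0 ≤ (monoForm hp).b q g) ↔ MonoOnSupport p f g :=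
  and_congr (monoForm_a hp f) (monoForm_b hp g)

theorem mem_face_monoForm {f v : X → ℝ} : v ∈ (monoForm hp).face f ↔
    ∀ x x', x < x' → 0 < margX p x → 0 < margX p x' → f x = f x' → v x = v x' := by
  refine ⟨fun h x x' h1 h2 h3 h4 => ?_, fun h q hq => ?_⟩
  · have := h ⟨(x, x'), h1, h2, h3⟩ (by simp [monoForm, h4])
    simp only [monoForm, LinearMap.sub_apply, LinearMap.proj_apply] at this
    linarith
  · simp only [monoForm, LinearMap.sub_apply, LinearMap.proj_apply] at hq ⊢
    have := h q.1.1 q.1.2 q.2.1 q.2.2.1 q.2.2.2 (by linarith)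
    linarith

theorem mem_face_swap_monoForm {g w : Y → ℝ} : w ∈ (monoForm hp).swap.face g ↔
    ∀ y y', y < y' → 0 < margY p y → 0 < margY p y' → g y = g y' → w y = w y' := by
  refine ⟨fun h x x' h1 h2 h3 h4 => ?_, fun h q hq => ?_⟩
  · have := h ⟨(x, x'), h1, h2, h3⟩ (by simp [monoForm, PairForm.swap, h4])
    simp only [monoForm, PairForm.swap, LinearMap.sub_apply, LinearMap.proj_apply] at this
    linarith
  · simp only [monoForm, PairForm.swap, LinearMap.sub_apply, LinearMap.proj_apply] at hq ⊢
    have := h q.1.1 q.1.2 q.2.1 q.2.2.1 q.2.2.2 (by linarith)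
    linarith

-- Extend by the supremum of `f` over the points of `S` below. A global lower bound `L` of `f` is
-- inserted so that the supremum is never over the empty set.
omit hp [PartialOrder Y] in
theorem exists_monotone_eqOn {f : X → ℝ} {S : Set X} (hf : MonotoneOn f S) :
    ∃ f', Monotone f' ∧ ∀ x ∈ S, f x = f' x := by
  obtain ⟨L, hL⟩ := (Set.finite_range f).bddBelow
  have hb : ∀ x, BddAbove (insert L (f '' {z | z ∈ S ∧ z ≤ x})) := fun x =>
    ((Set.toFinite _).insert L).bddAbove
  refine ⟨fun x => sSup (insert L (f '' {z | z ∈ S ∧ z ≤ x})), fun x y hxy => ?_,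
    fun x hx => le_antisymm ?_ ?_⟩
  · refine csSup_le_csSup (hb y) ⟨L, Set.mem_insert _ _⟩ (Set.insert_subset_insert ?_)
    exact Set.image_mono fun z hz => ⟨hz.1, hz.2.trans hxy⟩
  · exact le_csSup (hb x) (Set.mem_insert_of_mem _ ⟨x, ⟨hx, le_rfl⟩, rfl⟩)
  · refine csSup_le ⟨L, Set.mem_insert _ _⟩ ?_
    rintro c (rfl | ⟨z, hz, rfl⟩)
    · exact hL ⟨x, rfl⟩
    · exact hf hz.1 hx hz.2

-- The variational argument ignores symbols of probability zero, whereas `cmcSet` asks for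
-- monotonicity everywhere; the extension of both functions closes this gap.
include hp in
theorem mem_cmcSet_of_monoOnSupport {f : X → ℝ} {g : Y → ℝ} (h : MonoOnSupport p f g)
    (hf : 0 < varX p f) (hg : 0 < varY p g) :
    cov p f g / √(varX p f * varY p g) ∈ cmcSet p := by
  obtain ⟨f', hf1, hf2⟩ := exists_monotone_eqOn h.1
  obtain ⟨g', hg1, hg2⟩ := exists_monotone_eqOn h.2
  rw [cov_congr hp hf2 hg2, varX_congr hp hf2, varY_congr hp hg2]
  rw [varX_congr hp hf2] at hf
  rw [varY_congr hp hg2] at hg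
  exact ⟨f', g', hf1, hg1, hf, hg, rfl⟩

-- By antisymmetry one of two distinct support points `x`, `x'` satisfies `¬ x' ≤ x` after naming.
-- The indicator of the complement of the down-set of `x` is monotone and separates them.
omit [PartialOrder Y] in
include hp in
theorem exists_monotone_varX_pos (h : ∃ x x', x ≠ x' ∧ 0 < margX p x ∧ 0 < margX p x') :
    ∃ f : X → ℝ, Monotone f ∧ 0 < varX p f := by
  obtain ⟨x, x', hne, hx, hx'⟩ := h
  wlog hle : ¬ x' ≤ x generalizing x x'
  · push Not at hle
    exact this x' x hne.symm hx' hx fun h => hne (le_antisymm h hle)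
  classical
  refine ⟨fun z => if z ≤ x then 0 else 1, fun z z' hz => ?_, ?_⟩
  · by_cases h1 : z' ≤ x
    · simp [h1, hz.trans h1]
    · by_cases h2 : z ≤ x <;> simp [h1, h2]
  · refine lt_of_le_of_ne (varX_nonneg hp _) fun h => ?_
    have := (varX_eq_zero_iff hp).1 h.symm x x' hx hx'
    simp [hle] at this

theorem unit_of_pos {a : ℝ} (ha : 0 < a) : (√a)⁻¹ ^ 2 * a = 1 := by
  rw [inv_pow, Real.sq_sqrt ha.le, inv_mul_cancel₀ ha.ne']

omit [Fintype X] [PartialOrder Y] in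
theorem monotoneOn_smul {f : X → ℝ} {S : Set X} (hf : MonotoneOn f S) {c : ℝ}
    (hc : 0 ≤ c) : MonotoneOn (c • f) S := fun _ hx _ hy h =>
  mul_le_mul_of_nonneg_left (hf hx hy h) hc

omit hp [PartialOrder Y] in
theorem monotoneOn_centre {f : X → ℝ} (hf : MonotoneOn f {x | 0 < margX p x}) :
    MonotoneOn (centre p f) {x | 0 < margX p x} := fun x hx y hy h => by
  rw [centre_of_pos _ hx, centre_of_pos _ hy]
  linarith [hf hx hy h]

omit [Fintype X] [PartialOrder Y] in
theorem isClosed_monotoneOn (S : Set X) : IsClosed {f : X → ℝ | MonotoneOn f S} := by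
  simp only [MonotoneOn, Set.ofPred_forall]
  exact isClosed_iInter fun x => isClosed_iInter fun _ => isClosed_iInter fun y =>
    isClosed_iInter fun _ => isClosed_iInter fun _ =>
      isClosed_le (continuous_apply x) (continuous_apply y)

theorem exists_optimal (hnd : Nondegenerate p) : ∃ σ f g, (monoForm hp).Optimal σ f g := by
  have hX : ∀ f : X → ℝ, MonotoneOn f {x | 0 < margX p x} → 0 < varX p f →
      centre p ((√(varX p f))⁻¹ • f) ∈ {f | MonotoneOn f {x | 0 < margX p x}} ∩
      {f | centre p f = f ∧ varX p f = 1} := fun f hf hv =>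
    ⟨monotoneOn_centre (monotoneOn_smul hf (by positivity)), centre_centre hp _, by
      rw [varX_centre hp, varX_smul, unit_of_pos hv]⟩
  have hY : ∀ g : Y → ℝ, MonotoneOn g {x | 0 < margY p x} → 0 < varY p g →
      centre (fun y x => p x y) ((√(varY p g))⁻¹ • g) ∈ {f | MonotoneOn f {x | 0 < margY p x}} ∩
      {f | centre (fun y x => p x y) f = f ∧ varY p f = 1} := fun f hf hv =>
    ⟨monotoneOn_centre (monotoneOn_smul hf (by positivity)), centre_centre hp.swap _, by
      rw [← varX_swap, varX_centre hp.swap, varX_swap, varY_smul, unit_of_pos hv]⟩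
  obtain ⟨f₀, hf₀, hf₀'⟩ := exists_monotone_varX_pos hp hnd.1
  obtain ⟨g₀, hg₀, hg₀'⟩ := exists_monotone_varX_pos hp.swap hnd.2
  rw [varX_swap] at hg₀'
  have cY := (isCompact_centred hp.swap).isClosed
  simp only [varX_swap] at cY
  obtain ⟨f, ⟨hf1, hf2⟩, g, ⟨hg1, hg2⟩, hmax⟩ := exists_max_cov hp
    ((isClosed_monotoneOn _).inter (isCompact_centred hp).isClosed)
    ((isClosed_monotoneOn _).inter cY)
    (fun f hf => hf.2) (fun g hg => hg.2) ⟨_, hX f₀ (hf₀.monotoneOn _) hf₀'⟩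
    ⟨_, hY g₀ (hg₀.monotoneOn _) hg₀'⟩
  refine ⟨cov p f g, f, g, (monoForm_a hp f).2 hf1, (monoForm_b hp g).2 hg1, ?_, ?_, rfl, ?_⟩
  · rw [monoForm_Q, hf2.2]
  · rw [monoForm_R, hg2.2]
  · intro f' g' hf' hg' hQ hR
    rw [monoForm_a] at hf'
    rw [monoForm_b] at hg'
    rw [monoForm_Q] at hQ ⊢
    rw [monoForm_R] at hR ⊢
    rw [monoForm_B]
    have := hmax _ (hX f' hf' hQ) _ (hY g' hg' hR)
    rw [cov_centre_centre hp, cov_smul_smul, ← mul_inv, inv_mul_le_iff₀ (by positivity)] at this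
    linarith

theorem PairForm.Optimal.isGreatest {σ : ℝ} {f : X → ℝ} {g : Y → ℝ}
    (h : (monoForm hp).Optimal σ f g) : IsGreatest (cmcSet p) σ := by
  constructor
  · have hQ := h.Qf
    have hR := h.Rg
    rw [monoForm_Q] at hQ
    rw [monoForm_R] at hR
    have := mem_cmcSet_of_monoOnSupport hp ((monoForm_cones hp f g).1 ⟨h.hf, h.hg⟩)
      (by rw [hQ]; norm_num) (by rw [hR]; norm_num)
    rw [hQ, hR, ← monoForm_B hp, h.Bfg] at this
    simpa using this
  · rintro c ⟨f', g', hf', hg', hv, hw, rfl⟩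
    have := h.le f' g' ((monoForm_a hp f').2 (hf'.monotoneOn _))
      ((monoForm_b hp g').2 (hg'.monotoneOn _)) (by rwa [monoForm_Q]) (by rwa [monoForm_R])
    rw [monoForm_Q, monoForm_R, monoForm_B] at this
    rw [div_le_iff₀ (by positivity), Real.sqrt_mul hv.le]
    exact this

theorem exists_tight_cmc (hnd : Nondegenerate p) : ∃ f g, (monoForm hp).Tight (cmc p) f g := by
  obtain ⟨σ, f, g, h⟩ := exists_optimal hp hnd
  have : cmc p = σ := (h.isGreatest hp).csSup_eq
  rw [this]
  exact h.exists_tight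

include hp in
theorem cmc_isGreatest (hnd : Nondegenerate p) : IsGreatest (cmcSet p) (cmc p) := by
  obtain ⟨f, g, h⟩ := exists_tight_cmc hp hnd
  exact h.toOptimal.isGreatest hp

include hp in
theorem cov_div_le_cmc (hnd : Nondegenerate p) {f : X → ℝ} {g : Y → ℝ} (h : MonoOnSupport p f g)
    (hf : 0 < varX p f) (hg : 0 < varY p g) : cov p f g / √(varX p f * varY p g) ≤ cmc p :=
  (cmc_isGreatest hp hnd).2 (mem_cmcSet_of_monoOnSupport hp h hf hg)

include hp in
theorem cov_le_cmc (hnd : Nondegenerate p) {f : X → ℝ} {g : Y → ℝ} (h : MonoOnSupport p f g)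
    (hf : varX p f = 1) (hg : varY p g = 1) : cov p f g ≤ cmc p := by
  have := cov_div_le_cmc hp hnd h (by rw [hf]; norm_num) (by rw [hg]; norm_num)
  rw [hf, hg] at this
  simpa using this

-- This is what allows the program to start its running maximum at `-1`.
include hp in
theorem neg_one_le_cmc (hnd : Nondegenerate p) : -1 ≤ cmc p := by
  obtain ⟨f, g, h⟩ := exists_tight_cmc hp hnd
  have h1 := sq_cov_le hp f g
  rw [← monoForm_Q hp, ← monoForm_R hp, h.Qf, h.Rg, ← monoForm_B hp, h.Bfg] at h1
  nlinarith

omit [PartialOrder Y] in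
/-- The strict relations between symbols of positive probability on which `f` is constant. -/
def mergeSet (p : X → Y → ℝ) (f : X → ℝ) : Set (X × X) :=
  {q | q.1 < q.2 ∧ 0 < margX p q.1 ∧ 0 < margX p q.2 ∧ f q.1 = f q.2}

variable {hp}

/-- The relaxed problem of a merge set lives on the faces of `(f, g)`, which is where the optimality
conditions speak. -/
theorem feasible_mergeSet_iff {f : X → ℝ} {g : Y → ℝ}
    {fg : (X → ℝ) × (Y → ℝ)} :
    fg ∈ feasible p (mergeSet p f) (mergeSet (fun y x => p x y) g) ↔
      varX p fg.1 = 1 ∧ varY p fg.2 = 1 ∧ fg.1 ∈ (monoForm hp).face f ∧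
        fg.2 ∈ (monoForm hp).swap.face g := by
  rw [mem_face_monoForm, mem_face_swap_monoForm]
  refine and_congr_right fun _ => and_congr_right fun _ => and_congr ?_ ?_
  · exact ⟨fun h x x' h1 h2 h3 h4 => h (x, x') ⟨h1, h2, h3, h4⟩,
      fun h q hq => h _ _ hq.1 hq.2.1 hq.2.2.1 hq.2.2.2⟩
  · exact ⟨fun h x x' h1 h2 h3 h4 => h (x, x') ⟨h1, h2, h3, h4⟩,
      fun h q hq => h _ _ hq.1 hq.2.1 hq.2.2.1 hq.2.2.2⟩

/-- What the relaxed problem of a tight pair gives when the correlation is positive. -/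
theorem PairForm.Tight.monoOnSupport_of_pos {σ : ℝ} {f : X → ℝ} {g : Y → ℝ}
    (h : (monoForm hp).Tight σ f g) (hσ : 0 < σ) {v : X → ℝ} {w : Y → ℝ}
    (hv : v ∈ (monoForm hp).face f) (hw : w ∈ (monoForm hp).swap.face g) (hQ : varX p v = 1)
    (hR : varY p w = 1) (hB : cov p v w = σ) :
    MonoOnSupport p v w ∨ MonoOnSupport p (-v) (-w) := by
  have := h.mem_cones_of_pos hσ hv hw (by rwa [monoForm_Q]) (by rwa [monoForm_R]) hB
  rwa [monoForm_cones, monoForm_cones] at this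

/-- When the correlation is not positive, each merged function is monotone up to sign. -/
theorem PairForm.Tight.exists_signs {σ : ℝ} {f : X → ℝ} {g : Y → ℝ}
    (h : (monoForm hp).Tight σ f g) (hσ : σ ≤ 0) {v : X → ℝ} {w : Y → ℝ}
    (hv : v ∈ (monoForm hp).face f) (hw : w ∈ (monoForm hp).swap.face g) :
    ∃ v' w', (v' = v ∨ v' = -v) ∧ (w' = w ∨ w' = -w) ∧ MonoOnSupport p v' w' := by
  have h1 := h.mem_cone_of_nonpos hσ hv
  have h2 : (∀ i, 0 ≤ (monoForm hp).b i w) ∨ ∀ i, 0 ≤ (monoForm hp).b i (-w) :=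
    h.swap.mem_cone_of_nonpos hσ hw
  rw [monoForm_a, monoForm_a] at h1
  rw [monoForm_b, monoForm_b] at h2
  rcases h1 with h1 | h1 <;> rcases h2 with h2 | h2
  · exact ⟨v, w, .inl rfl, .inl rfl, h1, h2⟩
  · exact ⟨v, -w, .inl rfl, .inr rfl, h1, h2⟩
  · exact ⟨-v, w, .inr rfl, .inl rfl, h1, h2⟩
  · exact ⟨-v, -w, .inr rfl, .inr rfl, h1, h2⟩

theorem PairForm.Tight.abs_cov_of_nonpos {σ : ℝ} {f : X → ℝ} {g : Y → ℝ}
    (h : (monoForm hp).Tight σ f g) (hσ : σ ≤ 0) {v : X → ℝ} {w : Y → ℝ}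
    (hv : v ∈ (monoForm hp).face f) (hw : w ∈ (monoForm hp).swap.face g) :
    |cov p v w| = -σ * √(varX p v * varY p w) := by
  have := h.toOptimal.abs_B_of_nonpos hσ hv hw
  rwa [monoForm_Q, monoForm_R, monoForm_B, ← Real.sqrt_mul (varX_nonneg hp v),
    abs_of_nonpos hσ] at this

/-- When the correlation is not positive, a merged pair with the right signs is optimal. -/
theorem PairForm.Tight.cov_eq_of_nonpos {f : X → ℝ} {g : Y → ℝ} (hnd : Nondegenerate p)
    (h : (monoForm hp).Tight (cmc p) f g) (hσ : cmc p ≤ 0) {v : X → ℝ} {w : Y → ℝ}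
    (hv : v ∈ (monoForm hp).face f) (hw : w ∈ (monoForm hp).swap.face g)
    (hQ : 0 < varX p v) (hR : 0 < varY p w) (hm : MonoOnSupport p v w) :
    cov p v w / √(varX p v * varY p w) = cmc p := by
  have h1 := cov_div_le_cmc hp hnd hm hQ hR
  have h2 := h.abs_cov_of_nonpos hσ hv hw
  have h3 : 0 < √(varX p v * varY p w) := Real.sqrt_pos.2 (mul_pos hQ hR)
  apply le_antisymm h1
  rw [le_div_iff₀ h3]
  have := neg_abs_le (cov p v w)
  linarith

variable {F : Set (X × X) → Set (Y × Y) → X → ℝ} {G : Set (X × X) → Set (Y × Y) → Y → ℝ}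

theorem keptCommonSign_subset : keptCommonSign p F G ⊆ keptAllSigns p F G := by
  rintro c ⟨SX, hX, SY, hY, hne, hm | hm, rfl⟩
  · exact ⟨SX, hX, SY, hY, hne, _, _, .inl rfl, .inl rfl, hm, rfl⟩
  · exact ⟨SX, hX, SY, hY, hne, _, _, .inr rfl, .inr rfl, hm, (cov_neg_neg _ _).symm⟩

include hp in
theorem keptAllSigns_le (hnd : Nondegenerate p) (hsel : IsSelection p F G) {c : ℝ}
    (hc : c ∈ keptAllSigns p F G) : c ≤ cmc p := by
  obtain ⟨SX, hX, SY, hY, hne, f, g, hf, hg, hm, rfl⟩ := hc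
  obtain ⟨⟨h1, h2, -, -⟩, -⟩ := hsel SX hX SY hY hne
  apply cov_le_cmc hp hnd hm
  · rcases hf with rfl | rfl
    · exact h1
    · rw [varX_neg]; exact h1
  · rcases hg with rfl | rfl
    · exact h2
    · rw [varY_neg]; exact h2

-- The selection is examined only at the merge sets of one tight pair; every other selected pair
-- contributes at most `cmc p` because a kept pair is monotone on the support.
include hp in
theorem isGreatest_kept (hnd : Nondegenerate p) (hsel : IsSelection p F G) :
    IsGreatest (keptAllSigns p F G) (cmc p) ∧
      (0 < cmc p → IsGreatest (keptCommonSign p F G) (cmc p)) := by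
  obtain ⟨f, g, h⟩ := exists_tight_cmc hp hnd
  set SX := mergeSet p f
  set SY := mergeSet (fun y x => p x y) g
  have hX : SX ⊆ strictRel X := fun q hq => hq.1
  have hY : SY ⊆ strictRel Y := fun q hq => hq.1
  have hfg : (f, g) ∈ feasible p SX SY := by
    rw [feasible_mergeSet_iff (hp := hp), ← monoForm_Q hp, ← monoForm_R hp]
    exact ⟨h.Qf, h.Rg, PairForm.self_mem_face, PairForm.self_mem_face⟩
  obtain ⟨hF, hmax⟩ := hsel SX hX SY hY ⟨_, hfg⟩
  obtain ⟨h1, h2, h3, h4⟩ := (feasible_mergeSet_iff (hp := hp)).1 hF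
  have hub : cmc p ∈ upperBounds (keptAllSigns p F G) := fun c hc => keptAllSigns_le (hp := hp) hnd hsel hc
  -- The tight pair is feasible, so the optimizer reaches at least `cmc p`; the bound on the faces
  -- gives at most `cmc p`. Tightness then supplies monotonicity up to a common sign.
  have hpos : 0 < cmc p → cmc p ∈ keptCommonSign p F G := by
    intro hσ
    have hB : cov p (F SX SY) (G SX SY) = cmc p := by
      apply le_antisymm
      · have := h.toOptimal.B_le h3 h4
        rw [monoForm_Q, monoForm_R, monoForm_B, h1, h2, abs_of_pos hσ] at this
        simpa using this
      · have := hmax _ hfg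
        rwa [← monoForm_B hp f g, h.Bfg] at this
    exact ⟨SX, hX, SY, hY, ⟨_, hfg⟩, h.monoOnSupport_of_pos hσ h3 h4 h1 h2 hB, hB.symm⟩
  refine ⟨⟨?_, hub⟩, fun hσ => ⟨hpos hσ, fun c hc => hub (keptCommonSign_subset hc)⟩⟩
  rcases lt_or_ge 0 (cmc p) with hσ | hσ
  · exact keptCommonSign_subset (hpos hσ)
  -- For a nonpositive optimum only feasibility of the selected pair matters: with the right signs
  -- every feasible pair attains `cmc p`.
  · obtain ⟨v, w, hv, hw, hm⟩ := h.exists_signs hσ h3 h4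
    have hv' : v ∈ (monoForm hp).face f ∧ varX p v = 1 := by
      rcases hv with rfl | rfl
      · exact ⟨h3, h1⟩
      · exact ⟨Submodule.neg_mem _ h3, by rwa [varX_neg]⟩
    have hw' : w ∈ (monoForm hp).swap.face g ∧ varY p w = 1 := by
      rcases hw with rfl | rfl
      · exact ⟨h4, h2⟩
      · exact ⟨Submodule.neg_mem _ h4, by rwa [varY_neg]⟩
    have := h.cov_eq_of_nonpos hnd hσ hv'.1 hw'.1 (by rw [hv'.2]; norm_num)
      (by rw [hw'.2]; norm_num) hm
    rw [hv'.2, hw'.2] at this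
    exact ⟨SX, hX, SY, hY, ⟨_, hfg⟩, v, w, hv, hw, hm, by simpa using this.symm⟩

end Order

end MonoCorr

open Filter Topology

namespace MonoCorr

/-! ### Exact eigenvectors from a Krylov sequence and deflation -/

section Lanczos

variable {E : Type*} [NormedAddCommGroup E] [InnerProductSpace ℝ E] (T : E →ₗ[ℝ] E) (h : E)

/-- The orthogonalised Krylov sequence of `h`, preceded by a zero. -/
noncomputable def lanczos : ℕ → E
  -- Since division by `0` gives `0`, the zero in front makes the last term of the recurrence vanish
  -- in its first use, and the sequence stays zero once it has reached zero. No case distinction is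
  -- needed, here or in the program.
  | 0 => 0
  | 1 => h
  | k + 2 => T (lanczos (k + 1)) -
      (inner ℝ (T (lanczos (k + 1))) (lanczos (k + 1)) /
        inner ℝ (lanczos (k + 1)) (lanczos (k + 1))) • lanczos (k + 1) -
      (inner ℝ (lanczos (k + 1)) (lanczos (k + 1)) / inner ℝ (lanczos k) (lanczos k)) •
        lanczos k

/-- The first coefficient of the three-term recurrence. -/
noncomputable def lanczosA (k : ℕ) : ℝ :=
  inner ℝ (T (lanczos T h (k + 1))) (lanczos T h (k + 1)) /
    inner ℝ (lanczos T h (k + 1)) (lanczos T h (k + 1))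

/-- The second coefficient of the three-term recurrence. -/
noncomputable def lanczosB (k : ℕ) : ℝ :=
  inner ℝ (lanczos T h (k + 1)) (lanczos T h (k + 1)) / inner ℝ (lanczos T h k) (lanczos T h k)

theorem lanczos_zero : lanczos T h 0 = 0 := by rw [lanczos]

theorem lanczos_one : lanczos T h 1 = h := by rw [lanczos]

theorem lanczos_add_two (k : ℕ) : lanczos T h (k + 2) = T (lanczos T h (k + 1)) -
    lanczosA T h k • lanczos T h (k + 1) - lanczosB T h k • lanczos T h k := by
  rw [lanczos]; rfl

/-- The polynomials with `lanczosPoly k` acting on `h` as `T (lanczos k)`. -/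
noncomputable def lanczosPoly : ℕ → Polynomial ℝ
  | 0 => 0
  | 1 => Polynomial.X
  | k + 2 => Polynomial.X * lanczosPoly (k + 1) - Polynomial.C (lanczosA T h k) *
      lanczosPoly (k + 1) - Polynomial.C (lanczosB T h k) * lanczosPoly k

theorem lanczosPoly_add_two (k : ℕ) : lanczosPoly T h (k + 2) =
    Polynomial.X * lanczosPoly T h (k + 1) - Polynomial.C (lanczosA T h k) *
      lanczosPoly T h (k + 1) - Polynomial.C (lanczosB T h k) * lanczosPoly T h k := by
  rw [lanczosPoly]

/-- The additional factor `X`, visible in `T (lanczos T h k)`, is harmless: once `lanczos` is zero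
the polynomial still annihilates `h`. -/
theorem aeval_lanczosPoly (k : ℕ) :
    Polynomial.aeval T (lanczosPoly T h k) h = T (lanczos T h k) := by
  induction k using Nat.twoStepInduction with
  | zero => simp [lanczosPoly, lanczos_zero]
  | one => simp [lanczosPoly, lanczos_one]
  | more k h0 h1 =>
    rw [lanczosPoly_add_two, lanczos_add_two]
    simp [h0, h1]

/-- Monicity guarantees a nonzero polynomial with finitely many roots. The last conjunct carries the
degree bound of the preceding polynomial through the induction, including the zero polynomial at
index `0`. -/
theorem lanczosPoly_monic (k : ℕ) : (lanczosPoly T h (k + 1)).Monic ∧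
    (lanczosPoly T h (k + 1)).natDegree = k + 1 ∧ (lanczosPoly T h k).natDegree ≤ k := by
  induction k with
  | zero => simp [lanczosPoly, Polynomial.monic_X]
  | succ k ih =>
    obtain ⟨h1, h2, h3⟩ := ih
    have hd : (Polynomial.X * lanczosPoly T h (k + 1)).natDegree = k + 2 := by
      rw [Polynomial.natDegree_X_mul h1.ne_zero, h2]
    have hm : (Polynomial.X * lanczosPoly T h (k + 1)).Monic := Polynomial.monic_X.mul h1
    have l1 : (Polynomial.C (lanczosA T h k) * lanczosPoly T h (k + 1) +
        Polynomial.C (lanczosB T h k) * lanczosPoly T h k).natDegree < k + 2 := by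
      refine lt_of_le_of_lt (Polynomial.natDegree_add_le _ _) (max_lt ?_ ?_)
      · exact lt_of_le_of_lt (Polynomial.natDegree_C_mul_le _ _) (by omega)
      · exact lt_of_le_of_lt (Polynomial.natDegree_C_mul_le _ _) (by omega)
    have e : lanczosPoly T h (k + 1 + 1) = Polynomial.X * lanczosPoly T h (k + 1) -
        (Polynomial.C (lanczosA T h k) * lanczosPoly T h (k + 1) +
        Polynomial.C (lanczosB T h k) * lanczosPoly T h k) := by
      rw [lanczosPoly_add_two]; ring
    refine ⟨?_, ?_, h2.le⟩
    · rw [e]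
      exact hm.sub_of_left (Polynomial.degree_lt_degree (by rw [hd]; exact l1))
    · rw [e, Polynomial.natDegree_sub_eq_left_of_natDegree_lt (by rw [hd]; exact l1), hd]

variable {T} {h}

/-- Symmetry moves `T` onto the earlier vector, where the recurrence expresses it by its neighbours.
Only the last two vectors can have a nonzero product with it, and the two coefficients are chosen to
cancel these. -/
theorem lanczos_orthogonal (hT : T.IsSymmetric) (n : ℕ) :
    ∀ i j, i ≤ n → j ≤ n → i ≠ j → inner ℝ (lanczos T h i) (lanczos T h j) = 0 := by
  induction n with
  | zero => intro i j hi hj hij; omega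
  | succ n ih =>
    have key : ∀ j, j ≤ n → inner ℝ (lanczos T h (n + 1)) (lanczos T h j) = 0 := by
      intro j hj
      rcases n with _ | k
      · have : j = 0 := by omega
        rw [this, lanczos_zero, inner_zero_right]
      -- The quotients defining the coefficients also behave correctly when their denominators
      -- vanish, because then the vector itself is zero.
      · have hA : inner ℝ (T (lanczos T h (k + 1))) (lanczos T h (k + 1)) =
            lanczosA T h k * inner ℝ (lanczos T h (k + 1)) (lanczos T h (k + 1)) := by
          by_cases h0 : inner ℝ (lanczos T h (k + 1)) (lanczos T h (k + 1)) = 0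
          · rw [h0, inner_self_eq_zero.1 h0]; simp
          · rw [lanczosA, div_mul_cancel₀ _ h0]
        have hB : inner ℝ (lanczos T h (k + 1)) (T (lanczos T h k)) =
            lanczosB T h k * inner ℝ (lanczos T h k) (lanczos T h k) := by
          by_cases h0 : inner ℝ (lanczos T h k) (lanczos T h k) = 0
          · rw [h0, inner_self_eq_zero.1 h0]; simp
          · rw [lanczosB, div_mul_cancel₀ _ h0]
            rcases k with _ | k
            · rw [lanczos_zero] at h0; simp at h0
            · have e : T (lanczos T h (k + 1)) = lanczos T h (k + 2) +
                  lanczosA T h k • lanczos T h (k + 1) + lanczosB T h k • lanczos T h k := by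
                rw [lanczos_add_two]; abel
              rw [e, inner_add_right, inner_add_right, inner_smul_right, inner_smul_right,
                ih (k + 1 + 1) (k + 1) (by omega) (by omega) (by omega),
                ih (k + 1 + 1) k (by omega) (by omega) (by omega)]
              simp
        rw [lanczos_add_two, inner_sub_left, inner_sub_left, inner_smul_left, inner_smul_left]
        simp only [conj_trivial]
        rcases hj.eq_or_lt with rfl | hj1
        · rw [hA, ih k (k + 1) (by omega) (by omega) (by omega)]; ring
        · rw [hT, ih (k + 1) j (by omega) (by omega) (by omega)]
          rcases (Nat.lt_succ_iff.1 hj1).eq_or_lt with rfl | hj2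
          · rw [hB]; ring
          · rw [ih k j (by omega) (by omega) (by omega)]
            rcases j with _ | j
            · simp [lanczos_zero]
            · have e : T (lanczos T h (j + 1)) = lanczos T h (j + 2) +
                  lanczosA T h j • lanczos T h (j + 1) + lanczosB T h j • lanczos T h j := by
                rw [lanczos_add_two]; abel
              rw [e, inner_add_right, inner_add_right, inner_smul_right, inner_smul_right,
                ih (k + 1) (j + 2) (by omega) (by omega) (by omega),
                ih (k + 1) (j + 1) (by omega) (by omega) (by omega),
                ih (k + 1) j (by omega) (by omega) (by omega)]
              simp
    intro i j hi hj hij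
    rcases hi.eq_or_lt with rfl | hi1
    · exact key j (by omega)
    rcases hj.eq_or_lt with rfl | hj1
    · rw [real_inner_comm]; exact key i (by omega)
    · exact ih i j (by omega) (by omega) hij

theorem lanczos_eq_zero_of_le {k n : ℕ} (hk : lanczos T h (k + 1) = 0) (hkn : k ≤ n) :
    lanczos T h (n + 1) = 0 := by
  induction n, hkn using Nat.le_induction with
  | base => exact hk
  | succ n _ ih => rw [lanczos_add_two, lanczosB, ih]; simp

/-- Otherwise more nonzero orthogonal vectors would exist than the dimension permits. -/
theorem lanczos_finrank [FiniteDimensional ℝ E] (hT : T.IsSymmetric) {n : ℕ}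
    (hn : Module.finrank ℝ E ≤ n) : lanczos T h (n + 1) = 0 := by
  by_contra hne
  have hne' : ∀ i : Fin (n + 1), lanczos T h (i + 1) ≠ 0 := fun i hi =>
    hne (lanczos_eq_zero_of_le hi (by omega))
  have hli : LinearIndependent ℝ fun i : Fin (n + 1) => lanczos T h (i + 1) := by
    refine linearIndependent_of_ne_zero_of_inner_eq_zero hne' fun i j hij => ?_
    exact lanczos_orthogonal hT (n + 1) _ _ (by omega) (by omega)
      (by have := Fin.val_ne_of_ne hij; omega)
  have := hli.fintype_card_le_finrank
  rw [Fintype.card_fin] at this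
  omega

/-- The product of `T - μ` over a list of numbers `μ`, applied to a vector. -/
noncomputable def deflate (T : E →ₗ[ℝ] E) (l : List ℝ) (h : E) : E :=
  l.foldl (fun v μ => T v - μ • v) h

theorem inner_deflate (hT : T.IsSymmetric) {b : E} {ν : ℝ} (hb : T b = ν • b) (l : List ℝ) :
    ∀ h, inner ℝ b (deflate T l h) = (l.map fun μ => ν - μ).prod * inner ℝ b h := by
  induction l with
  | nil => intro h; simp [deflate]
  | cons μ l ih =>
    intro h
    have : deflate T (μ :: l) h = deflate T l (T h - μ • h) := rfl
    rw [this, ih, inner_sub_right, inner_smul_right, ← hT, hb, inner_smul_left]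
    simp
    ring

theorem inner_aeval (hT : T.IsSymmetric) {b : E} {ν : ℝ} (hb : T b = ν • b)
    (q : Polynomial ℝ) (h : E) :
    inner ℝ b (Polynomial.aeval T q h) = q.eval ν * inner ℝ b h := by
  induction q using Polynomial.induction_on' with
  | add p q hp hq => simp [inner_add_right, hp, hq, add_mul]
  | monomial n a =>
    have : ∀ n, inner ℝ b ((T ^ n) h) = ν ^ n * inner ℝ b h := by
      intro n
      induction n with
      | zero => simp
      | succ n ih =>
        rw [pow_succ', Module.End.mul_apply, ← hT, hb, inner_smul_left, ih]
        simp; ring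
    simp [Polynomial.aeval_monomial, inner_smul_right, this]
    ring

/-- Pairing `q(T) h = 0` with an eigenvector `b` multiplies the coefficient of `h` along `b` by
`q.eval ν`. -/
theorem eval_eq_zero_of_aeval (hT : T.IsSymmetric) {b : E} {ν : ℝ} (hb : T b = ν • b)
    {q : Polynomial ℝ} (hq : Polynomial.aeval T q h = 0) (hbh : inner ℝ b h ≠ 0) :
    q.eval ν = 0 := by
  have := inner_aeval hT hb q h
  rw [hq, inner_zero_right] at this
  exact (mul_eq_zero.1 this.symm).resolve_right hbh

/-- Compare coefficients in an orthonormal eigenbasis. A component with eigenvalue other than `σ` is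
either absent from `h`, or its eigenvalue is a root of `q` and is killed by a factor of the
deflation. -/
theorem deflate_eigen [FiniteDimensional ℝ E] (hT : T.IsSymmetric) {q : Polynomial ℝ}
    (hq : Polynomial.aeval T q h = 0) {l : List ℝ} {σ : ℝ}
    (hl : ∀ ν, q.eval ν = 0 → ν ≠ σ → ν ∈ l) : T (deflate T l h) = σ • deflate T l h := by
  set b := hT.eigenvectorBasis rfl
  refine InnerProductSpace.ext_inner_left_basis b.toBasis fun i => ?_
  rw [OrthonormalBasis.coe_toBasis]
  have hb : T (b i) = hT.eigenvalues rfl i • b i := hT.apply_eigenvectorBasis rfl i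
  rw [← hT, hb, inner_smul_left, inner_smul_right, inner_deflate hT hb]
  simp only [conj_trivial]
  by_cases h1 : hT.eigenvalues rfl i = σ
  · rw [h1]
  by_cases h2 : inner ℝ (b i) h = 0
  · rw [h2]; simp
  have h3 : (l.map fun μ => hT.eigenvalues rfl i - μ).prod = 0 := by
    rw [List.prod_eq_zero_iff, List.mem_map]
    exact ⟨_, hl _ (eval_eq_zero_of_aeval hT hb hq h2) h1, sub_self _⟩
  rw [h3]; simp

/-- The coefficient along `b` is multiplied by a product of factors `σ - μ`, none of which vanishes.
-/
theorem deflate_ne_zero (hT : T.IsSymmetric) {b : E} {σ : ℝ} (hb : T b = σ • b)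
    (hbh : inner ℝ b h ≠ 0) {l : List ℝ} (hl : ∀ μ ∈ l, μ ≠ σ) : deflate T l h ≠ 0 := by
  intro h0
  have := inner_deflate hT hb l h
  rw [h0, inner_zero_right] at this
  rcases mul_eq_zero.1 this.symm with h1 | h1
  · rw [List.prod_eq_zero_iff, List.mem_map] at h1
    obtain ⟨μ, hμ, h2⟩ := h1
    exact hl μ hμ (by linarith)
  · exact hbh h1

end Lanczos

/-! ### Roots by index, and square roots -/

section Roots

theorem exists_kthRoot {c : ℕ → ℝ} {d : ℕ} {q : Polynomial ℝ} (hq : q ≠ 0) (hd : q.natDegree ≤ d)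
    (hc : ∀ i ≤ d, c i = q.coeff i) {μ : ℝ} (hμ : q.eval μ = 0) :
    ∃ k < d, kthRoot c d k = μ := by
  have e : (∑ i ∈ Finset.range (d + 1), Polynomial.C (c i) * Polynomial.X ^ i :
      Polynomial ℝ) = q := by
    rw [q.as_sum_range_C_mul_X_pow' (n := d + 1) (by omega)]
    exact Finset.sum_congr rfl fun i hi => by
      rw [hc i (by simpa [Nat.lt_succ_iff] using hi)]
  have hm : μ ∈ q.roots.sort (· ≤ ·) := by
    rw [Multiset.mem_sort, Polynomial.mem_roots hq]; exact hμ
  obtain ⟨k, hk, he⟩ := List.mem_iff_getElem.1 hm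
  refine ⟨k, ?_, ?_⟩
  · rw [Multiset.length_sort] at hk
    exact lt_of_lt_of_le hk ((Polynomial.card_roots' q).trans hd)
  · unfold kthRoot
    rw [e, List.getD_eq_getElem _ _ hk, he]

/-- The sorted roots of `T ^ 2 - v` are `-√v`, `√v`. They are listed with multiplicity, so index `1`
is right also for `v = 0`. -/
theorem kthRoot_sqrt {c : ℕ → ℝ} {v : ℝ} (hv : 0 ≤ v) (h0 : c 0 = 0 - v) (h1 : c 1 = 0)
    (h2 : c 2 = 1) : kthRoot c 2 1 = √v := by
  have e : (∑ i ∈ Finset.range (2 + 1), Polynomial.C (c i) * Polynomial.X ^ i :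
      Polynomial ℝ) = (Polynomial.X - Polynomial.C (-√v)) * (Polynomial.X - Polynomial.C √v) := by
    have : v = √v * √v := (Real.mul_self_sqrt hv).symm
    simp only [Finset.sum_range_succ, Finset.sum_range_zero, h0, h1, h2]
    conv_lhs => rw [this]
    simp only [map_sub, map_mul, map_neg, map_zero, map_one]
    ring
  have hne : (Polynomial.X - Polynomial.C (-√v)) * (Polynomial.X - Polynomial.C √v) ≠
      (0 : Polynomial ℝ) := mul_ne_zero (Polynomial.X_sub_C_ne_zero _) (Polynomial.X_sub_C_ne_zero _)
  unfold kthRoot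
  rw [e, Polynomial.roots_mul hne, Polynomial.roots_X_sub_C, Polynomial.roots_X_sub_C,
    Multiset.singleton_add, Multiset.sort_cons]
  · simp
  · simp

end Roots

end MonoCorr

/-! ### Structured programs: denotation, frame properties and running time -/

namespace MonoCorr

theorem State.setIdx_ne (s : State) {v w : ℕ} (n : ℕ) (h : w ≠ v) :
    (s.setIdx v n).idx w = s.idx w :=
  Function.update_of_ne h _ _

theorem State.setIdx_self (s : State) (v n : ℕ) : (s.setIdx v n).idx v = n :=
  Function.update_self _ _ _

/-- Structured programs: loops only in the form `for v < u`. -/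
inductive Prog where
  | skip
  | iset (v : ℕ) (e : IExp)
  | rset (a : ℕ) (i j : IExp) (e : RExp)
  | root (a : ℕ) (i j : IExp) (b : ℕ) (r : IExp) (u : ℕ) (k : IExp)
  | seq (P Q : Prog)
  | ite (b : BExp) (P Q : Prog)
  | loop (v u : ℕ) (P : Prog)

namespace Prog

/-- Translation into the machine language. -/
def compile : Prog → Cmd
  | skip => .skip
  | iset v e => .iset v e
  | rset a i j e => .rset a i j e
  | root a i j b r u k => .root a i j b r (.var u) k
  | seq P Q => .seq P.compile Q.compile
  | ite b P Q => .ite b P.compile Q.compile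
  -- The counter is reset on exit as well, so that after a loop it is known to be `0` whatever the
  -- number of rounds.
  | loop v u P => .seq (.iset v (.lit 0)) (.seq
      (.loop (.ilt (.var v) (.var u)) (.seq P.compile (.iset v (.add (.var v) (.lit 1)))))
      (.iset v (.lit 0)))

open Classical in
/-- The effect of a structured program. -/
noncomputable def den : Prog → State → State
  | skip, s => s
  | iset v e, s => s.setIdx v (e.eval s)
  | rset a i j e, s => s.setMem a (i.eval s) (j.eval s) (e.eval s)
  | root a i j b r u k, s => s.setMem a (i.eval s) (j.eval s)
      (kthRoot (fun l => s.mem b (r.eval s) l) (s.idx u) (k.eval s))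
  | seq P Q, s => Q.den (P.den s)
  | ite b P Q, s => if b.Holds s then P.den s else Q.den s
  | loop v u P, s =>
      ((fun s' => (P.den s').setIdx v ((P.den s').idx v + 1))^[s.idx u] (s.setIdx v 0)).setIdx v 0

/-- The index variables that a program may change. -/
def writes : Prog → List ℕ
  | skip => []
  | iset v _ => [v]
  | rset .. => []
  | root .. => []
  | seq P Q => P.writes ++ Q.writes
  | ite _ P Q => P.writes ++ Q.writes
  | loop v _ P => v :: P.writes

/-- The arrays that a program may change. -/
def arrays : Prog → List ℕ
  | skip => []
  | iset _ _ => []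
  | rset a _ _ _ => [a]
  | root a .. => [a]
  | seq P Q => P.arrays ++ Q.arrays
  | ite _ P Q => P.arrays ++ Q.arrays
  | loop _ _ P => P.arrays

/-- The index variables that bound loops and degrees. -/
def bounds : Prog → List ℕ
  | skip => []
  | iset _ _ => []
  | rset .. => []
  | root _ _ _ _ _ u _ => [u]
  | seq P Q => P.bounds ++ Q.bounds
  | ite _ P Q => P.bounds ++ Q.bounds
  | loop _ u P => u :: P.bounds

/-- No loop changes its own counter in its body. -/
def wf : Prog → Bool
  | skip => true
  | iset _ _ => true
  | rset .. => true
  | root .. => true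
  | seq P Q => P.wf && Q.wf
  | ite _ P Q => P.wf && Q.wf
  | loop v _ P => P.wf && !(P.writes.contains v)

/-- A constant factor of the running time. -/
def size : Prog → ℕ
  | skip => 1
  | iset _ e => e.cost + 1
  | rset _ i j e => i.cost + j.cost + e.cost + 1
  | root _ i j _ r _ k => i.cost + j.cost + r.cost + 1 + k.cost + 1
  | seq P Q => P.size + Q.size
  | ite b P Q => b.cost + P.size + Q.size
  | loop _ _ P => P.size + 14

/-- The exponent of the running time. -/
def depth : Prog → ℕ
  | skip => 0
  | iset _ _ => 0
  | rset .. => 0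
  | root .. => 1
  | seq P Q => max P.depth Q.depth
  | ite _ P Q => max P.depth Q.depth
  | loop _ _ P => P.depth + 1

/-- This and `den_mem` are the frame rules. Their side conditions concern the program text only, so
that they are decided by evaluation for the concrete programs. -/
theorem den_idx (P : Prog) : ∀ (s : State) {v : ℕ}, v ∉ P.writes → (P.den s).idx v = s.idx v := by
  induction P with
  | skip => intros; rfl
  | iset v e =>
    intro s w hw
    simp only [writes, List.mem_singleton] at hw
    simp [den, State.setIdx, hw]
  | rset => intros; rfl
  | root => intros; rfl
  | seq P Q hP hQ =>
    intro s v hv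
    simp only [writes, List.mem_append, not_or] at hv
    simp only [den]
    rw [hQ _ hv.2, hP _ hv.1]
  | ite b P Q hP hQ =>
    intro s v hv
    simp only [writes, List.mem_append, not_or] at hv
    simp only [den]
    split_ifs
    · exact hP _ hv.1
    · exact hQ _ hv.2
  | loop v u P hP =>
    intro s w hw
    simp only [writes, List.mem_cons, not_or] at hw
    have : ∀ n, ((fun s' => (P.den s').setIdx v ((P.den s').idx v + 1))^[n]
        (s.setIdx v 0)).idx w = s.idx w := by
      intro n
      induction n with
      | zero => simp [State.setIdx, hw.1]
      | succ n ih =>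
        rw [Function.iterate_succ_apply']
        simp only [State.setIdx, Function.update_of_ne hw.1] at ih ⊢
        rw [hP _ hw.2, ih]
    simp only [den]
    rw [State.setIdx_ne _ _ hw.1, this]

theorem den_mem (P : Prog) : ∀ (s : State) {a : ℕ}, a ∉ P.arrays → (P.den s).mem a = s.mem a := by
  induction P with
  | skip => intros; rfl
  | iset v e => intros; rfl
  | rset a i j e =>
    intro s w hw
    simp only [arrays, List.mem_singleton] at hw
    simp [den, State.setMem, hw]
  | root =>
    intro s w hw
    simp only [arrays, List.mem_singleton] at hw
    simp [den, State.setMem, hw]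
  | seq P Q hP hQ =>
    intro s v hv
    simp only [arrays, List.mem_append, not_or] at hv
    simp only [den]
    rw [hQ _ hv.2, hP _ hv.1]
  | ite b P Q hP hQ =>
    intro s v hv
    simp only [arrays, List.mem_append, not_or] at hv
    simp only [den]
    split_ifs
    · exact hP _ hv.1
    · exact hQ _ hv.2
  | loop v u P hP =>
    intro s w hw
    simp only [arrays] at hw
    have : ∀ n, ((fun s' => (P.den s').setIdx v ((P.den s').idx v + 1))^[n]
        (s.setIdx v 0)).mem w = s.mem w := by
      intro n
      induction n with
      | zero => rfl
      | succ n ih =>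
        rw [Function.iterate_succ_apply']
        simp only [State.setIdx] at ih ⊢
        rw [hP _ hw, ih]
    simp only [den]
    rw [State.setIdx, this]

/-- Running time of a loop whose body takes at most `c` steps. -/
theorem exec_loop {v u : ℕ} {P : Prog} {I : State → Prop} {c : ℕ} (hvu : v ≠ u)
    (hv : v ∉ P.writes) (hu : u ∉ P.writes) (hI : ∀ s n, I s → I (s.setIdx v n))
    (hstep : ∀ s, I s → I (P.den s) ∧ ∃ t ≤ c, Exec P.compile s t (P.den s)) {s : State} (hs : I s) :
    ∃ t ≤ s.idx u * (c + 7) + 7, Exec (loop v u P).compile s t ((loop v u P).den s) := by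
  -- Here `n` is the number of rounds left. A round costs three steps for the test and four for the
  -- increment besides the body; the failing test costs three, and the two resets outside cost two
  -- each, which explains both sevens.
  have key : ∀ n s, I s → s.idx v + n = s.idx u →
      ∃ t ≤ n * (c + 7) + 3, Exec (.loop (.ilt (.var v) (.var u))
        (.seq P.compile (.iset v (.add (.var v) (.lit 1))))) s t
        ((fun s' => (P.den s').setIdx v ((P.den s').idx v + 1))^[n] s) := by
    intro n
    induction n with
    | zero =>
      intro s _ hn
      refine ⟨3, by omega, Exec.loop_false ?_⟩
      simp only [BExp.Holds, IExp.eval]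
      omega
    | succ n ih =>
      intro s hs hn
      obtain ⟨h1, t, ht, he⟩ := hstep s hs
      have e1 := den_idx P s hv
      have e2 := den_idx P s hu
      obtain ⟨t', ht', he'⟩ := ih ((P.den s).setIdx v ((P.den s).idx v + 1)) (hI _ _ h1) (by
        simp only [State.setIdx, Function.update_self, Function.update_of_ne hvu.symm]
        omega)
      refine ⟨_, ?_, Exec.loop_true ?_ (Exec.seq he (Exec.iset _ _ _)) he'⟩
      · simp only [BExp.cost, IExp.cost]
        rw [add_mul]
        omega
      · simp only [BExp.Holds, IExp.eval]
        omega
  obtain ⟨t, ht, he⟩ := key (s.idx u) (s.setIdx v 0) (hI _ _ hs) (by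
    simp [State.setIdx, Function.update_of_ne hvu.symm])
  refine ⟨_, ?_, Exec.seq (Exec.iset _ _ _) (Exec.seq he (Exec.iset _ _ _))⟩
  simp only [IExp.cost]
  omega

/-- The variables that bound loops and degrees are never written, so one bound `B` holds throughout
and every nesting level contributes a factor `B + 1`. A root extraction counts as one level because
it costs a degree plus one. -/
theorem exec_den (P : Prog) : P.wf = true → ∀ (B : ℕ) (s : State), (∀ u ∈ P.bounds, s.idx u ≤ B) →
    (∀ u ∈ P.bounds, u ∉ P.writes) →
    ∃ t ≤ P.size * (B + 1) ^ P.depth, Exec P.compile s t (P.den s) := by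
  induction P with
  | skip => exact fun _ B s _ _ => ⟨1, by simp [size, depth], Exec.skip s⟩
  | iset v e => exact fun _ B s _ _ => ⟨_, by simp [size, depth], Exec.iset v e s⟩
  | rset a i j e => exact fun _ B s _ _ => ⟨_, by simp [size, depth], Exec.rset a i j e s⟩
  | root a i j b r u k =>
    intro _ B s hB _
    refine ⟨_, ?_, Exec.root a i j b r (.var u) k s⟩
    have := hB u (by simp [bounds])
    simp only [size, depth, IExp.cost, IExp.eval, pow_one]
    nlinarith
  | seq P Q hP hQ =>
    intro hwf B s hB hw
    simp only [wf, Bool.and_eq_true] at hwf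
    simp only [bounds, writes, List.mem_append, not_or] at hB hw
    obtain ⟨t, ht, he⟩ := hP hwf.1 B s (fun u hu => hB u (.inl hu)) fun u hu => (hw u (.inl hu)).1
    obtain ⟨t', ht', he'⟩ := hQ hwf.2 B (P.den s) (fun u hu => by
      rw [den_idx P s (hw u (.inr hu)).1]; exact hB u (.inr hu)) fun u hu => (hw u (.inr hu)).2
    refine ⟨_, ?_, Exec.seq he he'⟩
    have h1 : (B + 1) ^ P.depth ≤ (B + 1) ^ max P.depth Q.depth :=
      Nat.pow_le_pow_right (by omega) (le_max_left _ _)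
    have h2 : (B + 1) ^ Q.depth ≤ (B + 1) ^ max P.depth Q.depth :=
      Nat.pow_le_pow_right (by omega) (le_max_right _ _)
    simp only [size, depth]
    nlinarith [Nat.mul_le_mul_left P.size h1, Nat.mul_le_mul_left Q.size h2]
  | ite b P Q hP hQ =>
    intro hwf B s hB hw
    simp only [wf, Bool.and_eq_true] at hwf
    simp only [bounds, writes, List.mem_append, not_or] at hB hw
    have h0 : 1 ≤ (B + 1) ^ max P.depth Q.depth := Nat.one_le_pow _ _ (by omega)
    have h1 : (B + 1) ^ P.depth ≤ (B + 1) ^ max P.depth Q.depth :=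
      Nat.pow_le_pow_right (by omega) (le_max_left _ _)
    have h2 : (B + 1) ^ Q.depth ≤ (B + 1) ^ max P.depth Q.depth :=
      Nat.pow_le_pow_right (by omega) (le_max_right _ _)
    have h3 := Nat.mul_le_mul_left P.size h1
    have h4 := Nat.mul_le_mul_left Q.size h2
    have h5 := Nat.mul_le_mul_left b.cost h0
    by_cases hb : b.Holds s
    · obtain ⟨t, ht, he⟩ := hP hwf.1 B s (fun u hu => hB u (.inl hu))
        fun u hu => (hw u (.inl hu)).1
      refine ⟨b.cost + t, ?_, ?_⟩
      · simp only [size, depth, add_mul]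
        have := Nat.zero_le (Q.size * (B + 1) ^ max P.depth Q.depth)
        omega
      · rw [den, if_pos hb]; exact Exec.ite_true hb he
    · obtain ⟨t, ht, he⟩ := hQ hwf.2 B s (fun u hu => hB u (.inr hu))
        fun u hu => (hw u (.inr hu)).2
      refine ⟨b.cost + t, ?_, ?_⟩
      · simp only [size, depth, add_mul]
        have := Nat.zero_le (P.size * (B + 1) ^ max P.depth Q.depth)
        omega
      · rw [den, if_neg hb]; exact Exec.ite_false hb he
  | loop v u P hP =>
    intro hwf B s hB hw
    simp only [wf, Bool.and_eq_true, Bool.not_eq_true', List.contains_eq_mem,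
      decide_eq_false_iff_not] at hwf
    simp only [bounds, writes, List.mem_cons, not_or] at hB hw
    have hu := hw u (.inl rfl)
    obtain ⟨t, ht, he⟩ := exec_loop (I := fun s => ∀ w ∈ P.bounds, s.idx w ≤ B) (Ne.symm hu.1) hwf.2
      hu.2 (fun s n hs w hw' => by
        rw [State.setIdx_ne _ _ (hw w (.inr hw')).1]; exact hs w hw')
      (fun s hs => ⟨fun w hw' => by rw [den_idx P s (hw w (.inr hw')).2]; exact hs w hw',
        hP hwf.1 B s hs fun w hw' => (hw w (.inr hw')).2⟩)
      (s := s) fun w hw' => hB w (.inr hw')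
    refine ⟨t, ht.trans ?_, he⟩
    have h1 := hB u (.inl rfl)
    have h0 : 1 ≤ (B + 1) ^ P.depth := Nat.one_le_pow _ _ (by omega)
    simp only [size, depth, pow_succ]
    set X := (B + 1) ^ P.depth
    -- Each of the two sevens is absorbed into `7 * X`, whence the constant `14` in `size`.
    calc s.idx u * (P.size * X + 7) + 7 ≤ B * (P.size * X + 7 * X) + 7 * X := by
          gcongr
          · omega
          · omega
      _ ≤ (P.size + 14) * (X * (B + 1)) := by ring_nf; nlinarith [Nat.zero_le (B * X)]

/-- The states after the rounds of a loop, if they are known explicitly. -/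
theorem den_loop_eq {v u : ℕ} {P : Prog} {s : State} (S : ℕ → State) (h0 : S 0 = s.setIdx v 0)
    (hstep : ∀ k < s.idx u, (P.den (S k)).setIdx v ((P.den (S k)).idx v + 1) = S (k + 1)) :
    (loop v u P).den s = (S (s.idx u)).setIdx v 0 := by
  have : ∀ n ≤ s.idx u, (fun s' => (P.den s').setIdx v ((P.den s').idx v + 1))^[n]
      (s.setIdx v 0) = S n := by
    intro n
    induction n with
    | zero => intro _; exact h0.symm
    | succ n ih =>
      intro hn
      rw [Function.iterate_succ_apply', ih (by omega), hstep n (by omega)]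
  simp only [den]
  rw [this _ le_rfl]

/-- Loop invariants: `I k` holds before round `k`. -/
theorem den_loop_induct {v u : ℕ} {P : Prog} {s : State} (hv : v ∉ P.writes)
    (I : ℕ → State → Prop) (h0 : I 0 (s.setIdx v 0))
    (hstep : ∀ k < s.idx u, ∀ s', I k s' → s'.idx v = k → I (k + 1) ((P.den s').setIdx v (k + 1))) :
    ∃ s', (loop v u P).den s = s'.setIdx v 0 ∧ I (s.idx u) s' := by
  have : ∀ n ≤ s.idx u, ∃ s', (fun s' => (P.den s').setIdx v ((P.den s').idx v + 1))^[n]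
      (s.setIdx v 0) = s' ∧ I n s' ∧ s'.idx v = n := by
    intro n
    induction n with
    | zero => intro _; exact ⟨_, rfl, h0, by simp [State.setIdx]⟩
    | succ n ih =>
      intro hn
      obtain ⟨s', h1, h2, h3⟩ := ih (by omega)
      refine ⟨_, rfl, ?_, ?_⟩
      · rw [Function.iterate_succ_apply', h1, den_idx P s' hv, h3]
        exact hstep n (by omega) s' h2 h3
      · rw [Function.iterate_succ_apply', h1, den_idx P s' hv, h3]
        simp [State.setIdx]
  obtain ⟨s', h1, h2, -⟩ := this _ le_rfl
  exact ⟨s', by simp only [den]; rw [h1], h2⟩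

end Prog

/-- The index variables read by an index expression. -/
def IExp.vars : IExp → List ℕ
  | .lit _ => []
  | .var v => [v]
  | .add e₁ e₂ => e₁.vars ++ e₂.vars
  | .sub e₁ e₂ => e₁.vars ++ e₂.vars

theorem IExp.eval_congr {s s' : State} (e : IExp) (h : ∀ v ∈ e.vars, s.idx v = s'.idx v) :
    e.eval s = e.eval s' := by
  induction e with
  | lit => rfl
  | var v => exact h v (by simp [vars])
  | add e₁ e₂ h1 h2 =>
    simp only [vars, List.mem_append] at h
    simp only [eval]
    rw [h1 fun v hv => h v (.inl hv), h2 fun v hv => h v (.inr hv)]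
  | sub e₁ e₂ h1 h2 =>
    simp only [vars, List.mem_append] at h
    simp only [eval]
    rw [h1 fun v hv => h v (.inl hv), h2 fun v hv => h v (.inr hv)]

/-- The arrays read by a real expression. -/
def RExp.arrays : RExp → List ℕ
  | .zero => []
  | .one => []
  | .cell a _ _ => [a]
  | .add e₁ e₂ => e₁.arrays ++ e₂.arrays
  | .sub e₁ e₂ => e₁.arrays ++ e₂.arrays
  | .mul e₁ e₂ => e₁.arrays ++ e₂.arrays
  | .div e₁ e₂ => e₁.arrays ++ e₂.arrays

theorem RExp.eval_congr {s s' : State} (hi : s.idx = s'.idx) (e : RExp)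
    (h : ∀ a ∈ e.arrays, s.mem a = s'.mem a) : e.eval s = e.eval s' := by
  have hI : ∀ i : IExp, i.eval s = i.eval s' := fun i => i.eval_congr fun v _ => by rw [hi]
  induction e with
  | zero => rfl
  | one => rfl
  | cell a i j =>
    simp only [eval, hI]
    rw [h a (by simp [arrays])]
  | add e₁ e₂ h1 h2 | sub e₁ e₂ h1 h2 | mul e₁ e₂ h1 h2 | div e₁ e₂ h1 h2 =>
    simp only [arrays, List.mem_append] at h
    simp only [eval]
    rw [h1 fun v hv => h v (.inl hv), h2 fun v hv => h v (.inr hv)]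

/-- The arrays read by a test. -/
def BExp.arrays : BExp → List ℕ
  | .ilt _ _ => []
  | .rlt e₁ e₂ => e₁.arrays ++ e₂.arrays
  | .not b => b.arrays
  | .and b₁ b₂ => b₁.arrays ++ b₂.arrays

theorem BExp.holds_congr {s s' : State} (hi : s.idx = s'.idx) (b : BExp)
    (h : ∀ a ∈ b.arrays, s.mem a = s'.mem a) : b.Holds s ↔ b.Holds s' := by
  have hI : ∀ i : IExp, i.eval s = i.eval s' := fun i => i.eval_congr fun v _ => by rw [hi]
  induction b with
  | ilt e₁ e₂ => simp only [Holds, hI]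
  | rlt e₁ e₂ =>
    simp only [arrays, List.mem_append] at h
    simp only [Holds]
    rw [e₁.eval_congr hi fun v hv => h v (.inl hv), e₂.eval_congr hi fun v hv => h v (.inr hv)]
  | not b ih => simp only [Holds, ih h]
  | and b₁ b₂ h1 h2 =>
    simp only [arrays, List.mem_append] at h
    simp only [Holds]
    exact and_congr (h1 fun v hv => h v (.inl hv)) (h2 fun v hv => h v (.inr hv))

/-! ### Tables of double sums -/

namespace Prog

/-- `fill a r c n₁ n₂ n₃ n₄ b e₁ e₂` writes, for `i < n₁` and `j < n₂`, into cell
`(r + i, c + j)` of array `a` the sum over `k < n₃` and `l < n₄` of `e₁` (where `b` holds) and `e₂`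
(elsewhere).  In these expressions `i`, `j`, `k`, `l` are the index variables 20, 21, 22, 23. -/
def fill (a : ℕ) (r c : IExp) (n₁ n₂ n₃ n₄ : ℕ) (b : BExp) (e₁ e₂ : RExp) : Prog :=
  .loop 20 n₁ (.loop 21 n₂ (.seq (.rset a (.add r (.var 20)) (.add c (.var 21)) .zero)
    (.loop 22 n₃ (.loop 23 n₄ (.ite b
      (.rset a (.add r (.var 20)) (.add c (.var 21))
        (.add (.cell a (.add r (.var 20)) (.add c (.var 21))) e₁))
      (.rset a (.add r (.var 20)) (.add c (.var 21))
        (.add (.cell a (.add r (.var 20)) (.add c (.var 21))) e₂)))))))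

end Prog

/-- The state with the four counters of `fill` set. -/
def State.at (s : State) (i j k l : ℕ) : State :=
  (((s.setIdx 20 i).setIdx 21 j).setIdx 22 k).setIdx 23 l

open Classical in
/-- The summand of `fill`. -/
noncomputable def fillTerm (b : BExp) (e₁ e₂ : RExp) (s : State) : ℝ :=
  if b.Holds s then e₁.eval s else e₂.eval s

theorem fillTerm_congr {a : ℕ} {b : BExp} {e₁ e₂ : RExp}
    (ha : a ∉ b.arrays ++ e₁.arrays ++ e₂.arrays) {s s' : State} (hi : s.idx = s'.idx)
    (hm : ∀ a' ≠ a, s.mem a' = s'.mem a') : fillTerm b e₁ e₂ s = fillTerm b e₁ e₂ s' := by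
  simp only [List.mem_append, not_or] at ha
  have h : ∀ l : List ℕ, a ∉ l → ∀ a' ∈ l, s.mem a' = s'.mem a' := fun l hl a' ha' =>
    hm a' fun he => hl (he ▸ ha')
  unfold fillTerm
  rw [e₁.eval_congr hi (h _ ha.1.2), e₂.eval_congr hi (h _ ha.2)]
  classical exact if_congr (b.holds_congr hi (h _ ha.1.1)) rfl rfl

/-- Whether the counters of `fill` are at rest. -/
def State.Clean (s : State) : Prop := s.idx 20 = 0 ∧ s.idx 21 = 0 ∧ s.idx 22 = 0 ∧ s.idx 23 = 0

theorem State.ext_iff' {s s' : State} (h1 : s.idx = s'.idx) (h2 : s.mem = s'.mem) : s = s' := by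
  cases s; cases s'; cases h1; cases h2; rfl

namespace Prog

-- The target array is not read by the test or the summands, so these depend only on the initial
-- memory and the counters, and the accumulation can be described by explicit states. The offsets
-- and bounds avoid the counters and are therefore constant during the run.
open Classical in
theorem den_fill {a : ℕ} {r c : IExp} {n₁ n₂ n₃ n₄ : ℕ} {b : BExp} {e₁ e₂ : RExp}
    (ha : a ∉ b.arrays ++ e₁.arrays ++ e₂.arrays)
    (hr : ∀ v ∈ r.vars ++ c.vars ++ [n₁, n₂, n₃, n₄], v < 20 ∨ 23 < v) {s : State}
    (hs : s.Clean) :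
    (fill a r c n₁ n₂ n₃ n₄ b e₁ e₂).den s = ⟨s.idx, fun a' i j =>
      if a' = a ∧ (r.eval s ≤ i ∧ i < r.eval s + s.idx n₁) ∧
          (c.eval s ≤ j ∧ j < c.eval s + s.idx n₂) then
        ∑ k ∈ Finset.range (s.idx n₃), ∑ l ∈ Finset.range (s.idx n₄),
          fillTerm b e₁ e₂ (s.at (i - r.eval s) (j - c.eval s) k l)
      else s.mem a' i j⟩ := by
  simp only [List.mem_append, List.mem_cons, List.not_mem_nil, or_false] at hr
  have hn₁ := hr n₁ (by simp)
  have hn₂ := hr n₂ (by simp)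
  have hn₃ := hr n₃ (by simp)
  have hn₄ := hr n₄ (by simp)
  have rcong : ∀ s' : State, (∀ v, v < 20 ∨ 23 < v → s'.idx v = s.idx v) → r.eval s' = r.eval s :=
    fun s' h => r.eval_congr fun v hv => h v (hr v (by simp [hv]))
  have ccong : ∀ s' : State, (∀ v, v < 20 ∨ 23 < v → s'.idx v = s.idx v) → c.eval s' = c.eval s :=
    fun s' h => c.eval_congr fun v hv => h v (hr v (by simp [hv]))
  set R := r.eval s
  set C := c.eval s
  set V : ℕ → ℕ → ℕ → ℕ → ℝ := fun i j k l => fillTerm b e₁ e₂ (s.at i j k l) with hV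
  -- a state during the run, with the cell under construction holding `x`
  let U : (ℕ → ℕ → ℕ → ℝ) → ℕ → ℕ → ℕ → ℕ → State := fun M i j k l =>
    ⟨(s.at i j k l).idx, M⟩
  have Uidx : ∀ M i j k l v, v < 20 ∨ 23 < v → (U M i j k l).idx v = s.idx v := by
    intro M i j k l v hv
    simp only [U, State.at, State.setIdx]
    rw [Function.update_of_ne (by omega), Function.update_of_ne (by omega),
      Function.update_of_ne (by omega), Function.update_of_ne (by omega)]
  have Uclean : s = U s.mem 0 0 0 0 := by
    obtain ⟨h1, h2, h3, h4⟩ := hs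
    refine State.ext_iff' (funext fun v => ?_) rfl
    simp only [U, State.at, State.setIdx, Function.update_apply]
    split_ifs <;> first | rfl | (subst_vars; assumption)
  have U20 : ∀ M i j k l n, (U M i j k l).setIdx 20 n = U M n j k l := by
    intro M i j k l n
    refine State.ext_iff' (funext fun v => ?_) rfl
    simp only [U, State.at, State.setIdx, Function.update_apply]
    split_ifs <;> first | rfl | omega
  have U21 : ∀ M i j k l n, (U M i j k l).setIdx 21 n = U M i n k l := by
    intro M i j k l n
    refine State.ext_iff' (funext fun v => ?_) rfl
    simp only [U, State.at, State.setIdx, Function.update_apply]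
    split_ifs <;> first | rfl | omega
  have U22 : ∀ M i j k l n, (U M i j k l).setIdx 22 n = U M i j n l := by
    intro M i j k l n
    refine State.ext_iff' (funext fun v => ?_) rfl
    simp only [U, State.at, State.setIdx, Function.update_apply]
    split_ifs <;> first | rfl | omega
  have U23 : ∀ M i j k l n, (U M i j k l).setIdx 23 n = U M i j k n := by
    intro M i j k l n
    refine State.ext_iff' (funext fun v => ?_) rfl
    simp only [U, State.at, State.setIdx, Function.update_apply]
    split_ifs <;> rfl
  have v20 : ∀ M i j k l, (U M i j k l).idx 20 = i := by
    intros; simp [U, State.at, State.setIdx]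
  have v21 : ∀ M i j k l, (U M i j k l).idx 21 = j := by
    intros; simp [U, State.at, State.setIdx]
  have v22 : ∀ M i j k l, (U M i j k l).idx 22 = k := by
    intros; simp [U, State.at, State.setIdx]
  have v23 : ∀ M i j k l, (U M i j k l).idx 23 = l := by
    intros; simp [U, State.at, State.setIdx]
  have Ur : ∀ M i j k l, (IExp.add r (.var 20)).eval (U M i j k l) = R + i := by
    intro M i j k l
    simp only [IExp.eval, v20]
    rw [rcong _ (Uidx M i j k l)]
  have Uc : ∀ M i j k l, (IExp.add c (.var 21)).eval (U M i j k l) = C + j := by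
    intro M i j k l
    simp only [IExp.eval, v21]
    rw [ccong _ (Uidx M i j k l)]
  have UV : ∀ M i j k l, (∀ a' ≠ a, M a' = s.mem a') →
      fillTerm b e₁ e₂ (U M i j k l) = V i j k l := fun M i j k l hM =>
    fillTerm_congr ha rfl fun a' ha' => hM a' ha'
  have Uset : ∀ M i j k l i' j' x, (U M i j k l).setMem a i' j' x =
      U (fun a' i'' j'' => if a' = a ∧ i'' = i' ∧ j'' = j' then x else M a' i'' j'') i j k l :=
    fun _ _ _ _ _ _ _ _ => rfl
  -- The functions `ins`, `row` and `box` give the memory after one cell, an initial segment of a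
  -- row, and an initial block of rows have been treated. They are the explicit states fed to
  -- `den_loop_eq` at the successive loop levels.
  let ins : (ℕ → ℕ → ℕ → ℝ) → ℕ → ℕ → ℝ → ℕ → ℕ → ℕ → ℝ := fun M i j x a' i'' j'' =>
    if a' = a ∧ i'' = R + i ∧ j'' = C + j then x else M a' i'' j''
  have ins_ins : ∀ M i j x y, ins (ins M i j x) i j y = ins M i j y := by
    intro M i j x y
    funext a' i'' j''
    simp only [ins]
    split_ifs <;> rfl
  have ins_self : ∀ M i j, ins M i j (M a (R + i) (C + j)) = M := by
    intro M i j
    funext a' i'' j''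
    simp only [ins]
    split_ifs with h
    · rw [h.1, h.2.1, h.2.2]
    · rfl
  have ins_at : ∀ M i j x, ins M i j x a (R + i) (C + j) = x := by
    intro M i j x
    simp [ins]
  have ins_ne : ∀ M i j x, (∀ a' ≠ a, M a' = s.mem a') → ∀ a' ≠ a, ins M i j x a' = s.mem a' := by
    intro M i j x hM a' ha'
    funext i'' j''
    simp only [ins, ha', false_and, if_false]
    rw [hM a' ha']
  have step4 : ∀ M i j k l, (∀ a' ≠ a, M a' = s.mem a') →
      (ite b (.rset a (.add r (.var 20)) (.add c (.var 21))
        (.add (.cell a (.add r (.var 20)) (.add c (.var 21))) e₁))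
      (.rset a (.add r (.var 20)) (.add c (.var 21))
        (.add (.cell a (.add r (.var 20)) (.add c (.var 21))) e₂))).den (U M i j k l) =
      U (ins M i j (M a (R + i) (C + j) + V i j k l)) i j k l := by
    intro M i j k l hM
    rw [← UV M i j k l hM]
    simp only [den, RExp.eval, Ur, Uc, Uset, fillTerm]
    split_ifs <;> rfl
  have step3 : ∀ M i j k, (∀ a' ≠ a, M a' = s.mem a') →
      (loop 23 n₄ (ite b (.rset a (.add r (.var 20)) (.add c (.var 21))
        (.add (.cell a (.add r (.var 20)) (.add c (.var 21))) e₁))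
      (.rset a (.add r (.var 20)) (.add c (.var 21))
        (.add (.cell a (.add r (.var 20)) (.add c (.var 21))) e₂)))).den (U M i j k 0) =
      U (ins M i j (M a (R + i) (C + j) + ∑ l ∈ Finset.range (s.idx n₄), V i j k l)) i j k 0 := by
    intro M i j k hM
    rw [den_loop_eq (fun l => U (ins M i j (M a (R + i) (C + j) +
      ∑ l' ∈ Finset.range l, V i j k l')) i j k l), U23, Uidx _ _ _ _ _ _ hn₄]
    · simp only [Finset.range_zero, Finset.sum_empty, add_zero, ins_self, U23]
    · intro l _
      rw [step4 _ _ _ _ _ (ins_ne _ _ _ _ hM), ins_ins, ins_at, v23, U23, Finset.sum_range_succ,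
        add_assoc]
  have step2 : ∀ M i j, (∀ a' ≠ a, M a' = s.mem a') →
      (loop 22 n₃ (loop 23 n₄ (ite b (.rset a (.add r (.var 20)) (.add c (.var 21))
        (.add (.cell a (.add r (.var 20)) (.add c (.var 21))) e₁))
      (.rset a (.add r (.var 20)) (.add c (.var 21))
        (.add (.cell a (.add r (.var 20)) (.add c (.var 21))) e₂))))).den (U M i j 0 0) =
      U (ins M i j (M a (R + i) (C + j) + ∑ k ∈ Finset.range (s.idx n₃),
        ∑ l ∈ Finset.range (s.idx n₄), V i j k l)) i j 0 0 := by
    intro M i j hM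
    rw [den_loop_eq (fun k => U (ins M i j (M a (R + i) (C + j) +
      ∑ k' ∈ Finset.range k, ∑ l ∈ Finset.range (s.idx n₄), V i j k' l)) i j k 0), U22,
      Uidx _ _ _ _ _ _ hn₃]
    · simp only [Finset.range_zero, Finset.sum_empty, add_zero, ins_self, U22]
    · intro k _
      rw [step3 _ _ _ _ (ins_ne _ _ _ _ hM), ins_ins, ins_at, v22, U22, Finset.sum_range_succ,
        add_assoc]
  set tot : ℕ → ℕ → ℝ := fun i j => ∑ k ∈ Finset.range (s.idx n₃),
    ∑ l ∈ Finset.range (s.idx n₄), V i j k l with htot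
  have step1 : ∀ M i j, (∀ a' ≠ a, M a' = s.mem a') →
      (seq (rset a (.add r (.var 20)) (.add c (.var 21)) .zero)
        (loop 22 n₃ (loop 23 n₄ (ite b (.rset a (.add r (.var 20)) (.add c (.var 21))
        (.add (.cell a (.add r (.var 20)) (.add c (.var 21))) e₁))
      (.rset a (.add r (.var 20)) (.add c (.var 21))
        (.add (.cell a (.add r (.var 20)) (.add c (.var 21))) e₂)))))).den (U M i j 0 0) =
      U (ins M i j (tot i j)) i j 0 0 := by
    intro M i j hM
    have : (rset a (.add r (.var 20)) (.add c (.var 21)) .zero).den (U M i j 0 0) =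
        U (ins M i j 0) i j 0 0 := by
      simp only [den, RExp.eval, Ur, Uc, Uset, ins]
    rw [den, this, step2 _ _ _ (ins_ne _ _ _ _ hM), ins_ins, ins_at, zero_add]
  let row : (ℕ → ℕ → ℕ → ℝ) → ℕ → ℕ → ℕ → ℕ → ℕ → ℝ := fun M i n a' i'' j'' =>
    if a' = a ∧ i'' = R + i ∧ (C ≤ j'' ∧ j'' < C + n) then tot (i'' - R) (j'' - C)
    else M a' i'' j''
  have row_ne : ∀ M i n, (∀ a' ≠ a, M a' = s.mem a') → ∀ a' ≠ a, row M i n a' = s.mem a' := by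
    intro M i n hM a' ha'
    funext i'' j''
    simp only [row, ha', false_and, if_false]
    rw [hM a' ha']
  have step0 : ∀ M i, (∀ a' ≠ a, M a' = s.mem a') →
      (loop 21 n₂ (seq (rset a (.add r (.var 20)) (.add c (.var 21)) .zero)
        (loop 22 n₃ (loop 23 n₄ (ite b (.rset a (.add r (.var 20)) (.add c (.var 21))
        (.add (.cell a (.add r (.var 20)) (.add c (.var 21))) e₁))
      (.rset a (.add r (.var 20)) (.add c (.var 21))
        (.add (.cell a (.add r (.var 20)) (.add c (.var 21))) e₂))))))).den (U M i 0 0 0) =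
      U (row M i (s.idx n₂)) i 0 0 0 := by
    intro M i hM
    rw [den_loop_eq (fun j => U (row M i j) i j 0 0), U21, Uidx _ _ _ _ _ _ hn₂]
    · rw [U21]
      congr 1
      funext a' i'' j''
      simp only [row]
      rw [if_neg (by omega)]
    · intro j _
      rw [step1 _ _ _ (row_ne _ _ _ hM), v21, U21]
      congr 1
      funext a' i'' j''
      simp only [ins, row]
      by_cases h1 : a' = a ∧ i'' = R + i ∧ j'' = C + j
      · rw [if_pos h1, if_pos (by omega)]
        congr 1 <;> omega
      · rw [if_neg h1]
        by_cases h2 : a' = a ∧ i'' = R + i ∧ (C ≤ j'' ∧ j'' < C + j)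
        · rw [if_pos h2, if_pos (by omega)]
        · rw [if_neg h2, if_neg (by omega)]
  let box : ℕ → ℕ → ℕ → ℕ → ℝ := fun n a' i'' j'' =>
    if a' = a ∧ (R ≤ i'' ∧ i'' < R + n) ∧ (C ≤ j'' ∧ j'' < C + s.idx n₂) then
      tot (i'' - R) (j'' - C) else s.mem a' i'' j''
  have box_ne : ∀ n, ∀ a' ≠ a, box n a' = s.mem a' := by
    intro n a' ha'
    funext i'' j''
    simp only [box, ha', false_and, if_false]
  rw [fill]
  conv_lhs => rw [Uclean]
  rw [den_loop_eq (fun i => U (box i) i 0 0 0), U20, Uidx _ _ _ _ _ _ hn₁]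
  · have h1 := congrArg State.idx Uclean
    exact State.ext_iff' h1.symm rfl
  · rw [U20]
    congr 1
    funext a' i'' j''
    simp only [box]
    rw [if_neg (by omega)]
  · intro i _
    rw [step0 _ _ (box_ne _), v20, U20]
    congr 1
    funext a' i'' j''
    simp only [row, box]
    by_cases h1 : a' = a ∧ i'' = R + i ∧ (C ≤ j'' ∧ j'' < C + s.idx n₂)
    · rw [if_pos h1, if_pos (by omega)]
    · rw [if_neg h1]
      by_cases h2 : a' = a ∧ (R ≤ i'' ∧ i'' < R + i) ∧ (C ≤ j'' ∧ j'' < C + s.idx n₂)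
      · rw [if_pos h2, if_pos (by omega)]
      · rw [if_neg h2, if_neg (by omega)]

end Prog

end MonoCorr


namespace MonoCorr

/-! ### The symmetric operator attached to a merging of symbols -/

section Merged

variable {X Y : Type*} [Fintype X] [Fintype Y] {p : X → Y → ℝ} {κ : Type*} [Fintype κ]
  [DecidableEq κ]

/-- The two marginals, as one weight on the disjoint union. -/
def jointWeight (p : X → Y → ℝ) : X ⊕ Y → ℝ := Sum.elim (margX p) (margY p)

/-- The centred kernel of the joint law, symmetrised on the disjoint union. -/
def jointKernel (p : X → Y → ℝ) : X ⊕ Y → X ⊕ Y → ℝ :=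
  Sum.elim (fun x => Sum.elim (fun _ => 0) fun y => p x y - margX p x * margY p y)
    fun y => Sum.elim (fun x => p x y - margX p x * margY p y) fun _ => 0

/-- The weight of a class of merged symbols. -/
def classWeight (p : X → Y → ℝ) (lab : X ⊕ Y → κ) (c : κ) : ℝ :=
  ∑ z, if lab z = c then jointWeight p z else 0

/-- The normalised kernel of the merged symbols. -/
noncomputable def classMatrix (p : X → Y → ℝ) (lab : X ⊕ Y → κ) : Matrix κ κ ℝ := fun c d =>
  ∑ z, ∑ z', (if lab z = c then 1 else 0) * jointKernel p z z' * (if lab z' = d then 1 else 0) /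
    (√(classWeight p lab c) * √(classWeight p lab d))

/-- The normalised kernel as an operator. -/
noncomputable def classOp (p : X → Y → ℝ) (lab : X ⊕ Y → κ) :
    EuclideanSpace ℝ κ →ₗ[ℝ] EuclideanSpace ℝ κ := (classMatrix p lab).toEuclideanLin

/-- The function on symbols that belongs to a vector indexed by classes. -/
noncomputable def classFun (p : X → Y → ℝ) (lab : X ⊕ Y → κ) (u : EuclideanSpace ℝ κ) :
    X ⊕ Y → ℝ := fun z => u (lab z) / √(classWeight p lab (lab z))

theorem jointWeight_nonneg (hp : IsJointPMF p) (z : X ⊕ Y) : 0 ≤ jointWeight p z := by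
  rcases z with x | y
  · exact margX_nonneg hp x
  · exact margX_nonneg hp.swap y

theorem jointKernel_symm (z z' : X ⊕ Y) : jointKernel p z z' = jointKernel p z' z := by
  rcases z with x | y <;> rcases z' with x' | y' <;> rfl

theorem classWeight_nonneg (hp : IsJointPMF p) (lab : X ⊕ Y → κ) (c : κ) :
    0 ≤ classWeight p lab c := by
  refine Finset.sum_nonneg fun z _ => ?_
  split_ifs
  · exact jointWeight_nonneg hp z
  · exact le_rfl

theorem classWeight_pos (hp : IsJointPMF p) (lab : X ⊕ Y → κ) {z : X ⊕ Y}
    (hz : 0 < jointWeight p z) : 0 < classWeight p lab (lab z) := by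
  refine lt_of_lt_of_le hz ?_
  have : jointWeight p z = if lab z = lab z then jointWeight p z else 0 := by simp
  rw [this]
  refine Finset.single_le_sum (f := fun z' => if lab z' = lab z then jointWeight p z' else 0)
    (fun z' _ => ?_) (Finset.mem_univ z)
  change 0 ≤ if lab z' = lab z then jointWeight p z' else 0
  split_ifs
  · exact jointWeight_nonneg hp z'
  · exact le_rfl

theorem mean_snd (g : Y → ℝ) : mean p (fun _ y => g y) = ∑ y, margY p y * g y := by
  rw [← mean_swap_fst]
  exact mean_fst g

theorem cov_eq_sum (hp : IsJointPMF p) (f : X → ℝ) (g : Y → ℝ) :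
    cov p f g = ∑ x, ∑ y, (p x y - margX p x * margY p y) * (f x * g y) := by
  rw [cov_eq, covForm_eq hp]
  have h1 : mean p (liftX X Y f) = ∑ x, margX p x * f x := mean_fst f
  have h2 : mean p (liftY X Y g) = ∑ y, margY p y * g y := mean_snd g
  rw [h1, h2, Finset.sum_mul_sum]
  simp only [mean, ← Finset.sum_sub_distrib]
  refine Finset.sum_congr rfl fun x _ => Finset.sum_congr rfl fun y _ => ?_
  simp only [liftX, liftY, LinearMap.coe_mk, AddHom.coe_mk]
  ring

/-- The kernel is zero within `X` and within `Y`, so only the two cross covariances remain. -/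
theorem sum_jointKernel (hp : IsJointPMF p) (h h' : X ⊕ Y → ℝ) :
    ∑ z, ∑ z', h' z * jointKernel p z z' * h z' =
      cov p (h' ∘ Sum.inl) (h ∘ Sum.inr) + cov p (h ∘ Sum.inl) (h' ∘ Sum.inr) := by
  rw [cov_eq_sum hp, cov_eq_sum hp, Fintype.sum_sum_type]
  congr 1
  · refine Finset.sum_congr rfl fun x _ => ?_
    rw [Fintype.sum_sum_type]
    simp only [jointKernel, Sum.elim_inl, Sum.elim_inr, mul_zero, zero_mul,
      Finset.sum_const_zero, zero_add, Function.comp]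
    exact Finset.sum_congr rfl fun y _ => by ring
  · rw [Finset.sum_comm]
    simp only [Fintype.sum_sum_type]
    simp only [jointKernel, Sum.elim_inl, Sum.elim_inr, mul_zero, zero_mul,
      Finset.sum_const_zero, add_zero, Function.comp]
    exact Finset.sum_congr rfl fun x _ => Finset.sum_congr rfl fun y _ => by ring

theorem sum_jointWeight (F : X ⊕ Y → ℝ) :
    ∑ z, jointWeight p z * F z = mean p (fun x _ => F (.inl x)) + mean p fun _ y => F (.inr y) := by
  rw [mean_fst, mean_snd, Fintype.sum_sum_type]
  rfl

theorem classMatrix_symm (lab : X ⊕ Y → κ) (c d : κ) :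
    classMatrix p lab c d = classMatrix p lab d c := by
  unfold classMatrix
  rw [Finset.sum_comm]
  refine Finset.sum_congr rfl fun z _ => Finset.sum_congr rfl fun z' _ => ?_
  rw [jointKernel_symm z' z, mul_comm (√(classWeight p lab c))]
  ring

theorem classOp_isSymmetric (lab : X ⊕ Y → κ) : (classOp p lab).IsSymmetric := by
  rw [classOp, Matrix.isSymmetric_toEuclideanLin_iff]
  ext c d
  simp [Matrix.conjTranspose_apply, classMatrix_symm lab d c]

theorem classOp_apply (lab : X ⊕ Y → κ) (u : EuclideanSpace ℝ κ) (c : κ) :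
    classOp p lab u c = ∑ d, classMatrix p lab c d * u d := by
  simp [classOp, Matrix.toLpLin_apply, Matrix.mulVec, dotProduct]

theorem sum_lab (lab : X ⊕ Y → κ) (F : κ → ℝ) (z : X ⊕ Y) :
    ∑ c, (if lab z = c then 1 else 0) * F c = F (lab z) := by
  simp

/-- Dividing by square roots of class weights turns covariances of merged functions into a form on a
standard Euclidean space. The resulting symmetric operator is covered by the spectral argument
above. -/
theorem inner_classOp (hp : IsJointPMF p) (lab : X ⊕ Y → κ) (u u' : EuclideanSpace ℝ κ) :
    inner ℝ u' (classOp p lab u) =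
      cov p (classFun p lab u' ∘ Sum.inl) (classFun p lab u ∘ Sum.inr) +
        cov p (classFun p lab u ∘ Sum.inl) (classFun p lab u' ∘ Sum.inr) := by
  rw [← sum_jointKernel hp, PiLp.inner_apply]
  simp only [classOp_apply, RCLike.inner_apply, conj_trivial, classMatrix, Finset.sum_mul]
  have : ∀ z z', classFun p lab u' z * jointKernel p z z' * classFun p lab u z' =
      ∑ c, ∑ d, (if lab z = c then 1 else 0) * jointKernel p z z' *
        (if lab z' = d then 1 else 0) / (√(classWeight p lab c) * √(classWeight p lab d)) *
        u d * u' c := by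
    intro z z'
    rw [classFun, classFun, ← sum_lab lab (fun c => u' c / √(classWeight p lab c)) z,
      ← sum_lab lab (fun c => u c / √(classWeight p lab c)) z', mul_assoc, Finset.sum_mul]
    refine Finset.sum_congr rfl fun c _ => ?_
    rw [Finset.mul_sum, Finset.mul_sum]
    refine Finset.sum_congr rfl fun d _ => ?_
    rw [div_eq_mul_inv, div_eq_mul_inv, div_eq_mul_inv, mul_inv]
    ring
  simp only [this]
  rw [Finset.sum_comm' (t' := Finset.univ) (s' := fun _ => Finset.univ) (by simp)]
  conv_rhs =>
    rw [Finset.sum_comm]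
    enter [2, z']
    rw [Finset.sum_comm]
    enter [2, c]
    rw [Finset.sum_comm]
  rw [Finset.sum_comm]
  conv_rhs =>
    rw [Finset.sum_comm]
    enter [2, c]
    rw [Finset.sum_comm]
  refine Finset.sum_congr rfl fun c _ => Finset.sum_congr rfl fun d _ => ?_
  rw [Finset.sum_comm]

/-- A function that is constant on classes comes from a vector, up to symbols of weight zero. -/
noncomputable def classVec (p : X → Y → ℝ) (lab : X ⊕ Y → κ) (h : X ⊕ Y → ℝ) :
    EuclideanSpace ℝ κ := open Classical in
  WithLp.toLp 2 fun c => √(classWeight p lab c) *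
    if hc : ∃ z, lab z = c then h hc.choose else 0

theorem classFun_classVec (hp : IsJointPMF p) {lab : X ⊕ Y → κ} {h : X ⊕ Y → ℝ}
    (hh : ∀ z z', lab z = lab z' → h z = h z') {z : X ⊕ Y} (hz : 0 < jointWeight p z) :
    classFun p lab (classVec p lab h) z = h z := by
  have hc : ∃ z', lab z' = lab z := ⟨z, rfl⟩
  have h0 := (Real.sqrt_pos.2 (classWeight_pos hp lab hz)).ne'
  simp only [classFun, classVec, dif_pos hc]
  rw [mul_div_cancel_left₀ _ h0]
  exact hh _ _ hc.choose_spec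

/-- A class of weight zero contributes to the Euclidean product but not to the weighted sum; hence
the condition on `u`. -/
theorem inner_eq_sum (hp : IsJointPMF p) (lab : X ⊕ Y → κ) {u : EuclideanSpace ℝ κ}
    (hu : ∀ c, classWeight p lab c = 0 → u c = 0) (u' : EuclideanSpace ℝ κ) :
    inner ℝ u' u = ∑ z, jointWeight p z * (classFun p lab u' z * classFun p lab u z) := by
  have h1 : ∀ c, inner ℝ (u' c) (u c) = ∑ z, if lab z = c then
      jointWeight p z * (u' c / √(classWeight p lab c) * (u c / √(classWeight p lab c))) else 0 := by
    intro c
    have : ∀ z, (if lab z = c then jointWeight p z * (u' c / √(classWeight p lab c) *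
        (u c / √(classWeight p lab c))) else 0) = (if lab z = c then jointWeight p z else 0) *
        (u' c / √(classWeight p lab c) * (u c / √(classWeight p lab c))) := by
      intro z; split_ifs <;> simp
    simp only [this, ← Finset.sum_mul]
    change _ = classWeight p lab c * _
    rcases (classWeight_nonneg hp lab c).eq_or_lt with h0 | h0
    · rw [hu c h0.symm]; simp
    · have hs := (Real.sqrt_pos.2 h0).ne'
      rw [div_mul_div_comm, Real.mul_self_sqrt h0.le, mul_div_cancel₀ _ h0.ne']
      simp [mul_comm]
  rw [PiLp.inner_apply]
  simp only [h1]
  rw [Finset.sum_comm]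
  refine Finset.sum_congr rfl fun z _ => ?_
  simp [classFun]

theorem classVec_eq_zero (lab : X ⊕ Y → κ) (h : X ⊕ Y → ℝ) {c : κ}
    (hc : classWeight p lab c = 0) : classVec p lab h c = 0 := by
  simp [classVec, hc]

/-- Rows of weight-zero classes vanish because the quotient by `√0` is `0`, so an eigenvector with
nonzero eigenvalue vanishes there too. -/
theorem eq_zero_of_eigen {lab : X ⊕ Y → κ} {v : EuclideanSpace ℝ κ} {σ : ℝ} (hσ : σ ≠ 0)
    (hv : classOp p lab v = σ • v) {c : κ} (hc : classWeight p lab c = 0) : v c = 0 := by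
  have h1 : classOp p lab v c = 0 := by
    rw [classOp_apply]
    simp [classMatrix, hc]
  rw [hv] at h1
  simpa [hσ] using h1

theorem varX_of_mean (f : X → ℝ) (h : mean p (fun x _ => f x) = 0) :
    varX p f = mean p fun x _ => f x * f x := by
  simp [varX, h, pow_two]

theorem varY_of_mean (g : Y → ℝ) (h : mean p (fun _ y => g y) = 0) :
    varY p g = mean p fun _ y => g y * g y := by
  simp [varY, h, pow_two]

theorem cov_const_left (hp : IsJointPMF p) (c : ℝ) (g : Y → ℝ) : cov p (fun _ => c) g = 0 := by
  simp [cov, mean_const hp]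

theorem cov_const_right (hp : IsJointPMF p) (f : X → ℝ) (c : ℝ) : cov p f (fun _ => c) = 0 := by
  simp [cov, mean_const hp]

end Merged

/-! ### Eigenvectors of the merged operator and optimal monotone pairs -/

section Tight

variable {X Y : Type*} [Fintype X] [Fintype Y] [PartialOrder X] [PartialOrder Y] {p : X → Y → ℝ}
  {κ : Type*} [Fintype κ] [DecidableEq κ]

/-- A labelling that merges exactly as prescribed by the level sets of a pair of functions. -/
structure IsMerging (p : X → Y → ℝ) (f : X → ℝ) (g : Y → ℝ) (lab : X ⊕ Y → κ) : Prop where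
  ne : ∀ x y, lab (.inl x) ≠ lab (.inr y)
  eq_left : ∀ x x', lab (.inl x) = lab (.inl x') → f x = f x'
  eq_right : ∀ y y', lab (.inr y) = lab (.inr y') → g y = g y'
  merge_left : ∀ x x', x < x' → 0 < margX p x → 0 < margX p x' → f x = f x' →
    lab (.inl x) = lab (.inl x')
  merge_right : ∀ y y', y < y' → 0 < margY p y → 0 < margY p y' → g y = g y' →
    lab (.inr y) = lab (.inr y')

variable {hp : IsJointPMF p} {f : X → ℝ} {g : Y → ℝ} {lab : X ⊕ Y → κ}

theorem IsMerging.mem_face (h : IsMerging p f g lab) {F : X ⊕ Y → ℝ}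
    (hF : ∀ z z', lab z = lab z' → F z = F z') :
    F ∘ Sum.inl ∈ (monoForm hp).face f ∧ F ∘ Sum.inr ∈ (monoForm hp).swap.face g := by
  rw [mem_face_monoForm, mem_face_swap_monoForm]
  exact ⟨fun x x' h1 h2 h3 h4 => hF _ _ (h.merge_left x x' h1 h2 h3 h4),
    fun x x' h1 h2 h3 h4 => hF _ _ (h.merge_right x x' h1 h2 h3 h4)⟩

omit [Fintype κ] in
theorem classFun_lab (u : EuclideanSpace ℝ κ) (z z' : X ⊕ Y) (h : lab z = lab z') :
    classFun p lab u z = classFun p lab u z' := by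
  simp [classFun, h]

/-- The centred pair, as a function on the disjoint union. -/
noncomputable def starFun (p : X → Y → ℝ) (f : X → ℝ) (g : Y → ℝ) : X ⊕ Y → ℝ :=
  Sum.elim (fun x => f x - mean p fun x _ => f x) fun y => g y - mean p fun _ y => g y

theorem IsMerging.starFun_lab (h : IsMerging p f g lab) (z z' : X ⊕ Y) (hz : lab z = lab z') :
    starFun p f g z = starFun p f g z' := by
  rcases z with x | y <;> rcases z' with x' | y'
  · simp [starFun, h.eq_left x x' hz]
  · exact absurd hz (h.ne x y')
  · exact absurd hz.symm (h.ne x' y)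
  · simp [starFun, h.eq_right y y' hz]

/-- Tested against an arbitrary class vector, the eigenvalue equation is the sum of the two
first-order conditions in the face directions given by that vector. -/
theorem IsMerging.eigen (h : IsMerging p f g lab) {σ : ℝ} (ht : (monoForm hp).Tight σ f g) :
    classOp p lab (classVec p lab (starFun p f g)) = σ • classVec p lab (starFun p f g) := by
  refine ext_inner_left ℝ fun u' => ?_
  set F := classFun p lab u'
  obtain ⟨m1, m2⟩ := h.mem_face (hp := hp) (F := F) (classFun_lab u')
  have e := fun z (hz : 0 < jointWeight p z) => classFun_classVec hp h.starFun_lab hz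
  have c1 : cov p (F ∘ Sum.inl) (classFun p lab (classVec p lab (starFun p f g)) ∘ Sum.inr) =
      cov p (F ∘ Sum.inl) g := by
    rw [cov_congr hp (f := F ∘ Sum.inl) (f' := F ∘ Sum.inl) (fun _ _ => rfl)
      (g := classFun p lab (classVec p lab (starFun p f g)) ∘ Sum.inr) (g' := fun y => g y - mean p fun _ y => g y)
      fun y hy => e (.inr y) hy, ← cov_swap, cov_sub_const_left hp.swap, cov_swap]
  have c2 : cov p (classFun p lab (classVec p lab (starFun p f g)) ∘ Sum.inl) (F ∘ Sum.inr) =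
      cov p f (F ∘ Sum.inr) := by
    rw [cov_congr hp (f := classFun p lab (classVec p lab (starFun p f g)) ∘ Sum.inl)
      (g := F ∘ Sum.inr) (g' := F ∘ Sum.inr) (f' := fun x => f x - mean p fun x _ => f x) (fun x hx => e (.inl x) hx)
      fun _ _ => rfl, cov_sub_const_left hp]
  rw [inner_classOp hp, c1, c2, inner_smul_right, inner_eq_sum hp lab fun c hc =>
    classVec_eq_zero lab _ hc]
  have f1 : cov p (F ∘ Sum.inl) g = σ * (monoForm hp).Q (F ∘ Sum.inl) f :=
    ht.toOptimal.first_order m1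
  have f2 : cov p f (F ∘ Sum.inr) = σ * (monoForm hp).R (F ∘ Sum.inr) g :=
    ht.toOptimal.first_order_right m2
  have s1 : ∑ z, jointWeight p z * (F z * classFun p lab (classVec p lab (starFun p f g)) z) =
      ∑ z, jointWeight p z * (F z * starFun p f g z) := by
    refine Finset.sum_congr rfl fun z _ => ?_
    rcases (jointWeight_nonneg hp z).eq_or_lt with h0 | h0
    · rw [← h0]; simp
    · rw [e z h0]
  have q1 : (monoForm hp).Q (F ∘ Sum.inl) f =
      mean p fun x _ => F (.inl x) * starFun p f g (.inl x) := by
    have : (monoForm hp).Q (F ∘ Sum.inl) f = mean p fun x _ =>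
      (F (.inl x) - mean p fun x _ => F (.inl x)) * starFun p f g (.inl x) := rfl
    rw [this]
    simp only [sub_mul, mean_sub, mean_mul_left]
    simp [starFun, mean_sub, mean_const hp]
  have q2 : (monoForm hp).R (F ∘ Sum.inr) g =
      mean p fun _ y => F (.inr y) * starFun p f g (.inr y) := by
    have : (monoForm hp).R (F ∘ Sum.inr) g = mean p fun _ y =>
      (F (.inr y) - mean p fun _ y => F (.inr y)) * starFun p f g (.inr y) := rfl
    rw [this]
    simp only [sub_mul, mean_sub, mean_mul_left]
    simp [starFun, mean_sub, mean_const hp]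
  rw [f1, f2, s1, sum_jointWeight, q1, q2]
  ring

theorem IsMerging.vec_ne_zero (h : IsMerging p f g lab) {σ : ℝ}
    (ht : (monoForm hp).Tight σ f g) : classVec p lab (starFun p f g) ≠ 0 := by
  intro h0
  have hv : varX p f = 0 := by
    rw [varX_eq_zero_iff hp]
    have : ∀ x, 0 < margX p x → f x - mean p (fun x _ => f x) = 0 := fun x hx => by
      have := classFun_classVec hp h.starFun_lab (z := Sum.inl x) hx
      rw [h0] at this
      simp only [classFun, starFun, Sum.elim_inl] at this
      rw [← this]; simp
    intro x x' hx hx'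
    linarith [this x hx, this x' hx']
  have := ht.Qf
  rw [monoForm_Q, hv] at this
  exact zero_ne_one this

omit [Fintype X] [Fintype κ] [DecidableEq κ] in
theorem monotoneOn_smul_cancel {Z : Type*} [PartialOrder Z] {φ : Z → ℝ} {S : Set Z} {a : ℝ}
    (ha : 0 < a) (hm : MonotoneOn (a⁻¹ • φ) S) : MonotoneOn φ S := by
  have : MonotoneOn (a • a⁻¹ • φ) S := fun x hx y hy h =>
    mul_le_mul_of_nonneg_left (hm hx hy h) ha.le
  rwa [smul_smul, mul_inv_cancel₀ ha.ne', one_smul] at this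

/-- Every eigenvector for a positive optimum gives an optimal monotone pair. -/
theorem IsMerging.of_eigen (h : IsMerging p f g lab) {σ : ℝ} (ht : (monoForm hp).Tight σ f g)
    (hσ : 0 < σ) {v : EuclideanSpace ℝ κ} (hv : classOp p lab v = σ • v) (hv0 : v ≠ 0) :
    (MonoOnSupport p (classFun p lab v ∘ Sum.inl) (classFun p lab v ∘ Sum.inr) ∨
      MonoOnSupport p (-(classFun p lab v ∘ Sum.inl)) (-(classFun p lab v ∘ Sum.inr))) ∧
    0 < varX p (classFun p lab v ∘ Sum.inl) ∧ 0 < varY p (classFun p lab v ∘ Sum.inr) ∧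
    cov p (classFun p lab v ∘ Sum.inl) (classFun p lab v ∘ Sum.inr) /
      √(varX p (classFun p lab v ∘ Sum.inl) * varY p (classFun p lab v ∘ Sum.inr)) = σ := by
  set F := classFun p lab v with hF
  have hnull : ∀ c, classWeight p lab c = 0 → v c = 0 := fun c hc =>
    eq_zero_of_eigen hσ.ne' hv hc
  -- The eigenvalue equation in weak form, for every test function that is constant on classes.
  have key : ∀ G : X ⊕ Y → ℝ, (∀ z z', lab z = lab z' → G z = G z') →
      cov p (G ∘ Sum.inl) (F ∘ Sum.inr) + cov p (F ∘ Sum.inl) (G ∘ Sum.inr) =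
        σ * (mean p (fun x _ => G (.inl x) * F (.inl x)) +
          mean p fun _ y => G (.inr y) * F (.inr y)) := by
    intro G hG
    have e := fun z (hz : 0 < jointWeight p z) => classFun_classVec hp hG hz
    have e0 := inner_classOp hp lab v (classVec p lab G)
    rw [hv, inner_smul_right, inner_eq_sum hp lab hnull] at e0
    rw [cov_congr hp (f := G ∘ Sum.inl) (fun x hx => (e (.inl x) hx).symm) fun _ _ => rfl,
      cov_congr hp (g := G ∘ Sum.inr) (fun _ _ => rfl) fun y hy => (e (.inr y) hy).symm]
    rw [← sum_jointWeight fun z => G z * F z]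
    refine e0.symm.trans (congrArg _ (Finset.sum_congr rfl fun z _ => ?_))
    rcases (jointWeight_nonneg hp z).eq_or_lt with h0 | h0
    · rw [← h0]; simp
    · rw [e z h0]
  have split : ∀ (a : X → ℝ) (b : Y → ℝ), (∀ x x', lab (.inl x) = lab (.inl x') → a x = a x') →
      (∀ y y', lab (.inr y) = lab (.inr y') → b y = b y') → ∀ z z', lab z = lab z' →
      Sum.elim a b z = Sum.elim a b z' := by
    rintro a b ha hb (x | y) (x' | y') hz
    · exact ha _ _ hz
    · exact absurd hz (h.ne x y')
    · exact absurd hz.symm (h.ne x' y)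
    · exact hb _ _ hz
  have Fl := classFun_lab (p := p) (lab := lab) v
  -- Four test functions are used. The indicators of the two sides give mean zero on each side. The
  -- two halves of `F` give `cov = σ * varX` and `cov = σ * varY`, so the variances agree and the
  -- correlation is `σ`.
  have k1 := key _ (split (fun _ => 1) (fun _ => 0) (fun _ _ _ => rfl) fun _ _ _ => rfl)
  have k2 := key _ (split (fun _ => 0) (fun _ => 1) (fun _ _ _ => rfl) fun _ _ _ => rfl)
  have k3 := key _ (split (F ∘ Sum.inl) (fun _ => 0) (fun _ _ hz => Fl _ _ hz) fun _ _ _ => rfl)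
  have k4 := key _ (split (fun _ => 0) (F ∘ Sum.inr) (fun _ _ _ => rfl) fun _ _ hz => Fl _ _ hz)
  simp only [Sum.elim_comp_inl, Sum.elim_comp_inr, cov_const_left hp, cov_const_right hp,
    Sum.elim_inl, Sum.elim_inr, one_mul, zero_mul, mean_const hp, add_zero, zero_add] at k1 k2 k3 k4
  have e1 : mean p (fun x _ => F (.inl x)) = 0 := by
    rcases mul_eq_zero.1 k1.symm with h | h
    · exact absurd h hσ.ne'
    · exact h
  have e2 : mean p (fun _ y => F (.inr y)) = 0 := by
    rcases mul_eq_zero.1 k2.symm with h | h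
    · exact absurd h hσ.ne'
    · exact h
  have v1 := varX_of_mean (p := p) (F ∘ Sum.inl) e1
  have v2 := varY_of_mean (p := p) (F ∘ Sum.inr) e2
  simp only [Function.comp] at k3 k4 v1 v2
  rw [← v1] at k3
  rw [← v2] at k4
  have hsum : 0 < varX p (F ∘ Sum.inl) + varY p (F ∘ Sum.inr) := by
    have hi := inner_eq_sum hp lab hnull v
    rw [sum_jointWeight] at hi
    have : 0 < inner ℝ v v := real_inner_self_pos.2 hv0
    rw [hi] at this
    rw [v1, v2]
    exact this
  have heq' : varX p (F ∘ Sum.inl) = varY p (F ∘ Sum.inr) := by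
    have := k3.symm.trans k4
    exact mul_left_cancel₀ hσ.ne' this
  have hX : 0 < varX p (F ∘ Sum.inl) := by linarith
  have hY : 0 < varY p (F ∘ Sum.inr) := by linarith
  have hc : cov p (F ∘ Sum.inl) (F ∘ Sum.inr) = σ * varX p (F ∘ Sum.inl) := k3
  refine ⟨?_, hX, hY, ?_⟩
  · obtain ⟨m1, m2⟩ := h.mem_face (hp := hp) (F := F) Fl
    set a := √(varX p (F ∘ Sum.inl)) with ha
    have ha0 : 0 < a := Real.sqrt_pos.2 hX
    have ha2 : a ^ 2 = varX p (F ∘ Sum.inl) := Real.sq_sqrt hX.le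
    have := ht.monoOnSupport_of_pos hσ (v := a⁻¹ • (F ∘ Sum.inl)) (w := a⁻¹ • (F ∘ Sum.inr))
      (Submodule.smul_mem _ _ m1) (Submodule.smul_mem _ _ m2)
      (by rw [varX_smul, ← ha2]; field_simp) (by rw [varY_smul, ← heq', ← ha2]; field_simp)
      (by rw [cov_smul_smul, hc, ← ha2]; field_simp)
    rw [← smul_neg, ← smul_neg] at this
    exact this.imp (fun hm => ⟨monotoneOn_smul_cancel ha0 hm.1, monotoneOn_smul_cancel ha0 hm.2⟩)
      fun hm => ⟨monotoneOn_smul_cancel ha0 hm.1, monotoneOn_smul_cancel ha0 hm.2⟩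
  · rw [← heq', hc, Real.sqrt_mul_self hX.le, mul_div_cancel_right₀ _ hX.ne']

/-- When the optimum is not positive, two signed class indicators are optimal. -/
theorem IsMerging.of_nonpos (h : IsMerging p f g lab) (hnd : Nondegenerate p)
    (ht : (monoForm hp).Tight (cmc p) f g) (hσ : cmc p ≤ 0) :
    ∃ (c d : κ) (s t : ℝ), (s = 1 ∨ s = -1) ∧ (t = 1 ∨ t = -1) ∧
      ∀ v : EuclideanSpace ℝ κ, (∀ c', v c' = (if c = c' then s else 0) + if d = c' then t else 0) →
      MonoOnSupport p (classFun p lab v ∘ Sum.inl) (classFun p lab v ∘ Sum.inr) ∧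
      0 < varX p (classFun p lab v ∘ Sum.inl) ∧ 0 < varY p (classFun p lab v ∘ Sum.inr) ∧
      cov p (classFun p lab v ∘ Sum.inl) (classFun p lab v ∘ Sum.inr) /
        √(varX p (classFun p lab v ∘ Sum.inl) * varY p (classFun p lab v ∘ Sum.inr)) = cmc p := by
  -- Unit variance provides two support symbols with different values of `f`. They lie in different
  -- classes, so the indicator of the class of the first one has positive variance.
  have hX : ∃ x x', 0 < margX p x ∧ 0 < margX p x' ∧ f x ≠ f x' := by
    by_contra! hcon
    have h1 := ht.Qf
    rw [monoForm_Q, (varX_eq_zero_iff hp).2 fun x x' hx hx' => hcon x x' hx hx'] at h1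
    exact zero_ne_one h1
  have hY : ∃ y y', 0 < margY p y ∧ 0 < margY p y' ∧ g y ≠ g y' := by
    by_contra! hcon
    have h1 := ht.Rg
    rw [monoForm_R, ← varX_swap, (varX_eq_zero_iff hp.swap).2
      fun y y' hy hy' => hcon y y' hy hy'] at h1
    exact zero_ne_one h1
  obtain ⟨x, x', hx, hx', hne⟩ := hX
  obtain ⟨y, y', hy, hy', hne'⟩ := hY
  set c := lab (.inl x)
  set d := lab (.inr y)
  let vec : ℝ → ℝ → EuclideanSpace ℝ κ := fun s t =>
    WithLp.toLp 2 fun c' => (if c = c' then s else 0) + if d = c' then t else 0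
  -- Classes never mix the two sides, so `s` acts only on the `X` half and `t` only on the `Y` half,
  -- and the signs can be chosen independently.
  have hL : ∀ s t x', classFun p lab (vec s t) (.inl x') =
      s * classFun p lab (vec 1 1) (.inl x') := by
    intro s t x'
    have : d ≠ lab (.inl x') := (h.ne x' y).symm
    simp only [classFun, vec, this, if_false, add_zero]
    split_ifs <;> ring
  have hR : ∀ s t y', classFun p lab (vec s t) (.inr y') =
      t * classFun p lab (vec 1 1) (.inr y') := by
    intro s t y'
    have : c ≠ lab (.inr y') := h.ne x y'
    simp only [classFun, vec, this, if_false, zero_add]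
    split_ifs <;> ring
  have n1 : varX p (classFun p lab (vec 1 1) ∘ Sum.inl) ≠ 0 := by
    intro h0
    have := (varX_eq_zero_iff hp).1 h0 x x' hx hx'
    have e1 : c ≠ lab (.inl x') := fun he => hne (h.eq_left _ _ he)
    have e2 : d ≠ lab (.inl x') := (h.ne x' y).symm
    have e3 : d ≠ c := (h.ne x y).symm
    have h3 := (Real.sqrt_pos.2 (classWeight_pos hp lab (z := .inl x) hx)).ne'
    simp only [Function.comp, classFun, vec, e1, e2, if_false, add_zero, zero_div] at this
    rw [if_pos rfl, if_neg e3] at this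
    rw [add_zero, div_eq_zero_iff] at this
    exact this.elim one_ne_zero h3
  have n2 : varY p (classFun p lab (vec 1 1) ∘ Sum.inr) ≠ 0 := by
    intro h0
    rw [← varX_swap] at h0
    have := (varX_eq_zero_iff hp.swap).1 h0 y y' hy hy'
    have e1 : d ≠ lab (.inr y') := fun he => hne' (h.eq_right _ _ he)
    have e2 : c ≠ lab (.inr y') := h.ne x y'
    have e3 : c ≠ d := h.ne x y
    have h3 := (Real.sqrt_pos.2 (classWeight_pos hp lab (z := .inr y) hy)).ne'
    simp only [Function.comp, classFun, vec, e1, e2, if_false, add_zero, zero_div] at this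
    rw [if_pos rfl, if_neg e3] at this
    rw [zero_add, div_eq_zero_iff] at this
    exact this.elim one_ne_zero h3
  obtain ⟨m1, m2⟩ := h.mem_face (hp := hp) (F := classFun p lab (vec 1 1)) (classFun_lab _)
  obtain ⟨a, b, ha, hb, hm⟩ := ht.exists_signs hσ m1 m2
  have ha' : ∃ s : ℝ, (s = 1 ∨ s = -1) ∧ a = s • (classFun p lab (vec 1 1) ∘ Sum.inl) := by
    rcases ha with rfl | rfl
    · exact ⟨1, .inl rfl, (one_smul _ _).symm⟩
    · exact ⟨-1, .inr rfl, by simp⟩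
  have hb' : ∃ t : ℝ, (t = 1 ∨ t = -1) ∧ b = t • (classFun p lab (vec 1 1) ∘ Sum.inr) := by
    rcases hb with rfl | rfl
    · exact ⟨1, .inl rfl, (one_smul _ _).symm⟩
    · exact ⟨-1, .inr rfl, by simp⟩
  obtain ⟨s, hs, rfl⟩ := ha'
  obtain ⟨t, ht', rfl⟩ := hb'
  refine ⟨c, d, s, t, hs, ht', fun v hv => ?_⟩
  have hvec : v = vec s t := by
    ext c'; exact hv c'
  have es : s ^ 2 = 1 := by rcases hs with rfl | rfl <;> norm_num
  have et : t ^ 2 = 1 := by rcases ht' with rfl | rfl <;> norm_num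
  have e1 : classFun p lab v ∘ Sum.inl = s • (classFun p lab (vec 1 1) ∘ Sum.inl) := by
    rw [hvec]; funext x'; exact hL s t x'
  have e2 : classFun p lab v ∘ Sum.inr = t • (classFun p lab (vec 1 1) ∘ Sum.inr) := by
    rw [hvec]; funext x'; exact hR s t x'
  rw [e1, e2]
  have p1 : 0 < varX p (s • (classFun p lab (vec 1 1) ∘ Sum.inl)) := by
    rw [varX_smul, es, one_mul]; exact lt_of_le_of_ne (varX_nonneg hp _) n1.symm
  have p2 : 0 < varY p (t • (classFun p lab (vec 1 1) ∘ Sum.inr)) := by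
    rw [varY_smul, et, one_mul]; exact lt_of_le_of_ne (varY_nonneg hp _) n2.symm
  exact ⟨hm, p1, p2, ht.cov_eq_of_nonpos hnd hσ (Submodule.smul_mem _ _ m1)
    (Submodule.smul_mem _ _ m2) p1 p2 hm⟩

end Tight

end MonoCorr


/-! ### Fixed registers and the basic program pieces -/

namespace MonoCorr

namespace Prog

theorem den_seq (P Q : Prog) (s : State) : (seq P Q).den s = Q.den (P.den s) := rfl

/-- The index variables that are assigned outside of loop headers. -/
def sets : Prog → List ℕ
  | skip => []
  | iset v _ => [v]
  | rset .. => []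
  | root .. => []
  | seq P Q => P.sets ++ Q.sets
  | ite _ P Q => P.sets ++ Q.sets
  | loop _ _ P => P.sets

/-- Loops reset their counters, so a variable that is changed only in loop headers returns to `0`.
This keeps the state `Clean` even though the counters of `fill` are written. -/
theorem den_idx_zero (P : Prog) : ∀ (s : State) {v : ℕ}, v ∉ P.sets → s.idx v = 0 →
    (P.den s).idx v = 0 := by
  induction P with
  | skip => exact fun _ _ _ h => h
  | iset v e =>
    intro s w hw h
    simp only [sets, List.mem_singleton] at hw
    rw [den, State.setIdx_ne _ _ hw, h]
  | rset => exact fun _ _ _ h => h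
  | root => exact fun _ _ _ h => h
  | seq P Q hP hQ =>
    intro s v hv h
    simp only [sets, List.mem_append, not_or] at hv
    exact hQ _ hv.2 (hP _ hv.1 h)
  | ite b P Q hP hQ =>
    intro s v hv h
    simp only [sets, List.mem_append, not_or] at hv
    simp only [den]
    split_ifs
    · exact hP _ hv.1 h
    · exact hQ _ hv.2 h
  | loop v u P hP =>
    intro s w hw h
    simp only [sets] at hw
    simp only [den]
    by_cases hwv : w = v
    · rw [hwv, State.setIdx_self]
    · rw [State.setIdx_ne _ _ hwv]
      have : ∀ n, ((fun s' => (P.den s').setIdx v ((P.den s').idx v + 1))^[n]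
          (s.setIdx v 0)).idx w = 0 := by
        intro n
        induction n with
        | zero => simpa [State.setIdx_ne _ _ hwv] using h
        | succ n ih =>
          rw [Function.iterate_succ_apply', State.setIdx_ne _ _ hwv]
          exact hP _ hw ih
      exact this _

end Prog

section At

variable (s : State) (i j k l : ℕ)

theorem State.at_mem : (s.at i j k l).mem = s.mem := rfl

theorem State.at_20 : (s.at i j k l).idx 20 = i := by simp [State.at, State.setIdx]

theorem State.at_21 : (s.at i j k l).idx 21 = j := by simp [State.at, State.setIdx]

theorem State.at_22 : (s.at i j k l).idx 22 = k := by simp [State.at, State.setIdx]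

theorem State.at_23 : (s.at i j k l).idx 23 = l := by simp [State.at, State.setIdx]

theorem State.at_of_lt {v : ℕ} (hv : v < 20) : (s.at i j k l).idx v = s.idx v := by
  simp only [State.at, State.setIdx]
  rw [Function.update_of_ne (by omega), Function.update_of_ne (by omega),
    Function.update_of_ne (by omega), Function.update_of_ne (by omega)]

variable {s}

theorem State.Clean.at_zero (hs : s.Clean) : s.at 0 0 0 0 = s := by
  obtain ⟨h1, h2, h3, h4⟩ := hs
  refine State.ext_iff' (funext fun v => ?_) rfl
  simp only [State.at, State.setIdx, Function.update_apply]
  split_ifs <;> first | rfl | (subst_vars; symm; assumption)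

end At

/-- The values of the index variables that stay fixed. -/
structure Fixed (m n : ℕ) (s : State) : Prop where
  clean : s.Clean
  i0 : s.idx 0 = m
  i1 : s.idx 1 = n
  i2 : s.idx 2 = m + n
  i3 : s.idx 3 = 1
  i4 : s.idx 4 = m + n + 1
  i14 : s.idx 14 = m + n + 2
  i15 : s.idx 15 = 2 * (m + n)
  i16 : s.idx 16 = 2
  i17 : s.idx 17 = 3

theorem Fixed.of_idx {m n : ℕ} {s s' : State} (h : Fixed m n s) (e : s'.idx = s.idx) :
    Fixed m n s' := by
  obtain ⟨⟨a, b, c, d⟩, h0, h1, h2, h3, h4, h5, h6, h7, h8⟩ := h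
  constructor <;> first | (unfold State.Clean; simp only [e]; exact ⟨a, b, c, d⟩) | (rw [e]; assumption)

theorem Fixed.setIdx {m n : ℕ} {s : State} (h : Fixed m n s) {v : ℕ} (x : ℕ)
    (hv : v ∉ [0, 1, 2, 3, 4, 14, 15, 16, 17, 20, 21, 22, 23]) : Fixed m n (s.setIdx v x) := by
  have e : ∀ w ∈ [0, 1, 2, 3, 4, 14, 15, 16, 17, 20, 21, 22, 23], (s.setIdx v x).idx w = s.idx w :=
    fun w hw => State.setIdx_ne _ _ fun he => hv (he ▸ hw)
  obtain ⟨⟨a, b, c, d⟩, h0, h1, h2, h3, h4, h5, h6, h7, h8⟩ := h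
  refine ⟨⟨?_, ?_, ?_, ?_⟩, ?_, ?_, ?_, ?_, ?_, ?_, ?_, ?_, ?_⟩ <;>
    · rw [e _ (by decide)]; assumption

theorem Fixed.den {m n : ℕ} {s : State} (h : Fixed m n s) (P : Prog)
    (hP : ∀ v ∈ [0, 1, 2, 3, 4, 14, 15, 16, 17], v ∉ P.writes)
    (hP' : ∀ v ∈ [20, 21, 22, 23], v ∉ P.sets) : Fixed m n (P.den s) := by
  have e : ∀ v ∈ [0, 1, 2, 3, 4, 14, 15, 16, 17], (P.den s).idx v = s.idx v := fun v hv =>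
    P.den_idx s (hP v hv)
  obtain ⟨⟨a, b, c, d⟩, h0, h1, h2, h3, h4, h5, h6, h7, h8⟩ := h
  refine ⟨⟨P.den_idx_zero s (hP' _ (by decide)) a, P.den_idx_zero s (hP' _ (by decide)) b,
    P.den_idx_zero s (hP' _ (by decide)) c, P.den_idx_zero s (hP' _ (by decide)) d⟩,
    ?_, ?_, ?_, ?_, ?_, ?_, ?_, ?_, ?_⟩ <;>
    · rw [e _ (by decide)]; assumption

namespace Algo

open Prog

/-- An index variable. -/
abbrev iv (v : ℕ) : IExp := .var v

/-- The index zero. -/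
abbrev o : IExp := .lit 0

/-- The true test. -/
abbrev tt : BExp := .ilt (.lit 0) (.lit 1)

/-- A cell of the first row of an array. -/
abbrev vc (a : ℕ) (j : IExp) : RExp := .cell a o j

/-- The first cell of an array. -/
abbrev sc (a : ℕ) : RExp := .cell a o o

/-- Equality of indices. -/
abbrev ieq (e₁ e₂ : IExp) : BExp := .and (.not (.ilt e₁ e₂)) (.not (.ilt e₂ e₁))

/-- Disjunction of tests. -/
abbrev bor (b₁ b₂ : BExp) : BExp := .not (.and (.not b₁) (.not b₂))

/-- Inequality of reals. -/
abbrev rne (e₁ e₂ : RExp) : BExp := bor (.rlt e₁ e₂) (.rlt e₂ e₁)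

/-- Unconditional `fill`. -/
abbrev sum (a : ℕ) (r c : IExp) (n₁ n₂ n₃ n₄ : ℕ) (e : RExp) : Prog :=
  fill a r c n₁ n₂ n₃ n₄ tt e .zero

theorem fillTerm_tt (e e' : RExp) (s : State) : fillTerm tt e e' s = e.eval s := by
  simp [fillTerm, BExp.Holds, IExp.eval]

theorem fill_spec {s : State} (hs : s.Clean) (a n₁ n₂ n₃ n₄ : ℕ) (b : BExp) (e₁ e₂ : RExp)
    (ha : a ∉ b.arrays ++ e₁.arrays ++ e₂.arrays) (hn : ∀ v ∈ [n₁, n₂, n₃, n₄], v < 20) :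
    ∃ s', (fill a o o n₁ n₂ n₃ n₄ b e₁ e₂).den s = s' ∧ s'.idx = s.idx ∧
      (∀ a' ≠ a, s'.mem a' = s.mem a') ∧
      ∀ i < s.idx n₁, ∀ j < s.idx n₂, s'.mem a i j = ∑ k ∈ Finset.range (s.idx n₃),
        ∑ l ∈ Finset.range (s.idx n₄), fillTerm b e₁ e₂ (s.at i j k l) := by
  refine ⟨_, den_fill ha ?_ hs, rfl, ?_, ?_⟩
  · intro v hv
    exact .inl (hn v (by simpa [IExp.vars] using hv))
  · intro a' ha'
    funext i j
    simp [ha']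
  · intro i hi j hj
    simp [IExp.eval, hi, hj]

theorem sum_spec {s : State} (hs : s.Clean) (a n₁ n₂ n₃ n₄ : ℕ) (e : RExp)
    (ha : a ∉ e.arrays) (hn : ∀ v ∈ [n₁, n₂, n₃, n₄], v < 20) :
    ∃ s', (sum a o o n₁ n₂ n₃ n₄ e).den s = s' ∧ s'.idx = s.idx ∧
      (∀ a' ≠ a, s'.mem a' = s.mem a') ∧
      ∀ i < s.idx n₁, ∀ j < s.idx n₂, s'.mem a i j = ∑ k ∈ Finset.range (s.idx n₃),
        ∑ l ∈ Finset.range (s.idx n₄), e.eval (s.at i j k l) := by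
  have := fill_spec hs a n₁ n₂ n₃ n₄ tt e .zero (by simpa [BExp.arrays, RExp.arrays] using ha) hn
  simpa only [fillTerm_tt] using this

/-- A number computed from sums, stored in the first cell. -/
theorem scalar_spec {m n : ℕ} {s : State} (hs : Fixed m n s) (a n₃ n₄ : ℕ) (e : RExp)
    (ha : a ∉ e.arrays) (hn : ∀ v ∈ [n₃, n₄], v < 20) :
    ∃ s', (sum a o o 3 3 n₃ n₄ e).den s = s' ∧ s'.idx = s.idx ∧
      (∀ a' ≠ a, s'.mem a' = s.mem a') ∧
      s'.mem a 0 0 = ∑ k ∈ Finset.range (s.idx n₃),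
        ∑ l ∈ Finset.range (s.idx n₄), e.eval (s.at 0 0 k l) := by
  obtain ⟨s', h1, h2, h3, h4⟩ := sum_spec hs.clean a 3 3 n₃ n₄ e ha (by
    intro v hv
    simp only [List.mem_cons, List.not_mem_nil, or_false] at hv hn
    rcases hv with rfl | rfl | rfl | rfl
    · norm_num
    · norm_num
    · exact hn _ (.inl rfl)
    · exact hn _ (.inr rfl))
  exact ⟨s', h1, h2, h3, h4 0 (by rw [hs.i3]; norm_num) 0 (by rw [hs.i3]; norm_num)⟩

/-- A vector of sums, stored in the first row. -/
theorem vector_spec {m n : ℕ} {s : State} (hs : Fixed m n s) (a n₂ n₄ : ℕ) (e : RExp)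
    (ha : a ∉ e.arrays) (hn : ∀ v ∈ [n₂, n₄], v < 20) :
    ∃ s', (sum a o o 3 n₂ 3 n₄ e).den s = s' ∧ s'.idx = s.idx ∧
      (∀ a' ≠ a, s'.mem a' = s.mem a') ∧
      ∀ j < s.idx n₂, s'.mem a 0 j = ∑ l ∈ Finset.range (s.idx n₄), e.eval (s.at 0 j 0 l) := by
  obtain ⟨s', h1, h2, h3, h4⟩ := sum_spec hs.clean a 3 n₂ 3 n₄ e ha (by
    intro v hv
    simp only [List.mem_cons, List.not_mem_nil, or_false] at hv hn
    rcases hv with rfl | rfl | rfl | rfl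
    · norm_num
    · exact hn _ (.inl rfl)
    · norm_num
    · exact hn _ (.inr rfl))
  refine ⟨s', h1, h2, h3, fun j hj => ?_⟩
  rw [h4 0 (by rw [hs.i3]; norm_num) j hj, hs.i3, Finset.sum_range_one]

/-- `sqrtTo a j e` stores the square root of `e` in cell `(0, j)` of array `a`. -/
def sqrtTo (a : ℕ) (j : IExp) (e : RExp) : Prog :=
  .seq (fill 14 o o 3 17 3 3 (.ilt (.lit 1) (iv 21)) .one .zero)
    (.seq (sum 14 o o 3 3 3 3 (.sub .zero e)) (.root a o j 14 o 16 (.lit 1)))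

theorem sqrtTo_spec {m n : ℕ} {s : State} (hs : Fixed m n s) (a : ℕ) (j : IExp) (e : RExp)
    (he : 14 ∉ e.arrays) (h0 : 0 ≤ e.eval s) :
    ∃ s', (sqrtTo a j e).den s = s' ∧ s'.idx = s.idx ∧
      (∀ a', a' ≠ a → a' ≠ 14 → s'.mem a' = s.mem a') ∧
      (a ≠ 14 → ∀ j', s'.mem a 0 j' = if j' = j.eval s then √(e.eval s) else s.mem a 0 j') := by
  -- The coefficients `0, 0, 1` of `T ^ 2` are written first; index variable `17` holds `3`. The
  -- next program overwrites the constant coefficient by `0 - e`.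
  obtain ⟨s1, e1, i1, f1, g1⟩ := fill_spec hs.clean 14 3 17 3 3 (.ilt (.lit 1) (iv 21)) .one .zero
    (by decide) (by decide)
  have hs1 := hs.of_idx i1
  have hd : (sum 14 o o 3 3 3 3 (.sub .zero e)).den s1 = ⟨s1.idx, fun a' i j =>
      if a' = 14 ∧ i = 0 ∧ j = 0 then 0 - e.eval s else s1.mem a' i j⟩ := by
    rw [den_fill (by simpa [BExp.arrays, RExp.arrays] using he)
      (by simp [IExp.vars]) hs1.clean]
    refine State.ext_iff' rfl (funext fun a' => funext fun i => funext fun j => ?_)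
    simp only [IExp.eval, hs1.i3, zero_le, zero_add, true_and, Nat.lt_one_iff,
      Finset.sum_range_one, fillTerm_tt]
    by_cases hc : a' = 14 ∧ i = 0 ∧ j = 0
    · rw [if_pos hc, if_pos hc, hc.2.1, hc.2.2]
      rw [Nat.sub_zero, hs1.clean.at_zero]
      simp only [RExp.eval]
      congr 1
      exact RExp.eval_congr i1 e fun a' ha' => f1 a' fun h => he (h ▸ ha')
    · rw [if_neg hc, if_neg hc]
  have hj : ∀ M, j.eval ⟨s1.idx, M⟩ = j.eval s := fun M => j.eval_congr fun v _ => by rw [← i1]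
  refine ⟨_, rfl, ?_, ?_, ?_⟩
  · simp only [sqrtTo, den, e1, hd, State.setMem, i1]
  · intro a' ha1 ha2
    funext i' j'
    simp only [sqrtTo, den, e1, hd, State.setMem, ha1, ha2, false_and, if_false]
    rw [f1 a' ha2]
  · intro ha j'
    simp only [sqrtTo, den, e1, hd, State.setMem, hj, IExp.eval, true_and, ha, false_and, if_false]
    rw [f1 a ha, hs1.i16]
    congr 1
    refine kthRoot_sqrt h0 (by simp) ?_ ?_
    · simp only [one_ne_zero, if_false]
      rw [g1 0 (by rw [hs.i3]; norm_num) 1 (by rw [hs.i17]; norm_num), hs.i3]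
      simp [fillTerm, BExp.Holds, IExp.eval, State.at_21, RExp.eval]
    · simp only [OfNat.ofNat_ne_zero, if_false]
      rw [g1 0 (by rw [hs.i3]; norm_num) 2 (by rw [hs.i17]; norm_num), hs.i3]
      simp [fillTerm, BExp.Holds, IExp.eval, State.at_21, RExp.eval]

end Algo

end MonoCorr


namespace MonoCorr

namespace Algo

open Prog

/-! ### Arrays indexed by a finite type -/

section Index

variable {Z : Type*} [Fintype Z] {m n N : ℕ}

theorem sum_range_index (e : Z ≃ Fin N) (F : ℕ → ℝ) :
    ∑ l ∈ Finset.range N, F l = ∑ z, F (e z) := by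
  rw [Finset.sum_range]
  exact (e.sum_comp fun i : Fin N => F i).symm

theorem exists_index (e : Z ≃ Fin N) {i : ℕ} (hi : i < N) : ∃ z, (e z : ℕ) = i :=
  ⟨e.symm ⟨i, hi⟩, by simp⟩

theorem index_inj (e : Z ≃ Fin N) {z z' : Z} (h : (e z : ℕ) = e z') : z = z' :=
  e.injective (Fin.ext h)

theorem index_pair_inj (e : Z ≃ Fin N) {a b a' b' : Z}
    (h : (e a : ℕ) * N + e b = e a' * N + e b') : a = a' ∧ b = b' := by
  have hN : 0 < N := (e a).pos
  have h1 := congrArg (· / N) h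
  have h2 := congrArg (· % N) h
  simp only [mul_comm _ N, Nat.mul_add_div hN, Nat.mul_add_mod, Nat.div_eq_of_lt (e b).2,
    Nat.div_eq_of_lt (e b').2, Nat.mod_eq_of_lt (e b).2, Nat.mod_eq_of_lt (e b').2,
    add_zero] at h1 h2
  exact ⟨index_inj e h1, index_inj e h2⟩

/-- The first row of array `a` holds the vector `v`. -/
def IsVec (e : Z ≃ Fin N) (a : ℕ) (v : Z → ℝ) (s : State) : Prop := ∀ z, s.mem a 0 (e z) = v z

/-- Array `a` holds the matrix `M`. -/
def IsMat (e : Z ≃ Fin N) (a : ℕ) (M : Z → Z → ℝ) (s : State) : Prop :=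
  ∀ z z', s.mem a (e z) (e z') = M z z'

variable {s : State} (hs : Fixed m n s) (e : Z ≃ Fin (m + n))

include hs

theorem vecSum_spec (a : ℕ) (x : RExp) (ha : a ∉ x.arrays) :
    ∃ s', (sum a o o 3 2 3 2 x).den s = s' ∧ s'.idx = s.idx ∧
      (∀ a' ≠ a, s'.mem a' = s.mem a') ∧
      IsVec e a (fun z => ∑ l, x.eval (s.at 0 (e z) 0 (e l))) s' := by
  obtain ⟨s', h1, h2, h3, h4⟩ := vector_spec hs a 2 2 x ha (by decide)
  refine ⟨s', h1, h2, h3, fun z => ?_⟩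
  rw [h4 _ (by rw [hs.i2]; exact (e z).2), hs.i2,
    sum_range_index e fun l => x.eval (s.at 0 (e z) 0 l)]

theorem vec_spec (a : ℕ) (x : RExp) (ha : a ∉ x.arrays) :
    ∃ s', (sum a o o 3 2 3 3 x).den s = s' ∧ s'.idx = s.idx ∧
      (∀ a' ≠ a, s'.mem a' = s.mem a') ∧
      IsVec e a (fun z => x.eval (s.at 0 (e z) 0 0)) s' := by
  obtain ⟨s', h1, h2, h3, h4⟩ := vector_spec hs a 2 3 x ha (by decide)
  refine ⟨s', h1, h2, h3, fun z => ?_⟩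
  rw [h4 _ (by rw [hs.i2]; exact (e z).2), hs.i3, Finset.sum_range_one]

theorem scalarSum_spec (a : ℕ) (x : RExp) (ha : a ∉ x.arrays) :
    ∃ s', (sum a o o 3 3 3 2 x).den s = s' ∧ s'.idx = s.idx ∧
      (∀ a' ≠ a, s'.mem a' = s.mem a') ∧
      s'.mem a 0 0 = ∑ l, x.eval (s.at 0 0 0 (e l)) := by
  obtain ⟨s', h1, h2, h3, h4⟩ := scalar_spec hs a 3 2 x ha (by decide)
  refine ⟨s', h1, h2, h3, ?_⟩
  rw [h4, hs.i2, hs.i3, Finset.sum_range_one, sum_range_index e fun l => x.eval (s.at 0 0 0 l)]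

theorem matSum_spec (a : ℕ) (x : RExp) (ha : a ∉ x.arrays) :
    ∃ s', (sum a o o 2 2 2 2 x).den s = s' ∧ s'.idx = s.idx ∧
      (∀ a' ≠ a, s'.mem a' = s.mem a') ∧
      IsMat e a (fun z z' => ∑ k, ∑ l, x.eval (s.at (e z) (e z') (e k) (e l))) s' := by
  obtain ⟨s', h1, h2, h3, h4⟩ := sum_spec hs.clean a 2 2 2 2 x ha (by decide)
  refine ⟨s', h1, h2, h3, fun z z' => ?_⟩
  rw [h4 _ (by rw [hs.i2]; exact (e z).2) _ (by rw [hs.i2]; exact (e z').2), hs.i2,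
    sum_range_index e fun k => ∑ l ∈ Finset.range (m + n), x.eval (s.at (e z) (e z') k l)]
  exact Finset.sum_congr rfl fun k _ => sum_range_index e fun l => x.eval (s.at (e z) (e z') (e k) l)

theorem matFill_spec (a : ℕ) (b : BExp) (x y : RExp) (ha : a ∉ b.arrays ++ x.arrays ++ y.arrays) :
    ∃ s', (fill a o o 2 2 3 3 b x y).den s = s' ∧ s'.idx = s.idx ∧
      (∀ a' ≠ a, s'.mem a' = s.mem a') ∧
      IsMat e a (fun z z' => fillTerm b x y (s.at (e z) (e z') 0 0)) s' := by
  obtain ⟨s', h1, h2, h3, h4⟩ := fill_spec hs.clean a 2 2 3 3 b x y ha (by decide)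
  refine ⟨s', h1, h2, h3, fun z z' => ?_⟩
  rw [h4 _ (by rw [hs.i2]; exact (e z).2) _ (by rw [hs.i2]; exact (e z').2), hs.i3,
    Finset.sum_range_one, Finset.sum_range_one]

end Index

/-! ### Merging of symbols -/

/-- Merges the classes of the symbols with numbers `idx 8` and `idx 9`. -/
def merge : Prog :=
  .seq (sum 10 o o 3 2 3 2 (.mul (.cell 9 (iv 21) (iv 23)) (.cell 9 (iv 9) (iv 23))))
    (.seq (fill 11 o o 2 2 3 3 (.rlt .zero (vc 10 (iv 20))) (.cell 9 (iv 8) (iv 21))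
      (.cell 9 (iv 20) (iv 21))) (fill 9 o o 2 2 3 3 tt (.cell 11 (iv 20) (iv 21)) .zero))

section Labels

variable {Z : Type*} [Fintype Z] [DecidableEq Z] {m n : ℕ}

/-- Array 9 holds the indicators of the classes of a labelling. -/
def HasLab {N : ℕ} (e : Z ≃ Fin N) (lab : Z → Z) (s : State) : Prop :=
  IsMat e 9 (fun z c => if lab z = c then 1 else 0) s

/-- The product of two rows of class indicators is `1` exactly when the two symbols share a class.
Array 11 serves as a buffer, since `fill` must not read its target. -/
theorem den_merge {s : State} (hs : Fixed m n s) {e : Z ≃ Fin (m + n)} {lab : Z → Z}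
    (hl : HasLab e lab s) {a b : Z} (ha : s.idx 8 = e a) (hb : s.idx 9 = e b) :
    HasLab e (fun z => if lab z = lab b then lab a else lab z) (merge.den s) := by
  obtain ⟨s1, e1, i1, f1, g1⟩ := vecSum_spec hs e 10
    (.mul (.cell 9 (iv 21) (iv 23)) (.cell 9 (iv 9) (iv 23))) (by decide)
  have hs1 := hs.of_idx i1
  obtain ⟨s2, e2, i2, f2, g2⟩ := matFill_spec hs1 e 11 (.rlt .zero (vc 10 (iv 20)))
    (.cell 9 (iv 8) (iv 21)) (.cell 9 (iv 20) (iv 21)) (by decide)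
  have hs2 := hs1.of_idx i2
  obtain ⟨s3, e3, i3, f3, g3⟩ := matFill_spec hs2 e 9 tt (.cell 11 (iv 20) (iv 21)) .zero
    (by decide)
  have hden : merge.den s = s3 := by
    rw [merge, den_seq, den_seq, e1, e2, e3]
  rw [hden]
  intro z c
  have h1 : s1.mem 10 0 (e z) = if lab z = lab b then 1 else 0 := by
    rw [g1 z]
    simp only [RExp.eval, IExp.eval, State.at_mem, State.at_21, State.at_23, Nat.reduceLT,
      State.at_of_lt, hb, hl _ _]
    rw [Finset.sum_eq_single (lab z) (fun l _ hne => by rw [if_neg (Ne.symm hne), zero_mul])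
      fun h => absurd (Finset.mem_univ _) h, if_pos rfl, one_mul]
    exact if_congr eq_comm rfl rfl
  rw [g3 z c]
  simp only [fillTerm_tt, RExp.eval, IExp.eval, State.at_mem, State.at_20, State.at_21]
  rw [g2 z c]
  simp only [fillTerm, BExp.Holds, RExp.eval, IExp.eval, State.at_mem, State.at_20, State.at_21,
    h1, f1 9 (by norm_num), Nat.reduceLT, State.at_of_lt, i1, ha, hl _ _]
  by_cases h : lab z = lab b
  · simp [h]
  · simp [h]

/-- A double loop over all pairs of symbols. -/
theorem den_double_loop (e : Z ≃ Fin (m + n)) {P : Prog} (h8 : 8 ∉ P.writes) (h9 : 9 ∉ P.writes)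
    (J : ℕ → State → Prop) (hJ : ∀ t s, J t s → s.idx 2 = m + n)
    (hJ8 : ∀ t s x, J t s → J t (s.setIdx 8 x)) (hJ9 : ∀ t s x, J t s → J t (s.setIdx 9 x))
    (hstep : ∀ a b s, J (e a * (m + n) + e b) s → s.idx 8 = e a → s.idx 9 = e b →
      J (e a * (m + n) + e b + 1) (P.den s)) {s : State} (h0 : J 0 s) :
    J ((m + n) * (m + n)) ((loop 8 2 (loop 9 2 P)).den s) := by
  obtain ⟨s', h1, h2⟩ := den_loop_induct (v := 8) (u := 2) (P := loop 9 2 P) (s := s)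
    (by simp [writes, h8]) (fun k s => J (k * (m + n)) s) (by
      rw [zero_mul]
      exact hJ8 _ _ _ h0) (by
    intro k hk s1 hs1 hk1
    rw [hJ _ _ h0] at hk
    obtain ⟨a, ha⟩ := exists_index e hk
    obtain ⟨s2, h2, h3, -⟩ := den_loop_induct (v := 9) (u := 2) (P := P) (s := s1) h9
      (fun j s => J (k * (m + n) + j) s ∧ s.idx 8 = k) ⟨hJ9 _ _ _ hs1, by
        rw [State.setIdx_ne _ _ (by norm_num), hk1]⟩ (by
      intro j hj s3 hs3 hj3
      rw [hJ _ _ hs1] at hj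
      obtain ⟨b, hb⟩ := exists_index e hj
      refine ⟨hJ9 _ _ _ ?_, ?_⟩
      · have := hstep a b s3 (by rw [ha, hb]; exact hs3.1) (by rw [hs3.2, ha]) (by rw [hj3, hb])
        rwa [ha, hb] at this
      · rw [State.setIdx_ne _ _ (by norm_num), den_idx P s3 h8, hs3.2])
    rw [h2]
    refine hJ8 _ _ _ (hJ9 _ _ _ ?_)
    rw [hJ _ _ hs1] at h3
    rwa [add_mul, one_mul])
  rw [h1]
  refine hJ8 _ _ _ ?_
  rwa [hJ _ _ h0] at h2

open Classical in
/-- The binary counter that selects the pairs of `S` among those of `D`. -/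
theorem exists_counter (M : ℕ) : ∀ (D S : ℕ → Prop) (R : ℕ), Nat.count D M ≤ R →
    ∃ cn : ℕ → ℕ, cn 0 < 2 ^ R ∧ 2 ^ (R - Nat.count D M) ∣ cn 0 ∧ ∀ t < M,
      cn (t + 1) < 2 ^ R ∧ (D t → 2 * cn t = cn (t + 1) + if S t then 2 ^ R else 0) ∧
      (¬ D t → cn (t + 1) = cn t) := by
  induction M with
  | zero => exact fun D S R _ => ⟨fun _ => 0, by positivity, by simp, by simp⟩
  | succ M ih =>
    intro D S R hR
    rw [Nat.count_succ'] at hR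
    obtain ⟨cn, h1, h2, h3⟩ := ih (fun t => D (t + 1)) (fun t => S (t + 1)) R (by omega)
    set q := Nat.count (fun t => D (t + 1)) M with hq
    by_cases hD : D 0
    · rw [if_pos hD] at hR
      have hp : 2 ^ (R - q) = 2 * 2 ^ (R - (q + 1)) := by
        rw [← pow_succ']; congr 1; omega
      have hR' : 2 ^ (R - (q + 1)) ∣ 2 ^ (R - 1) := pow_dvd_pow _ (by omega)
      have hp' : 2 ^ R = 2 * 2 ^ (R - 1) := by rw [← pow_succ']; congr 1; omega
      obtain ⟨y, hy⟩ := h2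
      -- The counter is built backwards: the new start value is half the old one plus the top bit if
      -- pair `0` is selected. The divisibility in the induction hypothesis makes the halving exact.
      obtain ⟨cn', hz, hsucc⟩ : ∃ cn' : ℕ → ℕ, cn' 0 = 2 ^ (R - (q + 1)) * y +
          (if S 0 then 2 ^ (R - 1) else 0) ∧ ∀ t, cn' (t + 1) = cn t :=
        ⟨fun t => if t = 0 then _ else cn (t - 1), if_pos rfl, fun _ => if_neg (Nat.succ_ne_zero _)⟩
      refine ⟨cn', ?_, ?_, ?_⟩
      · have : 2 * (2 ^ (R - (q + 1)) * y) = cn 0 := by rw [hy, hp, mul_assoc]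
        rw [hz]
        split_ifs <;> omega
      · rw [Nat.count_succ', if_pos hD, hz]
        refine dvd_add (dvd_mul_right _ _) ?_
        split_ifs
        · exact hR'
        · exact dvd_zero _
      · rintro (_ | t) ht
        · refine ⟨by rwa [hsucc], fun _ => ?_, fun h => absurd hD h⟩
          rw [hsucc, hz, hy, hp]
          split_ifs
          · rw [hp']; ring
          · ring
        · rw [hsucc, hsucc]
          exact h3 t (by omega)
    · rw [if_neg hD] at hR
      obtain ⟨cn', hz, hsucc⟩ : ∃ cn' : ℕ → ℕ, cn' 0 = cn 0 ∧ ∀ t, cn' (t + 1) = cn t :=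
        ⟨fun t => if t = 0 then _ else cn (t - 1), if_pos rfl, fun _ => if_neg (Nat.succ_ne_zero _)⟩
      refine ⟨cn', by rwa [hz], ?_, ?_⟩
      · rw [Nat.count_succ', if_neg hD, hz]
        exact h2
      · rintro (_ | t) ht
        · exact ⟨by rwa [hsucc], fun h => absurd h hD, fun _ => by rw [hsucc, hz]⟩
        · rw [hsucc, hsucc]
          exact h3 t (by omega)

/-- One round of `labels`. -/
def labelStep : Prog :=
  .ite (.rlt .zero (.cell 6 (iv 8) (iv 9)))
    (.seq (.iset 7 (.add (iv 7) (iv 7))) (.ite (.ilt (iv 7) (iv 5)) .skip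
      (.seq (.iset 7 (.sub (iv 7) (iv 5))) merge))) .skip

/-- Computes the classes of the symbols after merging the strict relations that are selected by
the binary digits of `idx 6`. -/
def labels : Prog :=
  .seq (.iset 7 (iv 6)) (.seq (fill 9 o o 2 2 3 3 (ieq (iv 20) (iv 21)) .one .zero)
    (.loop 8 2 (.loop 9 2 labelStep)))

/-- The numbers of the pairs in the relation `L`. -/
def pairNumbers {N : ℕ} (e : Z ≃ Fin N) (L : Z → Z → Prop) (t : ℕ) : Prop :=
  ∃ a b, (e a : ℕ) * N + e b = t ∧ L a b

theorem pairNumbers_iff {N : ℕ} (e : Z ≃ Fin N) (L : Z → Z → Prop) (a b : Z) :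
    pairNumbers e L (e a * N + e b) ↔ L a b := by
  constructor
  · rintro ⟨a', b', h, hL⟩
    obtain ⟨rfl, rfl⟩ := index_pair_inj e h
    exact hL
  · exact fun h => ⟨a, b, rfl, h⟩

-- The number `a` encodes the selection of those pairs of `L` that lie in `R`, and doubling the
-- register reads its binary digits from the top. Merging selected pairs one after another never
-- leaves `R`, because `R` is an equivalence.
open Classical in
theorem exists_labels (e : Z ≃ Fin (m + n)) (L R : Z → Z → Prop) (hR : Equivalence R) :
    ∃ a < 2 ^ Nat.count (pairNumbers e L) ((m + n) * (m + n)), ∀ s, Fixed m n s →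
      IsMat e 6 (fun z z' => if L z z' then 1 else 0) s →
      s.idx 5 = 2 ^ Nat.count (pairNumbers e L) ((m + n) * (m + n)) → s.idx 6 = a →
      ∃ lab : Z → Z, HasLab e lab (labels.den s) ∧ (∀ z z', lab z = lab z' → R z z') ∧
        ∀ z z', L z z' → R z z' → lab z = lab z' := by
  obtain ⟨cn, hc0, -, hc⟩ := exists_counter ((m + n) * (m + n)) (pairNumbers e L)
    (pairNumbers e R) _ le_rfl
  set r := Nat.count (pairNumbers e L) ((m + n) * (m + n))
  refine ⟨cn 0, hc0, fun s hs hL h5 h6 => ?_⟩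
  -- Before pair number `t` the register holds `cn t`, all earlier selected pairs are merged, and
  -- classes are contained in `R`-classes.
  let J : ℕ → State → Prop := fun t s => Fixed m n s ∧
    IsMat e 6 (fun z z' => if L z z' then 1 else 0) s ∧ s.idx 5 = 2 ^ r ∧ s.idx 7 = cn t ∧
    ∃ lab : Z → Z, HasLab e lab s ∧ (∀ z z', lab z = lab z' → R z z') ∧
      ∀ z z', (e z : ℕ) * (m + n) + e z' < t → L z z' → R z z' → lab z = lab z'
  suffices hJ : J ((m + n) * (m + n)) (labels.den s) by
    obtain ⟨-, -, -, -, lab, h1, h2, h3⟩ := hJ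
    refine ⟨lab, h1, h2, fun z z' => h3 z z' ?_⟩
    have h1 := (e z).2
    have h2 := (e z').2
    calc (e z : ℕ) * (m + n) + e z' < (e z + 1) * (m + n) := by rw [add_mul, one_mul]; omega
      _ ≤ (m + n) * (m + n) := Nat.mul_le_mul_right _ h1
  have hs' := hs.setIdx (v := 7) (s.idx 6) (by decide)
  obtain ⟨s1, e1, i1, f1, g1⟩ := matFill_spec hs' e 9 (ieq (iv 20) (iv 21)) .one .zero
    (by decide)
  have hd : labels.den s = (Prog.loop 8 2 (.loop 9 2 labelStep)).den s1 := by
    rw [labels, den_seq, den_seq, ← e1]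
    rfl
  rw [hd]
  refine den_double_loop e (by decide) (by decide) J (fun t s h => h.1.i2) ?_ ?_ ?_ ?_
  · rintro t s x ⟨k1, k2, k3, k4, k5⟩
    exact ⟨k1.setIdx x (by decide), k2, by rwa [State.setIdx_ne _ _ (by norm_num)],
      by rwa [State.setIdx_ne _ _ (by norm_num)], k5⟩
  · rintro t s x ⟨k1, k2, k3, k4, k5⟩
    exact ⟨k1.setIdx x (by decide), k2, by rwa [State.setIdx_ne _ _ (by norm_num)],
      by rwa [State.setIdx_ne _ _ (by norm_num)], k5⟩
  · rintro a b s ⟨k1, k2, k3, k4, lab, k5, k6, k7⟩ h8 h9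
    have hlt : (e a : ℕ) * (m + n) + e b < (m + n) * (m + n) := by
      have h1 := (e a).2
      have h2 := (e b).2
      calc (e a : ℕ) * (m + n) + e b < (e a + 1) * (m + n) := by rw [add_mul, one_mul]; omega
        _ ≤ (m + n) * (m + n) := Nat.mul_le_mul_right _ h1
    obtain ⟨hc1, hc2, hc3⟩ := hc _ hlt
    rw [pairNumbers_iff] at hc2 hc3
    rw [pairNumbers_iff] at hc2
    have hcond : (BExp.rlt .zero (.cell 6 (iv 8) (iv 9))).Holds s ↔ L a b := by
      simp only [BExp.Holds, RExp.eval, IExp.eval, h8, h9, k2 a b]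
      split_ifs with h <;> simp [h]
    have hnew : ∀ (lab' : Z → Z), (∀ z z', lab z = lab z' → lab' z = lab' z') →
        (L a b → R a b → lab' a = lab' b) → ∀ z z', (e z : ℕ) * (m + n) + e z' <
          e a * (m + n) + e b + 1 → L z z' → R z z' → lab' z = lab' z' := by
      intro lab' h1 h2 z z' hz hL hR
      rcases Nat.lt_succ_iff_lt_or_eq.1 hz with hz | hz
      · exact h1 _ _ (k7 z z' hz hL hR)
      · obtain ⟨rfl, rfl⟩ := index_pair_inj e hz
        exact h2 hL hR
    by_cases hLab : L a b
    · have hc2 := hc2 hLab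
      rw [labelStep, den, if_pos (hcond.2 hLab), den_seq]
      set s' := (Prog.iset 7 (.add (iv 7) (iv 7))).den s with hs'
      have e5 : s'.idx 5 = 2 ^ r := by rw [hs', den, State.setIdx_ne _ _ (by norm_num), k3]
      have e7 : s'.idx 7 = 2 * cn (e a * (m + n) + e b) := by
        rw [hs', den, State.setIdx_self]
        simp only [IExp.eval, k4, two_mul]
      have e8 : s'.idx 8 = e a := by rw [hs', den, State.setIdx_ne _ _ (by norm_num), h8]
      have e9 : s'.idx 9 = e b := by rw [hs', den, State.setIdx_ne _ _ (by norm_num), h9]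
      have k1' : Fixed m n s' := k1.setIdx _ (by decide)
      have k2' : IsMat e 6 (fun z z' => if L z z' then 1 else 0) s' := k2
      have k5' : HasLab e lab s' := k5
      clear_value s'
      have hcond' : (BExp.ilt (iv 7) (iv 5)).Holds s' ↔ ¬ R a b := by
        simp only [BExp.Holds, IExp.eval, e7, e5, hc2]
        split_ifs with h <;> simp [h, hc1]
      by_cases hRab : R a b
      · rw [den, if_neg (fun h => hcond'.1 h hRab), den_seq]
        rw [if_pos hRab] at hc2
        set s'' := (Prog.iset 7 (.sub (iv 7) (iv 5))).den s' with hs''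
        have m1 : Fixed m n s'' := k1'.setIdx _ (by decide)
        have m2 : IsMat e 6 (fun z z' => if L z z' then 1 else 0) s'' := k2'
        have m5 : s''.idx 5 = 2 ^ r := by rw [hs'', den, State.setIdx_ne _ _ (by norm_num), e5]
        have m7 : s''.idx 7 = cn (e a * (m + n) + e b + 1) := by
          rw [hs'', den, State.setIdx_self]
          simp only [IExp.eval, e7, e5, hc2]
          omega
        have m8 : s''.idx 8 = e a := by rw [hs'', den, State.setIdx_ne _ _ (by norm_num), e8]
        have m9 : s''.idx 9 = e b := by rw [hs'', den, State.setIdx_ne _ _ (by norm_num), e9]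
        have ml : HasLab e lab s'' := k5'
        clear_value s''
        refine ⟨m1.den _ (by decide) (by decide), ?_, ?_, ?_, _, den_merge m1 ml m8 m9, ?_, ?_⟩
        · intro z z'
          rw [den_mem _ _ (by decide)]
          exact m2 z z'
        · rw [den_idx _ _ (by decide), m5]
        · rw [den_idx _ _ (by decide), m7]
        · intro z z' h
          -- The new label of `z` is the old label of a representative that is `R`-related to `z`,
          -- namely `a` or `z` itself.
          have hz : ∀ z, R z (if lab z = lab b then a else z) := by
            intro z
            split_ifs with h
            · exact hR.trans (k6 _ _ h) (hR.symm hRab)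
            · exact hR.refl z
          have hz' : ∀ z, (if lab z = lab b then lab a else lab z) =
              lab (if lab z = lab b then a else z) := fun z => by split_ifs <;> rfl
          simp only [hz'] at h
          exact hR.trans (hz z) (hR.trans (k6 _ _ h) (hR.symm (hz z')))
        · refine hnew _ (fun z z' h => by simp only [h]) fun _ _ => ?_
          simp only [if_true]
          split_ifs with h <;> rfl
      · rw [den, if_pos (hcond'.2 hRab), den]
        rw [if_neg hRab] at hc2
        exact ⟨k1', k2', e5, by omega, lab, k5', k6, hnew lab (fun _ _ h => h) fun _ h =>
          absurd h hRab⟩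
    · rw [labelStep, den, if_neg (fun h => hLab (hcond.1 h)), den]
      exact ⟨k1, k2, k3, by rw [k4, hc3 hLab], lab, k5, k6, hnew lab (fun _ _ h => h) fun h =>
        absurd h hLab⟩
  · refine ⟨hs'.of_idx i1, ?_, ?_, ?_, id, ?_, ?_, ?_⟩
    · intro z z'
      rw [f1 6 (by norm_num)]
      exact hL z z'
    · rw [i1, State.setIdx_ne _ _ (by norm_num), h5]
    · rw [i1, State.setIdx_self, h6]
    · intro z z'
      rw [g1]
      simp only [fillTerm, BExp.Holds, IExp.eval, State.at_20, State.at_21, RExp.eval, id]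
      refine if_congr ⟨fun h => ?_, fun h => by simp [h]⟩ rfl rfl
      exact index_inj e (by omega)
    · rintro z z' rfl
      exact hR.refl z
    · intro z z' h
      omega

end Labels

end Algo

end MonoCorr


namespace MonoCorr

namespace Algo

open Prog

/-! ### The Krylov sequence -/

section Krylov

/-- One round of the three-term recurrence. -/
def lanczosStep : Prog :=
  .seq (sum 22 o o 3 2 3 2 (.mul (.cell 15 (iv 21) (iv 23)) (vc 17 (iv 23))))
  (.seq (sum 23 o o 3 3 3 2 (.mul (vc 17 (iv 23)) (vc 17 (iv 23))))
  (.seq (sum 24 o o 3 3 3 2 (.mul (vc 22 (iv 23)) (vc 17 (iv 23))))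
  (.seq (sum 25 o o 3 2 3 3 (.sub (.sub (vc 22 (iv 21)) (.mul (.div (sc 24) (sc 23))
    (vc 17 (iv 21)))) (.mul (.div (sc 23) (sc 19)) (vc 18 (iv 21)))))
  (.seq (fill 26 o o 3 14 3 3 (.ilt (iv 21) (.lit 1))
    (.sub (.sub .zero (.mul (.div (sc 24) (sc 23)) (vc 20 (iv 21))))
      (.mul (.div (sc 23) (sc 19)) (vc 21 (iv 21))))
    (.sub (.sub (vc 20 (.sub (iv 21) (.lit 1))) (.mul (.div (sc 24) (sc 23)) (vc 20 (iv 21))))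
      (.mul (.div (sc 23) (sc 19)) (vc 21 (iv 21)))))
  (.seq (sum 18 o o 3 2 3 3 (vc 17 (iv 21)))
  (.seq (sum 17 o o 3 2 3 3 (vc 25 (iv 21)))
  (.seq (sum 21 o o 3 14 3 3 (vc 20 (iv 21)))
  (.seq (sum 20 o o 3 14 3 3 (vc 26 (iv 21)))
    (sum 19 o o 3 3 3 3 (sc 23))))))))))

/-- Computes the first annihilating polynomial of the vector in array 16, times the variable. -/
def lanczosProg : Prog :=
  .seq (sum 17 o o 3 2 3 3 (vc 16 (iv 21)))
  (.seq (sum 18 o o 3 2 3 3 .zero)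
  (.seq (fill 20 o o 3 14 3 3 (ieq (iv 21) (.lit 1)) .one .zero)
  (.seq (sum 21 o o 3 14 3 3 .zero)
  (.seq (sum 19 o o 3 3 3 3 .zero)
    (.loop 13 2 lanczosStep)))))

/-- Extracts the roots of the polynomial in array 20. -/
def rootsProg : Prog := .loop 13 4 (.root 27 o (iv 13) 20 o 4 (iv 13))

variable {Z : Type*} [Fintype Z] [DecidableEq Z] {m n : ℕ}

/-- The first row of array `a` holds the coefficients of `q`. -/
def IsPoly (d a : ℕ) (q : Polynomial ℝ) (s : State) : Prop := ∀ j < d, s.mem a 0 j = q.coeff j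

theorem polyFill_spec {s : State} (hs : Fixed m n s) (a : ℕ) (b : BExp) (x y : RExp)
    (ha : a ∉ b.arrays ++ x.arrays ++ y.arrays) :
    ∃ s', (fill a o o 3 14 3 3 b x y).den s = s' ∧ s'.idx = s.idx ∧
      (∀ a' ≠ a, s'.mem a' = s.mem a') ∧
      ∀ j < m + n + 2, s'.mem a 0 j = fillTerm b x y (s.at 0 j 0 0) := by
  obtain ⟨s', h1, h2, h3, h4⟩ := fill_spec hs.clean a 3 14 3 3 b x y ha (by decide)
  refine ⟨s', h1, h2, h3, fun j hj => ?_⟩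
  rw [h4 0 (by rw [hs.i3]; norm_num) j (by rwa [hs.i14]), hs.i3,
    Finset.sum_range_one, Finset.sum_range_one]

/-- The state after `k` rounds of the recurrence. -/
structure LanczosState (e : Z ≃ Fin (m + n)) (M : Z → Z → ℝ)
    (T : EuclideanSpace ℝ Z →ₗ[ℝ] EuclideanSpace ℝ Z) (h : EuclideanSpace ℝ Z) (k : ℕ)
    (s : State) : Prop where
  fixed : Fixed m n s
  mat : IsMat e 15 M s
  cur : IsVec e 17 (fun z => lanczos T h (k + 1) z) s
  prev : IsVec e 18 (fun z => lanczos T h k z) s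
  np : s.mem 19 0 0 = inner ℝ (lanczos T h k) (lanczos T h k)
  qc : IsPoly (m + n + 2) 20 (lanczosPoly T h (k + 1)) s
  qp : IsPoly (m + n + 2) 21 (lanczosPoly T h k) s

variable {e : Z ≃ Fin (m + n)} {M : Z → Z → ℝ}
  {T : EuclideanSpace ℝ Z →ₗ[ℝ] EuclideanSpace ℝ Z} (hT : ∀ u z, T u z = ∑ l, M z l * u l)
  {h : EuclideanSpace ℝ Z}

include hT

/-- The new vector and polynomial are completed in buffers before the old ones are shifted, as all
of them are needed to compute the next. -/
theorem den_lanczosStep {k : ℕ} {s : State} (hs : LanczosState e M T h k s) :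
    LanczosState e M T h (k + 1) (lanczosStep.den s) := by
  obtain ⟨s1, e1, i1, f1, g1⟩ := vecSum_spec hs.fixed e 22
    (.mul (.cell 15 (iv 21) (iv 23)) (vc 17 (iv 23))) (by decide)
  have hs1 := hs.fixed.of_idx i1
  obtain ⟨s2, e2, i2, f2, g2⟩ := scalarSum_spec hs1 e 23
    (.mul (vc 17 (iv 23)) (vc 17 (iv 23))) (by decide)
  have hs2 := hs1.of_idx i2
  obtain ⟨s3, e3, i3, f3, g3⟩ := scalarSum_spec hs2 e 24
    (.mul (vc 22 (iv 23)) (vc 17 (iv 23))) (by decide)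
  have hs3 := hs2.of_idx i3
  obtain ⟨s4, e4, i4, f4, g4⟩ := vec_spec hs3 e 25
    (.sub (.sub (vc 22 (iv 21)) (.mul (.div (sc 24) (sc 23))
      (vc 17 (iv 21)))) (.mul (.div (sc 23) (sc 19)) (vc 18 (iv 21)))) (by decide)
  have hs4 := hs3.of_idx i4
  obtain ⟨s5, e5, i5, f5, g5⟩ := polyFill_spec hs4 26 (.ilt (iv 21) (.lit 1))
    (.sub (.sub .zero (.mul (.div (sc 24) (sc 23)) (vc 20 (iv 21))))
      (.mul (.div (sc 23) (sc 19)) (vc 21 (iv 21))))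
    (.sub (.sub (vc 20 (.sub (iv 21) (.lit 1))) (.mul (.div (sc 24) (sc 23)) (vc 20 (iv 21))))
      (.mul (.div (sc 23) (sc 19)) (vc 21 (iv 21)))) (by decide)
  have hs5 := hs4.of_idx i5
  obtain ⟨s6, e6, i6, f6, g6⟩ := vec_spec hs5 e 18 (vc 17 (iv 21)) (by decide)
  have hs6 := hs5.of_idx i6
  obtain ⟨s7, e7, i7, f7, g7⟩ := vec_spec hs6 e 17 (vc 25 (iv 21)) (by decide)
  have hs7 := hs6.of_idx i7
  obtain ⟨s8, e8, i8, f8, g8⟩ := polyFill_spec hs7 21 tt (vc 20 (iv 21)) .zero (by decide)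
  have hs8 := hs7.of_idx i8
  obtain ⟨s9, e9, i9, f9, g9⟩ := polyFill_spec hs8 20 tt (vc 26 (iv 21)) .zero (by decide)
  have hs9 := hs8.of_idx i9
  obtain ⟨s10, e10, i10, f10, g10⟩ := scalar_spec hs9 19 3 3 (sc 23) (by decide) (by decide)
  have hden : lanczosStep.den s = s10 := by
    rw [lanczosStep, den_seq, e1, den_seq, e2, den_seq, e3, den_seq, e4, den_seq, e5, den_seq, e6,
      den_seq, e7, den_seq, e8, den_seq, e9, e10]
  rw [hden]
  set A := lanczosA T h k with hA
  set B := lanczosB T h k with hB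
  have hnc : s2.mem 23 0 0 = inner ℝ (lanczos T h (k + 1)) (lanczos T h (k + 1)) := by
    rw [g2, PiLp.inner_apply]
    simp only [RExp.eval, IExp.eval, State.at_mem, State.at_23, f1, ne_eq, Nat.reduceEqDiff,
      not_false_eq_true, hs.cur _, RCLike.inner_apply, conj_trivial]
  have htv : ∀ z, s1.mem 22 0 (e z) = T (lanczos T h (k + 1)) z := by
    intro z
    rw [g1 z, hT]
    simp only [RExp.eval, IExp.eval, State.at_mem, State.at_21, State.at_23, hs.mat _ _, hs.cur _]
  have hal : s3.mem 24 0 0 = inner ℝ (T (lanczos T h (k + 1))) (lanczos T h (k + 1)) := by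
    rw [g3, PiLp.inner_apply]
    simp only [RExp.eval, IExp.eval, State.at_mem, State.at_23, f2, f1, ne_eq, Nat.reduceEqDiff,
      not_false_eq_true, hs.cur _, htv, RCLike.inner_apply, conj_trivial]
    exact Finset.sum_congr rfl fun _ _ => mul_comm _ _
  have hA3 : s3.mem 24 0 0 / s2.mem 23 0 0 = A := by rw [hal, hnc]; rfl
  have hB3 : s2.mem 23 0 0 / s.mem 19 0 0 = B := by rw [hnc, hs.np]; rfl
  refine ⟨hs9.of_idx i10, ?_, ?_, ?_, ?_, ?_, ?_⟩
  · intro z z'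
    simp only [f10, f9, f8, f7, f6, f5, f4, f3, f2, f1, ne_eq, Nat.reduceEqDiff, not_false_eq_true,
      hs.mat _ _]
  · intro z
    simp only [f10, f9, f8, ne_eq, Nat.reduceEqDiff, not_false_eq_true, g7 _]
    simp only [RExp.eval, IExp.eval, State.at_mem, State.at_21, f6, f5, ne_eq, Nat.reduceEqDiff,
      not_false_eq_true, g4 _]
    simp only [f3, f2, f1, ne_eq, Nat.reduceEqDiff, not_false_eq_true, hA3, hB3, htv, hs.cur _,
      hs.prev _]
    rw [lanczos_add_two]
    simp [A, B]
  · intro z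
    simp only [f10, f9, f8, f7, ne_eq, Nat.reduceEqDiff, not_false_eq_true, g6 _]
    simp only [RExp.eval, IExp.eval, State.at_mem, State.at_21, f5, f4, f3, f2, f1, ne_eq,
      Nat.reduceEqDiff, not_false_eq_true, hs.cur _]
  · rw [g10, hs9.i3, Finset.sum_range_one, Finset.sum_range_one]
    simp only [RExp.eval, IExp.eval, State.at_mem, f9, f8, f7, f6, f5, f4, f3, ne_eq,
      Nat.reduceEqDiff, not_false_eq_true, hnc]
  · intro j hj
    simp only [f10, ne_eq, Nat.reduceEqDiff, not_false_eq_true, g9 j hj, fillTerm_tt]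
    simp only [RExp.eval, IExp.eval, State.at_mem, State.at_21, f8, f7, f6, ne_eq,
      Nat.reduceEqDiff, not_false_eq_true, g5 j hj, fillTerm, BExp.Holds]
    simp only [f4, f3, f2, f1, ne_eq, Nat.reduceEqDiff, not_false_eq_true, hA3, hB3,
      hs.qc _ hj, hs.qp _ hj, hs.qc (j - 1) (by omega)]
    rw [lanczosPoly_add_two]
    -- The constant coefficient is separate because `X * q` has none, while the truncated index `j -
    -- 1` would wrongly return coefficient `0`.
    rcases j with _ | j
    · simp [A, B]
    · simp [A, B, Polynomial.coeff_X_mul]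
  · intro j hj
    simp only [f10, f9, ne_eq, Nat.reduceEqDiff, not_false_eq_true, g8 j hj, fillTerm_tt]
    simp only [RExp.eval, IExp.eval, State.at_mem, State.at_21, f7, f6, f5, f4, f3, f2, f1, ne_eq,
      Nat.reduceEqDiff, not_false_eq_true, hs.qc _ hj]

theorem den_lanczosProg {s : State} (hs : Fixed m n s) (hM : IsMat e 15 M s)
    (hh : IsVec e 16 (fun z => h z) s) :
    IsPoly (m + n + 2) 20 (lanczosPoly T h (m + n + 1)) (lanczosProg.den s) := by
  obtain ⟨s1, e1, i1, f1, g1⟩ := vec_spec hs e 17 (vc 16 (iv 21)) (by decide)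
  have hs1 := hs.of_idx i1
  obtain ⟨s2, e2, i2, f2, g2⟩ := vec_spec hs1 e 18 .zero (by decide)
  have hs2 := hs1.of_idx i2
  obtain ⟨s3, e3, i3, f3, g3⟩ := polyFill_spec hs2 20 (ieq (iv 21) (.lit 1)) .one .zero (by decide)
  have hs3 := hs2.of_idx i3
  obtain ⟨s4, e4, i4, f4, g4⟩ := polyFill_spec hs3 21 tt .zero .zero (by decide)
  have hs4 := hs3.of_idx i4
  obtain ⟨s5, e5, i5, f5, g5⟩ := scalar_spec hs4 19 3 3 .zero (by decide) (by decide)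
  have hs5 := hs4.of_idx i5
  have hden : lanczosProg.den s = (Prog.loop 13 2 lanczosStep).den s5 := by
    rw [lanczosProg, den_seq, e1, den_seq, e2, den_seq, e3, den_seq, e4, den_seq, e5]
  rw [hden]
  have key : ∀ k s, LanczosState e M T h k s → ∀ x, LanczosState e M T h k (s.setIdx 13 x) :=
    fun k s hk x => ⟨hk.fixed.setIdx x (by decide), hk.mat, hk.cur, hk.prev, hk.np, hk.qc, hk.qp⟩
  have h0 : LanczosState e M T h 0 s5 := by
    refine ⟨hs5, ?_, ?_, ?_, ?_, ?_, ?_⟩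
    · intro z z'
      simp only [f5, f4, f3, f2, f1, ne_eq, Nat.reduceEqDiff, not_false_eq_true, hM _ _]
    · intro z
      simp only [f5, f4, f3, f2, ne_eq, Nat.reduceEqDiff, not_false_eq_true, g1 _]
      simp only [RExp.eval, IExp.eval, State.at_mem, State.at_21, hh _, zero_add, lanczos_one]
    · intro z
      simp only [f5, f4, f3, ne_eq, Nat.reduceEqDiff, not_false_eq_true, g2 _]
      simp only [RExp.eval, lanczos_zero, PiLp.zero_apply]
    · rw [g5, hs4.i3, Finset.sum_range_one, Finset.sum_range_one]
      simp [RExp.eval, lanczos_zero]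
    · intro j hj
      simp only [f5, f4, ne_eq, Nat.reduceEqDiff, not_false_eq_true, g3 j hj]
      simp only [fillTerm, BExp.Holds, IExp.eval, State.at_21, RExp.eval, lanczosPoly,
        Polynomial.coeff_X]
      exact if_congr (by omega) rfl rfl
    · intro j hj
      simp only [f5, ne_eq, Nat.reduceEqDiff, not_false_eq_true, g4 j hj, fillTerm_tt, RExp.eval,
        lanczosPoly, Polynomial.coeff_zero]
  obtain ⟨s', h1, h2⟩ := den_loop_induct (v := 13) (u := 2) (P := lanczosStep) (s := s5)
    (by decide) (fun k s => LanczosState e M T h k s) (key _ _ h0 _)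
    fun k _ s' hs' _ => key _ _ (den_lanczosStep hT hs') _
  rw [hs5.i2] at h2
  rw [h1]
  exact h2.qc

omit hT in
-- Index variable `4` is `m + n + 1`, at once the degree of the polynomial and the largest possible
-- number of its roots.
theorem den_rootsProg {s : State} (hs : Fixed m n s) :
    ∀ k < m + n + 1, (rootsProg.den s).mem 27 0 k =
      kthRoot (fun l => s.mem 20 0 l) (m + n + 1) k := by
  obtain ⟨s', h1, h2, h3⟩ := den_loop_induct (v := 13) (u := 4)
    (P := .root 27 o (iv 13) 20 o 4 (iv 13)) (s := s)
    (by decide) (fun k s' => (Fixed m n s' ∧ s'.mem 20 = s.mem 20) ∧ ∀ k' < k, s'.mem 27 0 k' =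
      kthRoot (fun l => s.mem 20 0 l) (m + n + 1) k') ⟨⟨hs.setIdx _ (by decide), rfl⟩, by simp⟩ (by
    rintro k - s' ⟨⟨h1, h2⟩, h3⟩ hk
    refine ⟨⟨(h1.den _ (by decide) (by decide)).setIdx _ (by decide), ?_⟩, fun k' hk' => ?_⟩
    · rw [← h2]
      funext i j
      simp [den, State.setMem, State.setIdx]
    · simp only [den, State.setMem, State.setIdx, IExp.eval, hk, true_and, h1.i4, h2]
      split_ifs with h
      · rw [h]
      · exact h3 k' (by omega))
  rw [hs.i4] at h3
  intro k hk
  rw [rootsProg, h1]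
  exact h3 k hk

end Krylov

end Algo

end MonoCorr


namespace MonoCorr

namespace Algo

open Prog

/-! ### Eigenvectors by deflation -/

section Deflation

/-- Applies the operator in array 15, shifted by the current root, to the vector in array 28. -/
def deflateStep : Prog :=
  .seq (sum 29 o o 3 2 3 2 (.mul (.cell 15 (iv 21) (iv 23)) (vc 28 (iv 23))))
  (.seq (sum 30 o o 3 2 3 3 (.sub (vc 29 (iv 21)) (.mul (vc 27 (iv 13)) (vc 28 (iv 21)))))
    (sum 28 o o 3 2 3 3 (vc 30 (iv 21))))

/-- Deflates the vector in array 16 at all roots different from root `idx 12`, if there is one. -/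
def deflateProg : Prog :=
  .seq (sum 28 o o 3 2 3 3 (vc 16 (iv 21)))
    (.loop 13 4 (.ite (.and (.ilt (iv 12) (iv 4)) (rne (vc 27 (iv 13)) (vc 27 (iv 12))))
      deflateStep .skip))

variable {Z : Type*} [Fintype Z] [DecidableEq Z] {m n : ℕ}

variable {e : Z ≃ Fin (m + n)} {M : Z → Z → ℝ}
  {T : EuclideanSpace ℝ Z →ₗ[ℝ] EuclideanSpace ℝ Z} (hT : ∀ u z, T u z = ∑ l, M z l * u l)
  {h : EuclideanSpace ℝ Z}

include hT

theorem den_deflateStep {s : State} (hs : Fixed m n s) (hM : IsMat e 15 M s)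
    {v : EuclideanSpace ℝ Z} (hv : IsVec e 28 (fun z => v z) s) :
    IsVec e 28 (fun z => (T v - s.mem 27 0 (s.idx 13) • v) z) (deflateStep.den s) := by
  obtain ⟨s1, e1, i1, f1, g1⟩ := vecSum_spec hs e 29
    (.mul (.cell 15 (iv 21) (iv 23)) (vc 28 (iv 23))) (by decide)
  have hs1 := hs.of_idx i1
  obtain ⟨s2, e2, i2, f2, g2⟩ := vec_spec hs1 e 30
    (.sub (vc 29 (iv 21)) (.mul (vc 27 (iv 13)) (vc 28 (iv 21)))) (by decide)
  have hs2 := hs1.of_idx i2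
  obtain ⟨s3, e3, i3, f3, g3⟩ := vec_spec hs2 e 28 (vc 30 (iv 21)) (by decide)
  have hden : deflateStep.den s = s3 := by
    rw [deflateStep, den_seq, e1, den_seq, e2, e3]
  rw [hden]
  intro z
  rw [g3 z]
  simp only [RExp.eval, IExp.eval, State.at_mem, State.at_21, g2 _, f1, ne_eq, Nat.reduceEqDiff,
    not_false_eq_true, g1 _, State.at_23, hM _ _, hv _, ← hT, Nat.reduceLT, State.at_of_lt, i1]
  simp

theorem den_deflateProg {s : State} (hs : Fixed m n s) (hM : IsMat e 15 M s)
    (hh : IsVec e 16 (fun z => h z) s) :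
    IsVec e 28 (fun z => deflate T (if s.idx 12 < m + n + 1 then
      ((List.range (m + n + 1)).map fun k => s.mem 27 0 k).filter
        fun μ => μ ≠ s.mem 27 0 (s.idx 12) else []) h z) (deflateProg.den s) := by
  obtain ⟨s1, e1, i1, f1, g1⟩ := vec_spec hs e 28 (vc 16 (iv 21)) (by decide)
  have hs1 := hs.of_idx i1
  rw [deflateProg, den_seq, e1]
  set k0 := s.idx 12
  set μ := fun k => s.mem 27 0 k with hμ
  -- Values, not indices, are compared, so all copies of a multiple root are spared. For `k0 = m + n
  -- + 1` the list is empty and the start vector itself becomes the candidate.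
  let l : ℕ → List ℝ := fun k => if k0 < m + n + 1 then
      ((List.range k).map μ).filter fun x => x ≠ μ k0 else []
  let I : ℕ → State → Prop := fun k s => Fixed m n s ∧ IsMat e 15 M s ∧ s.idx 12 = k0 ∧
    (∀ j, s.mem 27 0 j = μ j) ∧ IsVec e 28 (fun z => deflate T (l k) h z) s
  have h0 : I 0 (s1.setIdx 13 0) := by
    refine ⟨hs1.setIdx _ (by decide), ?_, ?_, ?_, ?_⟩
    · intro z z'
      change s1.mem 15 _ _ = _
      rw [f1 15 (by norm_num), hM _ _]
    · rw [State.setIdx_ne _ _ (by norm_num), i1]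
    · intro j
      change s1.mem 27 _ _ = _
      rw [f1 27 (by norm_num)]
    · intro z
      change s1.mem 28 _ _ = _
      have : l 0 = [] := by simp [l]
      rw [g1 z, this]
      simp only [RExp.eval, IExp.eval, State.at_mem, State.at_21, hh _]
      rfl
  obtain ⟨s', h1, h2⟩ := den_loop_induct (v := 13) (u := 4)
    (P := .ite (.and (.ilt (iv 12) (iv 4)) (rne (vc 27 (iv 13)) (vc 27 (iv 12))))
      deflateStep .skip) (s := s1) (by decide) I h0 (by
    rintro k - s2 ⟨a1, a2, a3, a4, a5⟩ hk
    have hsucc : l (k + 1) = if k0 < m + n + 1 ∧ μ k ≠ μ k0 then l k ++ [μ k] else l k := by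
      simp only [l]
      by_cases h1 : k0 < m + n + 1
      · rw [if_pos h1, if_pos h1, List.range_succ, List.map_append, List.filter_append]
        by_cases h2 : μ k ≠ μ k0
        · rw [if_pos ⟨h1, h2⟩]
          congr 1
          simp [h2]
        · rw [if_neg (fun h => h2 h.2)]
          push Not at h2
          simp [h2]
      · simp [h1]
    have hcond : (BExp.and (.ilt (iv 12) (iv 4)) (rne (vc 27 (iv 13)) (vc 27 (iv 12)))).Holds s2 ↔
        k0 < m + n + 1 ∧ μ k ≠ μ k0 := by
      simp only [BExp.Holds, RExp.eval, IExp.eval, hk, a1.i4, a3, a4]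
      rw [ne_iff_lt_or_gt]
      tauto
    have hd : (Prog.ite (.and (.ilt (iv 12) (iv 4)) (rne (vc 27 (iv 13)) (vc 27 (iv 12))))
        deflateStep .skip).den s2 = if k0 < m + n + 1 ∧ μ k ≠ μ k0 then deflateStep.den s2
          else s2 := by
      classical
      rw [den]
      exact if_congr hcond rfl rfl
    rw [hd]
    by_cases hc : k0 < m + n + 1 ∧ μ k ≠ μ k0
    · rw [if_pos hc]
      refine ⟨(a1.den _ (by decide) (by decide)).setIdx _ (by decide), ?_, ?_, ?_, ?_⟩
      · intro z z'
        change (deflateStep.den s2).mem 15 _ _ = _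
        rw [den_mem _ _ (by decide), a2 _ _]
      · rw [State.setIdx_ne _ _ (by norm_num), den_idx _ _ (by decide), a3]
      · intro j
        change (deflateStep.den s2).mem 27 0 j = _
        rw [den_mem _ _ (by decide), a4]
      · intro z
        change (deflateStep.den s2).mem 28 0 _ = _
        rw [den_deflateStep hT a1 a2 a5 z, hsucc, if_pos hc, hk, a4]
        simp only [deflate, List.foldl_append, List.foldl_cons, List.foldl_nil]
    · rw [if_neg hc]
      refine ⟨a1.setIdx _ (by decide), a2, ?_, a4, ?_⟩
      · rw [State.setIdx_ne _ _ (by norm_num), a3]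
      · rw [hsucc, if_neg hc]
        exact a5)
  rw [h1]
  rw [hs1.i4] at h2
  exact h2.2.2.2.2

end Deflation

section Joint

variable {X Y : Type*} [Fintype X] [Fintype Y] {m n : ℕ}

/-- The numbering of the disjoint union. -/
def index (eX : X ≃ Fin m) (eY : Y ≃ Fin n) : X ⊕ Y ≃ Fin (m + n) :=
  (Equiv.sumCongr eX eY).trans finSumFinEquiv

theorem index_inl (eX : X ≃ Fin m) (eY : Y ≃ Fin n) (x : X) :
    (index eX eY (.inl x) : ℕ) = eX x := by
  simp [index]

theorem index_inr (eX : X ≃ Fin m) (eY : Y ≃ Fin n) (y : Y) :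
    (index eX eY (.inr y) : ℕ) = m + eY y := by
  simp [index]

variable [PartialOrder X] [PartialOrder Y]

/-- The strict order between symbols of positive probability. -/
def suppLt (p : X → Y → ℝ) : X ⊕ Y → X ⊕ Y → Prop
  | .inl x, .inl x' => x < x' ∧ 0 < margX p x ∧ 0 < margX p x'
  | .inr y, .inr y' => y < y' ∧ 0 < margY p y ∧ 0 < margY p y'
  | _, _ => False

theorem monoOnSupport_iff (p : X → Y → ℝ) (F : X ⊕ Y → ℝ) :
    MonoOnSupport p (F ∘ Sum.inl) (F ∘ Sum.inr) ↔ ∀ z z', suppLt p z z' → F z ≤ F z' := by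
  constructor
  · rintro ⟨h1, h2⟩ (x | y) (x' | y') h
    · exact h1 h.2.1 h.2.2 h.1.le
    · exact h.elim
    · exact h.elim
    · exact h2 h.2.1 h.2.2 h.1.le
  · intro h
    refine ⟨fun x hx x' hx' hle => ?_, fun y hy y' hy' hle => ?_⟩
    · rcases hle.eq_or_lt with rfl | hlt
      · exact le_rfl
      · exact h (.inl x) (.inl x') ⟨hlt, hx, hx'⟩
    · rcases hle.eq_or_lt with rfl | hlt
      · exact le_rfl
      · exact h (.inr y) (.inr y') ⟨hlt, hy, hy'⟩

open Classical in
/-- The tables that are computed once. -/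
structure Base (p : X → Y → ℝ) (eX : X ≃ Fin m) (eY : Y ≃ Fin n) (s : State) : Prop where
  fixed : Fixed m n s
  pmf : ∀ x y, s.mem 0 (eX x) (eY y) = p x y
  weight : IsVec (index eX eY) 4 (jointWeight p) s
  kernel : IsMat (index eX eY) 5 (jointKernel p) s
  rel : IsMat (index eX eY) 6 (fun z z' => if suppLt p z z' then 1 else 0) s
  pos : IsMat (index eX eY) 7 (fun c z => if c = z then 1 else 0) s
  neg : ∀ c z, s.mem 7 (m + n + index eX eY c) (index eX eY z) = if c = z then -1 else 0

variable {p : X → Y → ℝ} {eX : X ≃ Fin m} {eY : Y ≃ Fin n} {s : State}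

theorem Base.of_mem (h : Base p eX eY s) {s' : State} (hf : Fixed m n s')
    (hm : ∀ a ∈ [0, 4, 5, 6, 7], s'.mem a = s.mem a) : Base p eX eY s' := by
  obtain ⟨-, h1, h2, h3, h4, h5, h6⟩ := h
  refine ⟨hf, fun x y => ?_, fun z => ?_, fun z z' => ?_, fun z z' => ?_, fun z z' => ?_,
    fun c z => ?_⟩
  · rw [hm 0 (by decide), h1]
  · rw [hm 4 (by decide), h2]
  · rw [hm 5 (by decide), h3]
  · rw [hm 6 (by decide), h4]
  · rw [hm 7 (by decide), h5]
  · rw [hm 7 (by decide), h6]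

theorem Base.setIdx (h : Base p eX eY s) {v : ℕ} (x : ℕ)
    (hv : v ∉ [0, 1, 2, 3, 4, 14, 15, 16, 17, 20, 21, 22, 23]) : Base p eX eY (s.setIdx v x) :=
  h.of_mem (h.fixed.setIdx x hv) fun _ _ => rfl

theorem Base.den (h : Base p eX eY s) (P : Prog)
    (hP : ∀ v ∈ [0, 1, 2, 3, 4, 14, 15, 16, 17], v ∉ P.writes)
    (hP' : ∀ v ∈ [20, 21, 22, 23], v ∉ P.sets) (ha : ∀ a ∈ [0, 4, 5, 6, 7], a ∉ P.arrays) :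
    Base p eX eY (P.den s) :=
  h.of_mem (h.fixed.den P hP hP') fun a h' => P.den_mem s (ha a h')

/-! ### The operator of merged symbols -/

/-- Computes the weights of the classes, their square roots and the normalised kernel. -/
def classProg : Prog :=
  .seq (sum 12 o o 3 2 3 2 (.mul (.cell 9 (iv 23) (iv 21)) (vc 4 (iv 23))))
  (.seq (.loop 13 2 (sqrtTo 13 (iv 13) (vc 12 (iv 13))))
    (sum 15 o o 2 2 2 2 (.div (.mul (.mul (.cell 9 (iv 22) (iv 20)) (.cell 5 (iv 22) (iv 23)))
      (.cell 9 (iv 23) (iv 21))) (.mul (vc 13 (iv 20)) (vc 13 (iv 21))))))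

variable [DecidableEq X] [DecidableEq Y]

theorem den_classProg (hp : IsJointPMF p) (h : Base p eX eY s) {lab : X ⊕ Y → X ⊕ Y}
    (hl : HasLab (index eX eY) lab s) :
    IsVec (index eX eY) 13 (fun c => √(classWeight p lab c)) (classProg.den s) ∧
      IsMat (index eX eY) 15 (classMatrix p lab) (classProg.den s) := by
  obtain ⟨s1, e1, i1, f1, g1⟩ := vecSum_spec h.fixed (index eX eY) 12
    (.mul (.cell 9 (iv 23) (iv 21)) (vc 4 (iv 23))) (by decide)
  have hs1 := h.fixed.of_idx i1
  have g1' : ∀ c, s1.mem 12 0 (index eX eY c) = classWeight p lab c := by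
    intro c
    rw [g1 c]
    simp only [RExp.eval, IExp.eval, State.at_mem, State.at_21, State.at_23, hl _ _, h.weight _,
      classWeight, ite_mul, one_mul, zero_mul]
  obtain ⟨s2, e2, ⟨⟨h2, k2⟩, g2⟩⟩ := den_loop_induct (v := 13) (u := 2)
    (P := sqrtTo 13 (iv 13) (vc 12 (iv 13))) (s := s1) (by decide)
    (fun k s' => (Fixed m n s' ∧ ∀ a', a' ≠ 13 → a' ≠ 14 → s'.mem a' = s1.mem a') ∧
      ∀ c, (index eX eY c : ℕ) < k → s'.mem 13 0 (index eX eY c) = √(classWeight p lab c))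
    ⟨⟨hs1.setIdx _ (by decide), fun _ _ _ => rfl⟩, by simp⟩ (by
    rintro k hk s' ⟨⟨a1, a2⟩, a3⟩ hk'
    rw [hs1.i2] at hk
    obtain ⟨c, hc⟩ := exists_index (index eX eY) hk
    have hev : (vc 12 (iv 13)).eval s' = classWeight p lab c := by
      simp only [RExp.eval, IExp.eval, hk', ← hc]
      rw [a2 12 (by norm_num) (by norm_num), g1']
    obtain ⟨s'', b1, b2, b3, b4⟩ := sqrtTo_spec a1 13 (iv 13) (vc 12 (iv 13)) (by decide)
      (by rw [hev]; exact classWeight_nonneg hp lab c)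
    rw [b1]
    refine ⟨⟨(a1.of_idx b2).setIdx _ (by decide), fun a' h1 h2 => ?_⟩, fun c' hc' => ?_⟩
    · change s''.mem a' = _
      rw [b3 a' h1 h2, a2 a' h1 h2]
    · change s''.mem 13 _ _ = _
      rw [b4 (by norm_num), hev]
      simp only [IExp.eval, hk', ← hc]
      split_ifs with h1
      · rw [index_inj _ h1]
      · exact a3 c' (by omega))
  rw [hs1.i2] at g2
  have hs2 := h2.setIdx (v := 13) 0 (by decide)
  obtain ⟨s3, e3, i3, f3, g3⟩ := matSum_spec hs2 (index eX eY) 15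
    (.div (.mul (.mul (.cell 9 (iv 22) (iv 20)) (.cell 5 (iv 22) (iv 23)))
      (.cell 9 (iv 23) (iv 21))) (.mul (vc 13 (iv 20)) (vc 13 (iv 21)))) (by decide)
  have hden : classProg.den s = s3 := by
    rw [classProg, den_seq, e1, den_seq, e2, e3]
  have hm : ∀ a j, (s2.setIdx 13 0).mem a j = s2.mem a j := fun _ _ => rfl
  rw [hden]
  refine ⟨fun c => ?_, fun c d => ?_⟩
  · rw [f3 13 (by norm_num), hm]
    exact g2 c (index eX eY c).2
  · rw [g3 c d]
    simp only [RExp.eval, IExp.eval, State.at_mem, hm, State.at_20, State.at_21, State.at_22,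
      State.at_23, g2 _ (Fin.is_lt _), k2, f1, ne_eq, Nat.reduceEqDiff, not_false_eq_true, hl _ _,
      h.kernel _ _, classMatrix]

end Joint

end Algo

end MonoCorr


namespace MonoCorr

namespace Algo

open Prog

/-! ### Testing a candidate -/

section Test

/-- Computes the function on symbols that belongs to the vector in array 28. -/
def liftProg : Prog :=
  sum 31 o o 3 2 3 2 (.mul (.cell 9 (iv 21) (iv 23)) (.div (vc 28 (iv 23)) (vc 13 (iv 23))))

/-- Computes means, variances, covariance and the violations of monotonicity of the functions in
array 31. -/
def statProg : Prog :=
  .seq (sum 32 o o 3 3 0 3 (.mul (vc 4 (iv 22)) (vc 31 (iv 22))))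
  (.seq (sum 33 o o 3 3 1 3 (.mul (vc 4 (.add (iv 0) (iv 22))) (vc 31 (.add (iv 0) (iv 22)))))
  (.seq (sum 34 o o 3 3 0 3 (.mul (vc 4 (iv 22)) (.mul (.sub (vc 31 (iv 22)) (sc 32))
    (.sub (vc 31 (iv 22)) (sc 32)))))
  (.seq (sum 35 o o 3 3 1 3 (.mul (vc 4 (.add (iv 0) (iv 22)))
    (.mul (.sub (vc 31 (.add (iv 0) (iv 22))) (sc 33))
    (.sub (vc 31 (.add (iv 0) (iv 22))) (sc 33)))))
  (.seq (sum 36 o o 3 3 0 1 (.mul (.cell 0 (iv 22) (iv 23)) (.mul (.sub (vc 31 (iv 22)) (sc 32))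
    (.sub (vc 31 (.add (iv 0) (iv 23))) (sc 33)))))
  (.seq (fill 37 o o 3 3 2 2 (.and (.rlt .zero (.cell 6 (iv 22) (iv 23)))
    (.rlt (vc 31 (iv 23)) (vc 31 (iv 22)))) .one .zero)
  (.seq (fill 38 o o 3 3 2 2 (.and (.rlt .zero (.cell 6 (iv 22) (iv 23)))
    (.rlt (vc 31 (iv 22)) (vc 31 (iv 23)))) .one .zero)
    (sqrtTo 39 o (.mul (sc 34) (sc 35)))))))))

/-- Whether the candidate improves on the current optimum in array 8. -/
def improves : BExp :=
  .and (.and (bor (.not (.rlt .zero (sc 37))) (.not (.rlt .zero (sc 38))))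
    (.and (.rlt .zero (sc 34)) (.rlt .zero (sc 35)))) (.rlt (sc 8) (.div (sc 36) (sc 39)))

/-- Tests the functions in array 31 and updates the current optimum. -/
def testProg : Prog :=
  .seq statProg (.ite improves (.rset 8 o o (.div (sc 36) (sc 39))) .skip)

variable {X Y : Type*} [Fintype X] [Fintype Y] [PartialOrder X] [PartialOrder Y]

/-- The correlation of the two halves of a function on the disjoint union. -/
noncomputable def score (p : X → Y → ℝ) (F : X ⊕ Y → ℝ) : ℝ :=
  cov p (F ∘ Sum.inl) (F ∘ Sum.inr) / √(varX p (F ∘ Sum.inl) * varY p (F ∘ Sum.inr))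

/-- The candidates that pass the test. -/
def Accept (p : X → Y → ℝ) (F : X ⊕ Y → ℝ) : Prop :=
  (MonoOnSupport p (F ∘ Sum.inl) (F ∘ Sum.inr) ∨
    MonoOnSupport p (-(F ∘ Sum.inl)) (-(F ∘ Sum.inr))) ∧
  0 < varX p (F ∘ Sum.inl) ∧ 0 < varY p (F ∘ Sum.inr)

variable {p : X → Y → ℝ}

theorem score_le_cmc (hp : IsJointPMF p) (hnd : Nondegenerate p) {F : X ⊕ Y → ℝ}
    (hF : Accept p F) : score p F ≤ cmc p := by
  obtain ⟨h1 | h1, h2, h3⟩ := hF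
  · exact cov_div_le_cmc hp hnd h1 h2 h3
  · have := cov_div_le_cmc hp hnd h1 (by rwa [varX_neg]) (by rwa [varY_neg])
    rwa [cov_neg_neg, varX_neg, varY_neg] at this

variable {m n : ℕ} {eX : X ≃ Fin m} {eY : Y ≃ Fin n} {s : State}

-- Arrays 37 and 38 count the violations of increase and of decrease, both over the two orders
-- together. A zero in one of them means that the two halves are monotone with a common sign.
open Classical in
theorem den_statProg (hp : IsJointPMF p) (h : Base p eX eY s) {F : X ⊕ Y → ℝ}
    (hF : IsVec (index eX eY) 31 F s) : ∃ s', statProg.den s = s' ∧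
      s'.mem 34 0 0 = varX p (F ∘ Sum.inl) ∧ s'.mem 35 0 0 = varY p (F ∘ Sum.inr) ∧
      s'.mem 36 0 0 = cov p (F ∘ Sum.inl) (F ∘ Sum.inr) ∧
      s'.mem 37 0 0 = ∑ z, ∑ z', (if suppLt p z z' ∧ F z' < F z then 1 else 0) ∧
      s'.mem 38 0 0 = ∑ z, ∑ z', (if suppLt p z z' ∧ F z < F z' then 1 else 0) ∧
      s'.mem 39 0 0 = √(varX p (F ∘ Sum.inl) * varY p (F ∘ Sum.inr)) := by
  have wX : ∀ x, s.mem 4 0 (eX x) = margX p x := fun x => by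
    rw [← index_inl eX eY]; exact h.weight _
  have wY : ∀ y, s.mem 4 0 (m + eY y) = margY p y := fun y => by
    rw [← index_inr eX eY]; exact h.weight _
  have fX : ∀ x, s.mem 31 0 (eX x) = F (.inl x) := fun x => by
    rw [← index_inl eX eY]; exact hF _
  have fY : ∀ y, s.mem 31 0 (m + eY y) = F (.inr y) := fun y => by
    rw [← index_inr eX eY]; exact hF _
  have hs := h.fixed
  obtain ⟨s1, e1, i1, f1, g1⟩ := scalar_spec hs 32 0 3 (.mul (vc 4 (iv 22)) (vc 31 (iv 22)))
    (by decide) (by decide)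
  have hs1 := hs.of_idx i1
  obtain ⟨s2, e2, i2, f2, g2⟩ := scalar_spec hs1 33 1 3 (.mul (vc 4 (.add (iv 0) (iv 22)))
    (vc 31 (.add (iv 0) (iv 22)))) (by decide) (by decide)
  have hs2 := hs1.of_idx i2
  obtain ⟨s3, e3, i3, f3, g3⟩ := scalar_spec hs2 34 0 3 (.mul (vc 4 (iv 22))
    (.mul (.sub (vc 31 (iv 22)) (sc 32)) (.sub (vc 31 (iv 22)) (sc 32)))) (by decide) (by decide)
  have hs3 := hs2.of_idx i3
  obtain ⟨s4, e4, i4, f4, g4⟩ := scalar_spec hs3 35 1 3 (.mul (vc 4 (.add (iv 0) (iv 22)))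
    (.mul (.sub (vc 31 (.add (iv 0) (iv 22))) (sc 33))
    (.sub (vc 31 (.add (iv 0) (iv 22))) (sc 33)))) (by decide) (by decide)
  have hs4 := hs3.of_idx i4
  obtain ⟨s5, e5, i5, f5, g5⟩ := scalar_spec hs4 36 0 1 (.mul (.cell 0 (iv 22) (iv 23))
    (.mul (.sub (vc 31 (iv 22)) (sc 32)) (.sub (vc 31 (.add (iv 0) (iv 23))) (sc 33))))
    (by decide) (by decide)
  have hs5 := hs4.of_idx i5
  obtain ⟨s6, e6, i6, f6, g6⟩ := fill_spec hs5.clean 37 3 3 2 2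
    (.and (.rlt .zero (.cell 6 (iv 22) (iv 23)))
    (.rlt (vc 31 (iv 23)) (vc 31 (iv 22)))) .one .zero (by decide) (by decide)
  have hs6 := hs5.of_idx i6
  obtain ⟨s7, e7, i7, f7, g7⟩ := fill_spec hs6.clean 38 3 3 2 2
    (.and (.rlt .zero (.cell 6 (iv 22) (iv 23)))
    (.rlt (vc 31 (iv 22)) (vc 31 (iv 23)))) .one .zero (by decide) (by decide)
  have hs7 := hs6.of_idx i7
  have m1 : s1.mem 32 0 0 = mean p fun x _ => F (.inl x) := by
    rw [g1, hs.i0, hs.i3, sum_range_index eX fun k => ∑ l ∈ Finset.range 1, RExp.eval _ _, mean_fst]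
    simp only [Finset.sum_range_one, RExp.eval, IExp.eval, State.at_mem, State.at_22, wX, fX]
  have m2 : s2.mem 33 0 0 = mean p fun _ y => F (.inr y) := by
    rw [g2, hs1.i1, hs1.i3, sum_range_index eY fun k => ∑ l ∈ Finset.range 1, RExp.eval _ _,
      mean_snd]
    simp only [Finset.sum_range_one, RExp.eval, IExp.eval, State.at_mem, State.at_22, Nat.reduceLT,
      State.at_of_lt, hs1.i0, f1, ne_eq, Nat.reduceEqDiff, not_false_eq_true, wY, fY]
  have v1 : s3.mem 34 0 0 = varX p (F ∘ Sum.inl) := by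
    rw [g3, hs2.i0, hs2.i3, sum_range_index eX fun k => ∑ l ∈ Finset.range 1, RExp.eval _ _, varX,
      mean_fst]
    simp only [Finset.sum_range_one, RExp.eval, IExp.eval, State.at_mem, State.at_22,
      f1, f2, ne_eq, Nat.reduceEqDiff, not_false_eq_true, wX, fX, m1, Function.comp, pow_two]
  have v2 : s4.mem 35 0 0 = varY p (F ∘ Sum.inr) := by
    rw [g4, hs3.i1, hs3.i3, sum_range_index eY fun k => ∑ l ∈ Finset.range 1, RExp.eval _ _, varY,
      mean_snd]
    simp only [Finset.sum_range_one, RExp.eval, IExp.eval, State.at_mem, State.at_22, Nat.reduceLT,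
      State.at_of_lt, hs3.i0, f1, f2, f3, ne_eq, Nat.reduceEqDiff, not_false_eq_true, wY, fY, m2,
      Function.comp, pow_two]
  have cv : s5.mem 36 0 0 = cov p (F ∘ Sum.inl) (F ∘ Sum.inr) := by
    rw [g5, hs4.i0, hs4.i1, sum_range_index eX fun k => ∑ l ∈ Finset.range n, RExp.eval _ _, cov,
      mean]
    refine Finset.sum_congr rfl fun x _ => ?_
    rw [sum_range_index eY fun l => RExp.eval (s4.at 0 0 (eX x) l) _]
    simp only [RExp.eval, IExp.eval, State.at_mem, State.at_22, State.at_23, Nat.reduceLT,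
      State.at_of_lt, hs4.i0, f1, f2, f3, f4, ne_eq, Nat.reduceEqDiff, not_false_eq_true, m1, m2,
      fX, fY, h.pmf, Function.comp]
  have hc : ∀ z z', 0 < s.mem 6 (index eX eY z) (index eX eY z') ↔ suppLt p z z' := by
    intro z z'
    rw [h.rel z z']
    simp only
    split_ifs with hz <;> simp [hz]
  have n1 : s6.mem 37 0 0 = ∑ z, ∑ z', (if suppLt p z z' ∧ F z' < F z then 1 else 0) := by
    rw [g6 0 (by rw [hs5.i3]; norm_num) 0 (by rw [hs5.i3]; norm_num), hs5.i2,
      sum_range_index (index eX eY) fun k => ∑ l ∈ Finset.range (m + n), fillTerm _ _ _ _]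
    refine Finset.sum_congr rfl fun z _ => ?_
    rw [sum_range_index (index eX eY) fun l => fillTerm _ _ _ _]
    refine Finset.sum_congr rfl fun z' _ => ?_
    simp only [fillTerm, BExp.Holds, RExp.eval, IExp.eval, State.at_mem, State.at_22, State.at_23,
      f1, f2, f3, f4, f5, ne_eq, Nat.reduceEqDiff, not_false_eq_true, hF _, hc]
  have n2 : s7.mem 38 0 0 = ∑ z, ∑ z', (if suppLt p z z' ∧ F z < F z' then 1 else 0) := by
    rw [g7 0 (by rw [hs6.i3]; norm_num) 0 (by rw [hs6.i3]; norm_num), hs6.i2,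
      sum_range_index (index eX eY) fun k => ∑ l ∈ Finset.range (m + n), fillTerm _ _ _ _]
    refine Finset.sum_congr rfl fun z _ => ?_
    rw [sum_range_index (index eX eY) fun l => fillTerm _ _ _ _]
    refine Finset.sum_congr rfl fun z' _ => ?_
    simp only [fillTerm, BExp.Holds, RExp.eval, IExp.eval, State.at_mem, State.at_22, State.at_23,
      f1, f2, f3, f4, f5, f6, ne_eq, Nat.reduceEqDiff, not_false_eq_true, hF _, hc]
  have hev : (RExp.mul (sc 34) (sc 35)).eval s7 =
      varX p (F ∘ Sum.inl) * varY p (F ∘ Sum.inr) := by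
    simp only [RExp.eval, IExp.eval, f7, f6, f5, f4, ne_eq, Nat.reduceEqDiff, not_false_eq_true,
      v1, v2]
  obtain ⟨s8, e8, i8, f8, g8⟩ := sqrtTo_spec hs7 39 o (.mul (sc 34) (sc 35)) (by decide) (by
    rw [hev]; exact mul_nonneg (varX_nonneg hp _) (varY_nonneg hp _))
  refine ⟨s8, ?_, ?_, ?_, ?_, ?_, ?_, ?_⟩
  · rw [statProg, den_seq, e1, den_seq, e2, den_seq, e3, den_seq, e4, den_seq, e5, den_seq, e6,
      den_seq, e7, e8]
  · simp only [f8, f7, f6, f5, f4, ne_eq, Nat.reduceEqDiff, not_false_eq_true, v1]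
  · simp only [f8, f7, f6, f5, ne_eq, Nat.reduceEqDiff, not_false_eq_true, v2]
  · simp only [f8, f7, f6, ne_eq, Nat.reduceEqDiff, not_false_eq_true, cv]
  · simp only [f8, f7, ne_eq, Nat.reduceEqDiff, not_false_eq_true, n1]
  · simp only [f8, ne_eq, Nat.reduceEqDiff, not_false_eq_true, n2]
  · rw [g8 (by norm_num), hev]
    rfl

theorem not_sum_pos_iff {Z : Type*} [Fintype Z] (P : Z → Z → Prop) [∀ z z', Decidable (P z z')] :
    ¬ (0 : ℝ) < ∑ z, ∑ z', (if P z z' then 1 else 0) ↔ ∀ z z', ¬ P z z' := by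
  have h0 : ∀ z z', (0 : ℝ) ≤ if P z z' then 1 else 0 := fun z z' => by split_ifs <;> norm_num
  rw [not_lt]
  constructor
  · intro h z z' hP
    have h1 := (Finset.sum_eq_zero_iff_of_nonneg fun z _ => Finset.sum_nonneg fun z' _ =>
      h0 z z').1 (le_antisymm h (Finset.sum_nonneg fun z _ => Finset.sum_nonneg fun z' _ =>
        h0 z z')) z (Finset.mem_univ z)
    have h2 := (Finset.sum_eq_zero_iff_of_nonneg fun z' _ => h0 z z').1 h1 z' (Finset.mem_univ z')
    rw [if_pos hP] at h2
    exact one_ne_zero h2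
  · intro h
    exact (Finset.sum_eq_zero fun z _ => Finset.sum_eq_zero fun z' _ => if_neg (h z z')).le

open Classical in
theorem den_testProg (hp : IsJointPMF p) (h : Base p eX eY s) {F : X ⊕ Y → ℝ}
    (hF : IsVec (index eX eY) 31 F s) : (testProg.den s).mem 8 0 0 =
      if Accept p F ∧ s.mem 8 0 0 < score p F then score p F else s.mem 8 0 0 := by
  obtain ⟨s', h0, h1, h2, h3, h4, h5, h6⟩ := den_statProg hp h hF
  have h8 : s'.mem 8 = s.mem 8 := by rw [← h0, den_mem _ _ (by decide)]
  have hsc : (RExp.div (sc 36) (sc 39)).eval s' = score p F := by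
    simp only [RExp.eval, IExp.eval, h3, h6, score]
  have hm1 : (∀ z z', ¬ (suppLt p z z' ∧ F z' < F z)) ↔
      MonoOnSupport p (F ∘ Sum.inl) (F ∘ Sum.inr) := by
    rw [monoOnSupport_iff]
    simp only [not_and, not_lt]
  have hm2 : (∀ z z', ¬ (suppLt p z z' ∧ F z < F z')) ↔
      MonoOnSupport p (-(F ∘ Sum.inl)) (-(F ∘ Sum.inr)) := by
    have : MonoOnSupport p (-(F ∘ Sum.inl)) (-(F ∘ Sum.inr)) ↔
        MonoOnSupport p ((-F) ∘ Sum.inl) ((-F) ∘ Sum.inr) := Iff.rfl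
    rw [this, monoOnSupport_iff]
    simp only [not_and, not_lt, Pi.neg_apply, neg_le_neg_iff]
  have hcond : improves.Holds s' ↔ Accept p F ∧ s.mem 8 0 0 < score p F := by
    have n1 := (not_sum_pos_iff fun z z' => suppLt p z z' ∧ F z' < F z).trans hm1
    have n2 := (not_sum_pos_iff fun z z' => suppLt p z z' ∧ F z < F z').trans hm2
    simp only [improves, BExp.Holds]
    rw [hsc]
    simp only [RExp.eval, IExp.eval, h1, h2, h4, h5, h8, Accept]
    rw [← n1, ← n2]
    tauto
  rw [testProg, den_seq, h0, den]
  split_ifs with c1 c2 c2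
  · simp only [den, State.setMem, IExp.eval, hsc]
    simp
  · exact absurd (hcond.1 c1) c2
  · exact absurd (hcond.2 c2) c1
  · rw [den, h8]

variable [DecidableEq X] [DecidableEq Y]

theorem den_liftProg (hs : Fixed m n s) {lab : X ⊕ Y → X ⊕ Y}
    (hl : HasLab (index eX eY) lab s) (hr : IsVec (index eX eY) 13 (fun c => √(classWeight p lab c)) s)
    {v : EuclideanSpace ℝ (X ⊕ Y)} (hv : IsVec (index eX eY) 28 (fun z => v z) s) :
    IsVec (index eX eY) 31 (classFun p lab v) (liftProg.den s) := by
  obtain ⟨s1, e1, i1, f1, g1⟩ := vecSum_spec hs (index eX eY) 31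
    (.mul (.cell 9 (iv 21) (iv 23)) (.div (vc 28 (iv 23)) (vc 13 (iv 23)))) (by decide)
  rw [liftProg, e1]
  intro z
  rw [g1 z]
  simp only [RExp.eval, IExp.eval, State.at_mem, State.at_21, State.at_23, hl _ _, hr _, hv _]
  exact sum_lab lab (fun c => v c / √(classWeight p lab c)) z

end Test

end Algo

end MonoCorr


namespace MonoCorr

theorem kthRoot_congr {c c' : ℕ → ℝ} {d : ℕ} (h : ∀ i ≤ d, c i = c' i) (k : ℕ) :
    kthRoot c d k = kthRoot c' d k := by
  have : (∑ i ∈ Finset.range (d + 1), Polynomial.C (c i) * Polynomial.X ^ i :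
      Polynomial ℝ) = ∑ i ∈ Finset.range (d + 1), Polynomial.C (c' i) * Polynomial.X ^ i :=
    Finset.sum_congr rfl fun i hi => by rw [h i (by simpa [Nat.lt_succ_iff] using hi)]
  rw [kthRoot, this, kthRoot]

namespace Algo

open Prog

/-! ### The candidates -/

section Candidates

variable {E : Type*} [NormedAddCommGroup E] [InnerProductSpace ℝ E] (T : E →ₗ[ℝ] E) (h : E)

/-- The roots of the annihilating polynomial. -/
noncomputable def krylovRoot (N k : ℕ) : ℝ :=
  kthRoot (lanczosPoly T h (N + 1)).coeff (N + 1) k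

/-- The vector `h`, deflated at all roots different from root `k₀`, if there is one. -/
noncomputable def trialVec (N k₀ : ℕ) : E :=
  deflate T (if k₀ < N + 1 then ((List.range (N + 1)).map (krylovRoot T h N)).filter
    fun μ => μ ≠ krylovRoot T h N k₀ else []) h

variable {T} {h}

/-- The eigenvalue `σ` is one of the roots because `h` is not orthogonal to the eigenvector `b`.
Deflating at all the other roots gives a nonzero vector of the eigenspace, for that index `k`. -/
theorem exists_trialVec [FiniteDimensional ℝ E] (hT : T.IsSymmetric) {N : ℕ}
    (hN : Module.finrank ℝ E ≤ N) {b : E} {σ : ℝ} (hb : T b = σ • b) (hbh : inner ℝ b h ≠ 0) :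
    ∃ k < N + 1, T (trialVec T h N k) = σ • trialVec T h N k ∧ trialVec T h N k ≠ 0 := by
  obtain ⟨hq1, hq2, -⟩ := lanczosPoly_monic T h N
  have hq : Polynomial.aeval T (lanczosPoly T h (N + 1)) h = 0 := by
    rw [aeval_lanczosPoly, lanczos_finrank hT hN, map_zero]
  have hroot : ∀ ν, (lanczosPoly T h (N + 1)).eval ν = 0 → ∃ k < N + 1, krylovRoot T h N k = ν :=
    fun ν hν => exists_kthRoot hq1.ne_zero hq2.le (fun _ _ => rfl) hν
  obtain ⟨k, hk, hkσ⟩ := hroot σ (eval_eq_zero_of_aeval hT hb hq hbh)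
  refine ⟨k, hk, ?_, ?_⟩
  · rw [trialVec, if_pos hk, hkσ]
    refine deflate_eigen hT hq fun ν hν hne => ?_
    obtain ⟨j, hj, rfl⟩ := hroot ν hν
    simp only [List.mem_filter, List.mem_map, List.mem_range, decide_eq_true_eq]
    exact ⟨⟨j, hj, rfl⟩, hne⟩
  · rw [trialVec, if_pos hk, hkσ]
    refine deflate_ne_zero hT hb hbh fun μ hμ => ?_
    simpa using (List.mem_filter.1 hμ).2

variable {X Y : Type*} [Fintype X] [Fintype Y] [PartialOrder X] [PartialOrder Y] {p : X → Y → ℝ}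
  {κ : Type*} [Fintype κ] [DecidableEq κ]

theorem exists_trial (hp : IsJointPMF p) (hnd : Nondegenerate p) {f : X → ℝ} {g : Y → ℝ}
    (ht : (monoForm hp).Tight (cmc p) f g) {lab : X ⊕ Y → κ} (hl : IsMerging p f g lab) {N : ℕ}
    (hN : Fintype.card κ ≤ N) :
    ∃ (c d : κ) (s t : ℝ), (s = 1 ∨ s = -1) ∧ (t = 1 ∨ t = -1) ∧ ∃ u : EuclideanSpace ℝ κ,
      (∀ c', u c' = (if c = c' then s else 0) + if d = c' then t else 0) ∧ ∃ k < N + 2,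
      Accept p (classFun p lab (trialVec (classOp p lab) u N k)) ∧
      score p (classFun p lab (trialVec (classOp p lab) u N k)) = cmc p := by
  rcases lt_or_ge 0 (cmc p) with hσ | hσ
  · have he := hl.eigen ht
    have h0 := hl.vec_ne_zero ht
    set b := classVec p lab (starFun p f g)
    -- Any nonzero coordinate of the eigenvector gives a usable unit vector. It is taken twice
    -- because start vectors are sums of two rows of the table.
    obtain ⟨c, hc⟩ : ∃ c, b c ≠ 0 := by
      by_contra! h
      exact h0 (by ext c; simpa using h c)
    refine ⟨c, c, 1, 1, .inl rfl, .inl rfl, WithLp.toLp 2 fun c' => (if c = c' then 1 else 0) +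
      if c = c' then 1 else 0, fun _ => rfl, ?_⟩
    set u : EuclideanSpace ℝ κ := WithLp.toLp 2 fun c' => (if c = c' then 1 else 0) +
      if c = c' then 1 else 0
    have hbu : inner ℝ b u ≠ 0 := by
      have : inner ℝ b u = b c + b c := by
        rw [PiLp.inner_apply]
        simp [u, add_mul, Finset.sum_add_distrib]
      rw [this, ← two_mul]
      exact mul_ne_zero two_ne_zero hc
    obtain ⟨k, hk, h1, h2⟩ := exists_trialVec (classOp_isSymmetric lab) (N := N) (by simpa using hN)
      he hbu
    obtain ⟨k1, k2, k3, k4⟩ := hl.of_eigen ht hσ h1 h2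
    exact ⟨k, by omega, ⟨k1, k2, k3⟩, k4⟩
  · obtain ⟨c, d, s, t, hs, ht', h⟩ := hl.of_nonpos hnd ht hσ
    obtain ⟨h1, h2, h3, h4⟩ := h (WithLp.toLp 2 fun c' => (if c = c' then s else 0) +
      if d = c' then t else 0) fun _ => rfl
    -- The index `N + 1` lies outside the range of roots and requests no deflation, so the signed
    -- indicators are tested unchanged.
    refine ⟨c, d, s, t, hs, ht', WithLp.toLp 2 fun c' => (if c = c' then s else 0) +
      if d = c' then t else 0, fun _ => rfl, N + 1, by omega, ?_⟩
    have : ∀ u, trialVec (classOp p lab) u N (N + 1) = u := fun u => by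
      simp [trialVec, deflate]
    rw [this]
    exact ⟨⟨.inl h1, h2, h3⟩, h4⟩

end Candidates

/-! ### The search -/

section Search

theorem den_loop_safe {v u : ℕ} {P : Prog} (hv : v ∉ P.writes) {I : State → Prop}
    (hI : ∀ s x, I s → I (s.setIdx v x)) (hP : ∀ s, I s → I (P.den s)) {s : State} (hs : I s) :
    I ((loop v u P).den s) := by
  obtain ⟨s', h1, h2⟩ := den_loop_induct (s := s) (u := u) hv (fun _ s => I s) (hI _ _ hs)
    fun k _ s' hs' _ => hI _ _ (hP _ hs')
  rw [h1]
  exact hI _ _ h2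

/-- A goal hit in one single round and preserved by all later rounds holds at the end. Every search
loop is analysed by this principle. -/
theorem den_loop_reach {v u : ℕ} {P : Prog} (hv : v ∉ P.writes) {I G : State → Prop}
    (hI : ∀ s x, I s → I (s.setIdx v x)) (hG : ∀ s x, G s → G (s.setIdx v x))
    (hP : ∀ s, I s → I (P.den s)) (hGP : ∀ s, I s → G s → G (P.den s)) {s : State} {k₀ : ℕ}
    (hk₀ : k₀ < s.idx u) (hit : ∀ s, I s → s.idx v = k₀ → G (P.den s)) (hs : I s) :
    G ((loop v u P).den s) := by
  obtain ⟨s', h1, -, h2⟩ := den_loop_induct (s := s) (u := u) hv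
    (fun k s => I s ∧ (k₀ < k → G s)) ⟨hI _ _ hs, by simp⟩ (by
    rintro k - s' ⟨h1, h2⟩ hk
    refine ⟨hI _ _ (hP _ h1), fun h => hG _ _ ?_⟩
    rcases Nat.lt_succ_iff_lt_or_eq.1 h with h | h
    · exact hGP _ h1 (h2 h)
    · exact hit _ h1 (by rw [hk, h]))
  rw [h1]
  exact hG _ _ (h2 hk₀)

/-- Computes one candidate and tests it. -/
def trialProg : Prog := .seq deflateProg (.seq liftProg testProg)

/-- Prepares the start vector. -/
def startProg : Prog :=
  sum 16 o o 3 2 3 3 (.add (.cell 7 (iv 10) (iv 21)) (.cell 7 (iv 11) (iv 21)))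

/-- Tests all candidates that belong to one start vector. -/
def pairProg : Prog :=
  .seq startProg (.seq lanczosProg (.seq rootsProg (.loop 12 14 trialProg)))

/-- Tests all candidates that belong to the selection with number `idx 6`. -/
def roundProg : Prog :=
  .seq labels (.seq classProg (.loop 10 15 (.loop 11 15 pairProg)))

variable {X Y : Type*} [Fintype X] [Fintype Y] [PartialOrder X] [PartialOrder Y]
  {m n : ℕ} {p : X → Y → ℝ} {eX : X ≃ Fin m} {eY : Y ≃ Fin n} {s : State}

/-- The tables are right and the current optimum is at most the true one. -/
def Inv (p : X → Y → ℝ) (eX : X ≃ Fin m) (eY : Y ≃ Fin n) (s : State) : Prop :=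
  Base p eX eY s ∧ s.mem 8 0 0 ≤ cmc p

theorem Inv.setIdx (h : Inv p eX eY s) {v : ℕ} (x : ℕ)
    (hv : v ∉ [0, 1, 2, 3, 4, 14, 15, 16, 17, 20, 21, 22, 23]) : Inv p eX eY (s.setIdx v x) :=
  ⟨h.1.setIdx x hv, h.2⟩

/-- The program keeps the invariant and does not decrease the current optimum. -/
def Safe (p : X → Y → ℝ) (eX : X ≃ Fin m) (eY : Y ≃ Fin n) (P : Prog) : Prop :=
  ∀ s, Inv p eX eY s → Inv p eX eY (P.den s) ∧ s.mem 8 0 0 ≤ (P.den s).mem 8 0 0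

theorem safe_of_frame {P : Prog} (hP : ∀ v ∈ [0, 1, 2, 3, 4, 14, 15, 16, 17], v ∉ P.writes)
    (hP' : ∀ v ∈ [20, 21, 22, 23], v ∉ P.sets) (ha : ∀ a ∈ [0, 4, 5, 6, 7], a ∉ P.arrays)
    (h8 : 8 ∉ P.arrays) : Safe p eX eY P := by
  intro s hs
  have : (P.den s).mem 8 0 0 = s.mem 8 0 0 := by rw [P.den_mem s h8]
  exact ⟨⟨hs.1.den P hP hP' ha, by rw [this]; exact hs.2⟩, this.ge⟩

theorem Safe.seq {P Q : Prog} (hP : Safe p eX eY P) (hQ : Safe p eX eY Q) :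
    Safe p eX eY (.seq P Q) := by
  intro s hs
  obtain ⟨h1, h2⟩ := hP s hs
  obtain ⟨h3, h4⟩ := hQ _ h1
  exact ⟨h3, h2.trans h4⟩

theorem Safe.loop {P : Prog} (hP : Safe p eX eY P) {v u : ℕ} (hv : v ∉ P.writes)
    (hv' : v ∉ [0, 1, 2, 3, 4, 14, 15, 16, 17, 20, 21, 22, 23]) :
    Safe p eX eY (.loop v u P) := by
  intro s hs
  exact den_loop_safe (I := fun s' => Inv p eX eY s' ∧ s.mem 8 0 0 ≤ s'.mem 8 0 0) hv
    (fun s' x h => ⟨h.1.setIdx x hv', h.2⟩)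
    (fun s' h => ⟨(hP s' h.1).1, h.2.trans (hP s' h.1).2⟩) ⟨hs, le_rfl⟩

theorem safe_testProg (hp : IsJointPMF p) (hnd : Nondegenerate p) : Safe p eX eY testProg := by
  classical
  intro s hs
  -- Whatever array 31 contains, it is some function on the symbols. The running maximum is
  -- therefore never too large, even for candidates computed from meaningless roots.
  have h := den_testProg hp hs.1 (F := fun z => s.mem 31 0 (index eX eY z)) fun _ => rfl
  refine ⟨⟨hs.1.den _ (by decide) (by decide) (by decide), ?_⟩, ?_⟩
  · rw [h]
    split_ifs with hc
    · exact score_le_cmc hp hnd hc.1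
    · exact hs.2
  · rw [h]
    split_ifs with hc
    · exact hc.2.le
    · exact le_rfl

theorem safe_trialProg (hp : IsJointPMF p) (hnd : Nondegenerate p) : Safe p eX eY trialProg :=
  (safe_of_frame (by decide) (by decide) (by decide) (by decide)).seq
    ((safe_of_frame (by decide) (by decide) (by decide) (by decide)).seq (safe_testProg hp hnd))

theorem safe_pairProg (hp : IsJointPMF p) (hnd : Nondegenerate p) : Safe p eX eY pairProg :=
  (safe_of_frame (by decide) (by decide) (by decide) (by decide)).seq
    ((safe_of_frame (by decide) (by decide) (by decide) (by decide)).seq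
      ((safe_of_frame (by decide) (by decide) (by decide) (by decide)).seq
        ((safe_trialProg hp hnd).loop (by decide) (by decide))))

theorem safe_roundProg (hp : IsJointPMF p) (hnd : Nondegenerate p) : Safe p eX eY roundProg :=
  (safe_of_frame (by decide) (by decide) (by decide) (by decide)).seq
    ((safe_of_frame (by decide) (by decide) (by decide) (by decide)).seq
      (((safe_pairProg hp hnd).loop (by decide) (by decide)).loop (by decide) (by decide)))

variable [DecidableEq X] [DecidableEq Y]

/-- The tables that belong to a labelling are right. -/
structure Ready (p : X → Y → ℝ) (eX : X ≃ Fin m) (eY : Y ≃ Fin n) (lab : X ⊕ Y → X ⊕ Y)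
    (s : State) : Prop where
  inv : Inv p eX eY s
  hasLab : HasLab (index eX eY) lab s
  root : IsVec (index eX eY) 13 (fun c => √(classWeight p lab c)) s
  mat : IsMat (index eX eY) 15 (classMatrix p lab) s

variable {lab : X ⊕ Y → X ⊕ Y}

theorem Ready.of_mem (h : Ready p eX eY lab s) {s' : State} (hi : Inv p eX eY s')
    (hm : ∀ a ∈ [9, 13, 15], s'.mem a = s.mem a) : Ready p eX eY lab s' := by
  obtain ⟨-, h1, h2, h3⟩ := h
  refine ⟨hi, fun z z' => ?_, fun z => ?_, fun z z' => ?_⟩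
  · rw [hm 9 (by decide), h1 _ _]
  · rw [hm 13 (by decide), h2 _]
  · rw [hm 15 (by decide), h3 _ _]

theorem Ready.setIdx (h : Ready p eX eY lab s) {v : ℕ} (x : ℕ)
    (hv : v ∉ [0, 1, 2, 3, 4, 14, 15, 16, 17, 20, 21, 22, 23]) :
    Ready p eX eY lab (s.setIdx v x) :=
  h.of_mem (h.inv.setIdx x hv) fun _ _ => rfl

theorem Ready.den (h : Ready p eX eY lab s) {P : Prog} (hP : Safe p eX eY P)
    (ha : ∀ a ∈ [9, 13, 15], a ∉ P.arrays) : Ready p eX eY lab (P.den s) :=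
  h.of_mem (hP s h.inv).1 fun a h' => P.den_mem s (ha a h')

theorem reach_trialProg (hp : IsJointPMF p) (h : Ready p eX eY lab s)
    {u : EuclideanSpace ℝ (X ⊕ Y)} (hu : IsVec (index eX eY) 16 (fun z => u z) s)
    (hr : ∀ k < m + n + 1, s.mem 27 0 k = krylovRoot (classOp p lab) u (m + n) k)
    (ha : Accept p (classFun p lab (trialVec (classOp p lab) u (m + n) (s.idx 12))))
    (hc : score p (classFun p lab (trialVec (classOp p lab) u (m + n) (s.idx 12))) = cmc p) :
    cmc p ≤ (trialProg.den s).mem 8 0 0 := by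
  classical
  have h1 := den_deflateProg (classOp_apply lab) h.inv.1.fixed h.mat hu
  have hv : deflate (classOp p lab) (if s.idx 12 < m + n + 1 then
      ((List.range (m + n + 1)).map fun k => s.mem 27 0 k).filter
        fun μ => μ ≠ s.mem 27 0 (s.idx 12) else []) u =
      trialVec (classOp p lab) u (m + n) (s.idx 12) := by
    rw [trialVec]
    split_ifs with hk
    · rw [hr _ hk]
      congr 2
      exact List.map_congr_left fun k hk => hr k (List.mem_range.1 hk)
    · rfl
  rw [hv] at h1
  have r1 : Ready p eX eY lab (deflateProg.den s) := h.den
    (safe_of_frame (by decide) (by decide) (by decide) (by decide)) (by decide)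
  have h2 := den_liftProg r1.inv.1.fixed r1.hasLab r1.root h1
  have r2 : Ready p eX eY lab (liftProg.den (deflateProg.den s)) := r1.den
    (safe_of_frame (by decide) (by decide) (by decide) (by decide)) (by decide)
  rw [trialProg, den_seq, den_seq, den_testProg hp r2.inv.1 h2, hc]
  split_ifs with h3
  · exact le_rfl
  · by_contra h4
    exact h3 ⟨ha, not_le.1 h4⟩

theorem den_startProg (hs : Fixed m n s) {e : X ⊕ Y ≃ Fin (m + n)} :
    IsVec e 16 (fun z => s.mem 7 (s.idx 10) (e z) + s.mem 7 (s.idx 11) (e z))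
      (startProg.den s) := by
  obtain ⟨s1, e1, i1, f1, g1⟩ := vec_spec hs e 16
    (.add (.cell 7 (iv 10) (iv 21)) (.cell 7 (iv 11) (iv 21))) (by decide)
  rw [startProg, e1]
  intro z
  rw [g1 z]
  simp only [RExp.eval, IExp.eval, State.at_mem, State.at_21, Nat.reduceLT, State.at_of_lt]

theorem reach_pairProg (hp : IsJointPMF p) (hnd : Nondegenerate p) (h : Ready p eX eY lab s)
    {u : EuclideanSpace ℝ (X ⊕ Y)} (hu : ∀ z, u z = s.mem 7 (s.idx 10) (index eX eY z) +
      s.mem 7 (s.idx 11) (index eX eY z)) {k : ℕ} (hk : k < m + n + 2)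
    (ha : Accept p (classFun p lab (trialVec (classOp p lab) u (m + n) k)))
    (hc : score p (classFun p lab (trialVec (classOp p lab) u (m + n) k)) = cmc p) :
    cmc p ≤ (pairProg.den s).mem 8 0 0 := by
  have h1 : IsVec (index eX eY) 16 (fun z => u z) (startProg.den s) := fun z => by
    rw [den_startProg h.inv.1.fixed z]
    exact (hu z).symm
  have r1 : Ready p eX eY lab (startProg.den s) := h.den
    (safe_of_frame (by decide) (by decide) (by decide) (by decide)) (by decide)
  set s1 := startProg.den s
  have h2 := den_lanczosProg (classOp_apply lab) r1.inv.1.fixed r1.mat h1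
  have r2 : Ready p eX eY lab (lanczosProg.den s1) := r1.den
    (safe_of_frame (by decide) (by decide) (by decide) (by decide)) (by decide)
  have u2 : IsVec (index eX eY) 16 (fun z => u z) (lanczosProg.den s1) := fun z => by
    rw [den_mem _ _ (by decide), h1 z]
  set s2 := lanczosProg.den s1
  have h3 := den_rootsProg r2.inv.1.fixed
  have r3 : Ready p eX eY lab (rootsProg.den s2) := r2.den
    (safe_of_frame (by decide) (by decide) (by decide) (by decide)) (by decide)
  have u3 : IsVec (index eX eY) 16 (fun z => u z) (rootsProg.den s2) := fun z => by
    rw [den_mem _ _ (by decide), u2 z]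
  have k3 : ∀ k < m + n + 1, (rootsProg.den s2).mem 27 0 k =
      krylovRoot (classOp p lab) u (m + n) k := fun k hk => by
    rw [h3 k hk, krylovRoot]
    exact kthRoot_congr (fun i hi => h2 i (by omega)) k
  rw [pairProg, den_seq, den_seq, den_seq]
  set s3 := rootsProg.den s2
  refine den_loop_reach (by decide) (I := fun s => Ready p eX eY lab s ∧
    IsVec (index eX eY) 16 (fun z => u z) s ∧ ∀ k < m + n + 1, s.mem 27 0 k =
      krylovRoot (classOp p lab) u (m + n) k) (G := fun s => cmc p ≤ s.mem 8 0 0) ?_ ?_ ?_ ?_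
    (k₀ := k) (by rw [r3.inv.1.fixed.i14]; exact hk) ?_ ⟨r3, u3, k3⟩
  · exact fun s x hs => ⟨hs.1.setIdx x (by decide), hs.2⟩
  · exact fun s x hs => hs
  · refine fun s hs => ⟨hs.1.den (safe_trialProg hp hnd) (by decide), fun z => ?_, fun k hk => ?_⟩
    · rw [den_mem _ _ (by decide), hs.2.1 z]
    · rw [den_mem _ _ (by decide), hs.2.2 k hk]
  · exact fun s hs hG => hG.trans (safe_trialProg hp hnd s hs.1.inv).2
  · rintro s ⟨a1, a2, a3⟩ rfl
    exact reach_trialProg hp a1 a2 a3 ha hc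

/-- Signed unit vectors are rows of array 7. -/
theorem exists_row (c : X ⊕ Y) (eX : X ≃ Fin m) (eY : Y ≃ Fin n) {t : ℝ} (ht : t = 1 ∨ t = -1) :
    ∃ i < 2 * (m + n), ∀ s, Base p eX eY s → ∀ z,
      s.mem 7 i (index eX eY z) = if c = z then t else 0 := by
  rcases ht with rfl | rfl
  · exact ⟨index eX eY c, by omega, fun s hs z => by rw [hs.pos c z]; by_cases h : c = z <;> simp [h]⟩
  · exact ⟨m + n + index eX eY c, by omega, fun s hs z => by rw [hs.neg c z]; by_cases h : c = z <;> simp [h]⟩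

/-- One good pair of rows and one good root index are enough, since the other rounds cannot lower
the running maximum. -/
theorem reach_roundProg (hp : IsJointPMF p) (hnd : Nondegenerate p) {f : X → ℝ} {g : Y → ℝ}
    (ht : (monoForm hp).Tight (cmc p) f g) (hl : IsMerging p f g lab) (h : Inv p eX eY s)
    (hlab : HasLab (index eX eY) lab (labels.den s)) : cmc p ≤ (roundProg.den s).mem 8 0 0 := by
  have hcard : Fintype.card (X ⊕ Y) ≤ m + n := by
    rw [Fintype.card_congr (index eX eY), Fintype.card_fin]
  obtain ⟨c, d, σ, τ, hσ, hτ, u, hu, k, hk, ha, hc⟩ := exists_trial hp hnd ht hl hcard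
  obtain ⟨i, hi, hi'⟩ := exists_row (p := p) c eX eY hσ
  obtain ⟨j, hj, hj'⟩ := exists_row (p := p) d eX eY hτ
  have s1 : Inv p eX eY (labels.den s) :=
    (safe_of_frame (by decide) (by decide) (by decide) (by decide) s h).1
  obtain ⟨c1, c2⟩ := den_classProg hp s1.1 hlab
  have r : Ready p eX eY lab (classProg.den (labels.den s)) := by
    refine ⟨(safe_of_frame (by decide) (by decide) (by decide) (by decide) _ s1).1, ?_, c1, c2⟩
    intro z z'
    rw [den_mem _ _ (by decide), hlab _ _]
  rw [roundProg, den_seq, den_seq]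
  have hsafe := safe_pairProg (eX := eX) (eY := eY) hp hnd
  have hsafe' : Safe p eX eY (.loop 11 15 pairProg) := hsafe.loop (by decide) (by decide)
  refine den_loop_reach (by decide) (I := Ready p eX eY lab) (G := fun s => cmc p ≤ s.mem 8 0 0)
    (fun s x hs => hs.setIdx x (by decide)) (fun s x hs => hs)
    (fun s hs => hs.den hsafe' (by decide)) (fun s hs hG => hG.trans (hsafe' s hs.inv).2)
    (k₀ := i) (by rw [r.inv.1.fixed.i15]; exact hi) ?_ r
  intro s hs hsi
  refine den_loop_reach (by decide) (I := fun s => Ready p eX eY lab s ∧ s.idx 10 = i)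
    (G := fun s => cmc p ≤ s.mem 8 0 0)
    (fun s x hs => ⟨hs.1.setIdx x (by decide), by rw [State.setIdx_ne _ _ (by norm_num), hs.2]⟩)
    (fun s x hs => hs)
    (fun s hs => ⟨hs.1.den hsafe (by decide), by rw [den_idx _ _ (by decide), hs.2]⟩)
    (fun s hs hG => hG.trans (hsafe s hs.1.inv).2)
    (k₀ := j) (by rw [hs.inv.1.fixed.i15]; exact hj) ?_ ⟨hs, hsi⟩
  rintro s ⟨hs, h10⟩ h11
  refine reach_pairProg hp hnd hs (u := u) (fun z => ?_) hk ha hc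
  rw [h10, h11, hi' s hs.inv.1, hj' s hs.inv.1, hu]

end Search

end Algo

end MonoCorr


namespace MonoCorr

namespace Algo

open Prog

/-! ### Preparation of the tables -/

section Setup

theorem offsetFill_spec {s : State} (hs : s.Clean) (a : ℕ) (r c : IExp) (n₁ n₂ n₃ n₄ : ℕ) (b : BExp)
    (e₁ e₂ : RExp) (ha : a ∉ b.arrays ++ e₁.arrays ++ e₂.arrays)
    (hn : ∀ v ∈ r.vars ++ c.vars ++ [n₁, n₂, n₃, n₄], v < 20) :
    ∃ s', (fill a r c n₁ n₂ n₃ n₄ b e₁ e₂).den s = s' ∧ s'.idx = s.idx ∧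
      (∀ a' ≠ a, s'.mem a' = s.mem a') ∧
      (∀ i < s.idx n₁, ∀ j < s.idx n₂, s'.mem a (r.eval s + i) (c.eval s + j) =
        ∑ k ∈ Finset.range (s.idx n₃), ∑ l ∈ Finset.range (s.idx n₄),
          fillTerm b e₁ e₂ (s.at i j k l)) ∧
      ∀ i j, ¬ ((r.eval s ≤ i ∧ i < r.eval s + s.idx n₁) ∧
        (c.eval s ≤ j ∧ j < c.eval s + s.idx n₂)) → s'.mem a i j = s.mem a i j := by
  refine ⟨_, den_fill ha (fun v hv => .inl (hn v hv)) hs, rfl, ?_, ?_, ?_⟩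
  · intro a' ha'
    funext i j
    simp [ha']
  · intro i hi j hj
    simp [hi, hj]
  · intro i j h
    simp [h]

/-- Sets the index variables that stay fixed. -/
def indexProg : Prog :=
  .seq (.iset 2 (.add (iv 0) (iv 1))) (.seq (.iset 3 (.lit 1)) (.seq (.iset 4 (.add (iv 2) (.lit 1)))
  (.seq (.iset 14 (.add (iv 4) (.lit 1))) (.seq (.iset 15 (.add (iv 2) (iv 2)))
  (.seq (.iset 16 (.lit 2)) (.iset 17 (.lit 3)))))))

/-- Computes the marginals. -/
def weightProg : Prog :=
  .seq (fill 4 o o 3 0 3 1 tt (.cell 0 (iv 21) (iv 23)) .zero)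
    (fill 4 o (iv 0) 3 1 0 3 tt (.cell 0 (iv 22) (iv 21)) .zero)

/-- Computes the symmetrised centred kernel. -/
def kernelProg : Prog :=
  .seq (fill 5 o (iv 0) 0 1 3 3 tt (.sub (.cell 0 (iv 20) (iv 21))
    (.mul (vc 4 (iv 20)) (vc 4 (.add (iv 0) (iv 21))))) .zero)
    (fill 5 (iv 0) o 1 0 3 3 tt (.sub (.cell 0 (iv 21) (iv 20))
    (.mul (vc 4 (iv 21)) (vc 4 (.add (iv 0) (iv 20))))) .zero)

/-- Computes the table of the strict orders on the support. -/
def relProg : Prog :=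
  .seq (fill 6 o o 0 0 3 3 (.and (.not (ieq (iv 20) (iv 21))) (.and
    (.rlt .zero (.cell 1 (iv 20) (iv 21))) (.and (.rlt .zero (vc 4 (iv 20)))
    (.rlt .zero (vc 4 (iv 21)))))) .one .zero)
    (fill 6 (iv 0) (iv 0) 1 1 3 3 (.and (.not (ieq (iv 20) (iv 21))) (.and
    (.rlt .zero (.cell 2 (iv 20) (iv 21))) (.and (.rlt .zero (vc 4 (.add (iv 0) (iv 20))))
    (.rlt .zero (vc 4 (.add (iv 0) (iv 21))))))) .one .zero)

/-- Computes the signed unit vectors. -/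
def basisProg : Prog :=
  .seq (fill 7 o o 2 2 3 3 (ieq (iv 20) (iv 21)) .one .zero)
    (fill 7 (iv 2) o 2 2 3 3 (ieq (iv 20) (iv 21)) (.sub .zero .one) .zero)

/-- Computes all tables and initialises the current optimum. -/
def tableProg : Prog :=
  .seq weightProg (.seq kernelProg (.seq relProg (.seq basisProg (.rset 8 o o (.sub .zero .one)))))

variable {X Y : Type*} [Fintype X] [Fintype Y] [PartialOrder X] [PartialOrder Y]
  {m n : ℕ} {p : X → Y → ℝ} {eX : X ≃ Fin m} {eY : Y ≃ Fin n} {s : State}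

open Classical in
/-- The tables of the input. -/
structure Input (p : X → Y → ℝ) (eX : X ≃ Fin m) (eY : Y ≃ Fin n) (s : State) : Prop where
  fixed : Fixed m n s
  pmf : ∀ x y, s.mem 0 (eX x) (eY y) = p x y
  leX : ∀ x x', s.mem 1 (eX x) (eX x') = if x ≤ x' then 1 else 0
  leY : ∀ y y', s.mem 2 (eY y) (eY y') = if y ≤ y' then 1 else 0
  zero : ∀ a, 3 ≤ a → s.mem a = 0

theorem den_weightProg (h : Input p eX eY s) :
    ∃ s', weightProg.den s = s' ∧ s'.idx = s.idx ∧ (∀ a' ≠ 4, s'.mem a' = s.mem a') ∧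
      (∀ x, s'.mem 4 0 (eX x) = margX p x) ∧ ∀ y, s'.mem 4 0 (m + eY y) = margY p y := by
  have hs := h.fixed
  obtain ⟨s1, e1, i1, f1, g1, k1⟩ := offsetFill_spec hs.clean 4 o o 3 0 3 1 tt
    (.cell 0 (iv 21) (iv 23)) .zero (by decide) (by decide)
  have hs1 := hs.of_idx i1
  obtain ⟨s2, e2, i2, f2, g2, k2⟩ := offsetFill_spec hs1.clean 4 o (iv 0) 3 1 0 3 tt
    (.cell 0 (iv 22) (iv 21)) .zero (by decide) (by decide)
  refine ⟨s2, by rw [weightProg, den_seq, e1, e2], by rw [i2, i1],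
    fun a ha => by rw [f2 a ha, f1 a ha], fun x => ?_, fun y => ?_⟩
  · have := g1 0 (by rw [hs.i3]; norm_num) (eX x) (by rw [hs.i0]; exact (eX x).2)
    simp only [IExp.eval, zero_add] at this
    rw [k2 _ _ (by simp only [IExp.eval, hs1.i0]; have := (eX x).2; omega), this, hs.i3, hs.i1,
      Finset.sum_range_one, sum_range_index eY fun l => fillTerm _ _ _ _, margX]
    simp only [fillTerm_tt, RExp.eval, IExp.eval, State.at_mem, State.at_21, State.at_23, h.pmf]
  · have := g2 0 (by rw [hs1.i3]; norm_num) (eY y) (by rw [hs1.i1]; exact (eY y).2)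
    simp only [IExp.eval, zero_add, hs1.i0] at this
    rw [this, hs1.i3, sum_range_index eX fun k => ∑ l ∈ Finset.range 1, fillTerm _ _ _ _, margY]
    simp only [Finset.sum_range_one, fillTerm_tt, RExp.eval, IExp.eval, State.at_mem, State.at_21,
      State.at_22, f1, ne_eq, OfNat.zero_ne_ofNat, not_false_eq_true, h.pmf]

theorem den_kernelProg (hs : Fixed m n s) (hp : ∀ x y, s.mem 0 (eX x) (eY y) = p x y)
    (hX : ∀ x, s.mem 4 0 (eX x) = margX p x) (hY : ∀ y, s.mem 4 0 (m + eY y) = margY p y)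
    (h0 : s.mem 5 = 0) :
    ∃ s', kernelProg.den s = s' ∧ s'.idx = s.idx ∧ (∀ a' ≠ 5, s'.mem a' = s.mem a') ∧
      IsMat (index eX eY) 5 (jointKernel p) s' := by
  obtain ⟨s1, e1, i1, f1, g1, k1⟩ := offsetFill_spec hs.clean 5 o (iv 0) 0 1 3 3 tt
    (.sub (.cell 0 (iv 20) (iv 21)) (.mul (vc 4 (iv 20)) (vc 4 (.add (iv 0) (iv 21))))) .zero
    (by decide) (by decide)
  have hs1 := hs.of_idx i1
  obtain ⟨s2, e2, i2, f2, g2, k2⟩ := offsetFill_spec hs1.clean 5 (iv 0) o 1 0 3 3 tt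
    (.sub (.cell 0 (iv 21) (iv 20)) (.mul (vc 4 (iv 21)) (vc 4 (.add (iv 0) (iv 20))))) .zero
    (by decide) (by decide)
  simp only [IExp.eval, hs.i0, hs.i1, hs.i3, zero_add, zero_le, true_and, Finset.sum_range_one,
    fillTerm_tt, RExp.eval, State.at_mem, State.at_20, State.at_21, Nat.reduceLT,
    State.at_of_lt] at g1 k1
  simp only [IExp.eval, hs1.i0, hs1.i1, hs1.i3, zero_add, zero_le, true_and, Finset.sum_range_one,
    fillTerm_tt, RExp.eval, State.at_mem, State.at_20, State.at_21, Nat.reduceLT,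
    State.at_of_lt] at g2 k2
  refine ⟨s2, by rw [kernelProg, den_seq, e1, e2], by rw [i2, i1],
    fun a ha => by rw [f2 a ha, f1 a ha], ?_⟩
  rintro (x | y) (x' | y')
  · have h1 := (eX x).2
    have h2 := (eX x').2
    -- Neither of the two fills touches a diagonal block, which keeps the zeros of the initial
    -- memory.
    rw [index_inl, index_inl, k2 _ _ (by omega), k1 _ _ (by omega), h0]
    rfl
  · have h1 := (eX x).2
    have h2 := (eY y').2
    rw [index_inl, index_inr, k2 _ _ (by omega), g1 _ h1 _ h2, hp, hX, hY]
    rfl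
  · have h1 := (eX x').2
    have h2 := (eY y).2
    rw [index_inl, index_inr, g2 _ h2 _ h1, f1 0 (by norm_num), f1 4 (by norm_num), hp, hX, hY]
    rfl
  · have h1 := (eY y').2
    have h2 := (eY y).2
    rw [index_inr, index_inr, k2 _ _ (by omega), k1 _ _ (by omega), h0]
    rfl

open Classical in
theorem den_relProg (hs : Fixed m n s) (hX : ∀ x, s.mem 4 0 (eX x) = margX p x)
    (hY : ∀ y, s.mem 4 0 (m + eY y) = margY p y)
    (leX : ∀ x x', s.mem 1 (eX x) (eX x') = if x ≤ x' then 1 else 0)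
    (leY : ∀ y y', s.mem 2 (eY y) (eY y') = if y ≤ y' then 1 else 0) (h0 : s.mem 6 = 0) :
    ∃ s', relProg.den s = s' ∧ s'.idx = s.idx ∧ (∀ a' ≠ 6, s'.mem a' = s.mem a') ∧
      IsMat (index eX eY) 6 (fun z z' => if suppLt p z z' then 1 else 0) s' := by
  obtain ⟨s1, e1, i1, f1, g1, k1⟩ := offsetFill_spec hs.clean 6 o o 0 0 3 3
    (.and (.not (ieq (iv 20) (iv 21))) (.and
    (.rlt .zero (.cell 1 (iv 20) (iv 21))) (.and (.rlt .zero (vc 4 (iv 20)))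
    (.rlt .zero (vc 4 (iv 21)))))) .one .zero (by decide) (by decide)
  have hs1 := hs.of_idx i1
  obtain ⟨s2, e2, i2, f2, g2, k2⟩ := offsetFill_spec hs1.clean 6 (iv 0) (iv 0) 1 1 3 3
    (.and (.not (ieq (iv 20) (iv 21))) (.and
    (.rlt .zero (.cell 2 (iv 20) (iv 21))) (.and (.rlt .zero (vc 4 (.add (iv 0) (iv 20))))
    (.rlt .zero (vc 4 (.add (iv 0) (iv 21))))))) .one .zero (by decide) (by decide)
  simp only [IExp.eval, hs.i0, hs.i3, zero_add, zero_le, true_and, Finset.sum_range_one,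
    fillTerm, BExp.Holds, RExp.eval, State.at_mem, State.at_20, State.at_21] at g1 k1
  simp only [IExp.eval, hs1.i0, hs1.i1, hs1.i3, Finset.sum_range_one,
    fillTerm, BExp.Holds, RExp.eval, State.at_mem, State.at_20, State.at_21, Nat.reduceLT,
    State.at_of_lt] at g2 k2
  have hle : ∀ P : Prop, (0 : ℝ) < (if P then 1 else 0) ↔ P := fun P => by
    split_ifs with h <;> simp [h]
  refine ⟨s2, by rw [relProg, den_seq, e1, e2], by rw [i2, i1],
    fun a ha => by rw [f2 a ha, f1 a ha], ?_⟩
  rintro (x | y) (x' | y')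
  · have h1 := (eX x).2
    have h2 := (eX x').2
    rw [index_inl, index_inl, k2 _ _ (by omega), g1 _ h1 _ h2]
    refine if_congr ?_ rfl rfl
    rw [leX, hle, hX, hX]
    rw [show suppLt p (.inl x) (.inl x') ↔ x < x' ∧ 0 < margX p x ∧ 0 < margX p x' from Iff.rfl,
      lt_iff_le_and_ne (a := x)]
    have : ¬ (¬ (eX x : ℕ) < eX x' ∧ ¬ (eX x' : ℕ) < eX x) ↔ x ≠ x' := by
      constructor
      · rintro h rfl
        exact h ⟨lt_irrefl _, lt_irrefl _⟩
      · exact fun h h' => h (index_inj eX (by omega))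
    rw [this]
    tauto
  · have h1 := (eX x).2
    have h2 := (eY y').2
    rw [index_inl, index_inr, k2 _ _ (by omega), k1 _ _ (by omega), h0]
    exact (if_neg id).symm
  · have h1 := (eX x').2
    have h2 := (eY y).2
    rw [index_inl, index_inr, k2 _ _ (by omega), k1 _ _ (by omega), h0]
    exact (if_neg id).symm
  · have h1 := (eY y').2
    have h2 := (eY y).2
    rw [index_inr, index_inr, g2 _ h2 _ h1, f1 2 (by norm_num), f1 4 (by norm_num)]
    refine if_congr ?_ rfl rfl
    rw [leY, hle, hY, hY]
    rw [show suppLt p (.inr y) (.inr y') ↔ y < y' ∧ 0 < margY p y ∧ 0 < margY p y' from Iff.rfl,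
      lt_iff_le_and_ne (a := y)]
    have : ¬ (¬ (eY y : ℕ) < eY y' ∧ ¬ (eY y' : ℕ) < eY y) ↔ y ≠ y' := by
      constructor
      · rintro h rfl
        exact h ⟨lt_irrefl _, lt_irrefl _⟩
      · exact fun h h' => h (index_inj eY (by omega))
    rw [this]
    tauto

open Classical in
theorem den_basisProg {Z : Type*} [Fintype Z] (hs : Fixed m n s) (e : Z ≃ Fin (m + n)) :
    ∃ s', basisProg.den s = s' ∧ s'.idx = s.idx ∧ (∀ a' ≠ 7, s'.mem a' = s.mem a') ∧
      IsMat e 7 (fun c z => if c = z then 1 else 0) s' ∧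
      ∀ c z, s'.mem 7 (m + n + e c) (e z) = if c = z then -1 else 0 := by
  obtain ⟨s1, e1, i1, f1, g1⟩ := matFill_spec hs e 7 (ieq (iv 20) (iv 21)) .one .zero (by decide)
  have hs1 := hs.of_idx i1
  obtain ⟨s2, e2, i2, f2, g2, k2⟩ := offsetFill_spec hs1.clean 7 (iv 2) o 2 2 3 3
    (ieq (iv 20) (iv 21)) (.sub .zero .one) .zero (by decide) (by decide)
  have hiff : ∀ c z, (¬ (e c : ℕ) < e z ∧ ¬ (e z : ℕ) < e c) ↔ c = z := by
    intro c z
    constructor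
    · exact fun h => index_inj e (by omega)
    · rintro rfl
      exact ⟨lt_irrefl _, lt_irrefl _⟩
  simp only [IExp.eval, hs1.i2, hs1.i3, zero_add, zero_le, true_and, Finset.sum_range_one,
    fillTerm, BExp.Holds, RExp.eval, State.at_20, State.at_21] at g2 k2
  refine ⟨s2, by rw [basisProg, den_seq, e1, e2], by rw [i2, i1],
    fun a ha => by rw [f2 a ha, f1 a ha], fun c z => ?_, fun c z => ?_⟩
  · have h1 := (e c).2
    rw [k2 _ _ (by omega), g1 c z]
    simp only [IExp.eval, fillTerm, BExp.Holds, RExp.eval, State.at_20, State.at_21]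
    exact if_congr (hiff c z) rfl rfl
  · rw [g2 _ (e c).2 _ (e z).2, zero_sub]
    exact if_congr (hiff c z) rfl rfl

theorem den_tableProg (hp : IsJointPMF p) (hnd : Nondegenerate p) (h : Input p eX eY s) :
    Inv p eX eY (tableProg.den s) := by
  obtain ⟨s1, e1, i1, f1, wX, wY⟩ := den_weightProg h
  have hs1 := h.fixed.of_idx i1
  obtain ⟨s2, e2, i2, f2, g2⟩ := den_kernelProg (eX := eX) (eY := eY) hs1
    (fun x y => by rw [f1 0 (by norm_num), h.pmf]) wX wY
    (by rw [f1 5 (by norm_num), h.zero 5 (by norm_num)])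
  have hs2 := hs1.of_idx i2
  obtain ⟨s3, e3, i3, f3, g3⟩ := den_relProg (p := p) (eX := eX) (eY := eY) hs2
    (fun x => by rw [f2 4 (by norm_num), wX]) (fun y => by rw [f2 4 (by norm_num), wY])
    (fun x x' => by rw [f2 1 (by norm_num), f1 1 (by norm_num), h.leX])
    (fun y y' => by rw [f2 2 (by norm_num), f1 2 (by norm_num), h.leY])
    (by rw [f2 6 (by norm_num), f1 6 (by norm_num), h.zero 6 (by norm_num)])
  have hs3 := hs2.of_idx i3
  obtain ⟨s4, e4, i4, f4, g4, g4'⟩ := den_basisProg hs3 (index eX eY)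
  have hs4 := hs3.of_idx i4
  have hden : tableProg.den s = s4.setMem 8 0 0 (0 - 1) := by
    rw [tableProg, den_seq, e1, den_seq, e2, den_seq, e3, den_seq, e4]
    rfl
  have hm : ∀ a ≠ 8, (s4.setMem 8 0 0 (0 - 1)).mem a = s4.mem a := by
    intro a ha
    funext i j
    simp [State.setMem, ha]
  rw [hden]
  refine ⟨⟨hs4.of_idx rfl, fun x y => ?_, ?_, fun z z' => ?_, fun z z' => ?_, fun z z' => ?_,
    fun c z => ?_⟩, ?_⟩
  · rw [hm 0 (by norm_num), f4 0 (by norm_num), f3 0 (by norm_num), f2 0 (by norm_num),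
      f1 0 (by norm_num), h.pmf]
  · rintro (x | y)
    · rw [hm 4 (by norm_num), f4 4 (by norm_num), f3 4 (by norm_num), f2 4 (by norm_num),
        index_inl, wX]
      rfl
    · rw [hm 4 (by norm_num), f4 4 (by norm_num), f3 4 (by norm_num), f2 4 (by norm_num),
        index_inr, wY]
      rfl
  · rw [hm 5 (by norm_num), f4 5 (by norm_num), f3 5 (by norm_num), g2 z z']
  · rw [hm 6 (by norm_num), f4 6 (by norm_num), g3 z z']
  · rw [hm 7 (by norm_num), g4 z z']
    by_cases hz : z = z' <;> simp [hz]
  · rw [hm 7 (by norm_num), g4' c z]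
    by_cases hz : c = z <;> simp [hz]
  -- The start value `-1` does not exceed the optimum, by Cauchy–Schwarz.
  · have := neg_one_le_cmc hp hnd
    simpa [State.setMem] using this

/-- Computes the number of selections of strict relations. -/
def countProg : Prog :=
  .seq (.iset 5 (.lit 1)) (.loop 8 2 (.loop 9 2
    (.ite (.rlt .zero (.cell 6 (iv 8) (iv 9))) (.iset 5 (.add (iv 5) (iv 5))) .skip)))

open Classical in
theorem den_countProg {Z : Type*} [Fintype Z] (e : Z ≃ Fin (m + n)) (L : Z → Z → Prop)
    (hs : Fixed m n s) (hL : IsMat e 6 (fun z z' => if L z z' then 1 else 0) s) :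
    (countProg.den s).idx 5 = 2 ^ Nat.count (pairNumbers e L) ((m + n) * (m + n)) := by
  have hs' := hs.setIdx (v := 5) 1 (by decide)
  have hd : countProg.den s = (Prog.loop 8 2 (.loop 9 2 (.ite (.rlt .zero (.cell 6 (iv 8) (iv 9)))
      (.iset 5 (.add (iv 5) (iv 5))) .skip))).den (s.setIdx 5 1) := by
    rw [countProg, den_seq]
    rfl
  rw [hd]
  refine (den_double_loop e (by decide) (by decide) (fun t s => Fixed m n s ∧
    IsMat e 6 (fun z z' => if L z z' then 1 else 0) s ∧
    s.idx 5 = 2 ^ Nat.count (pairNumbers e L) t) (fun t s h => h.1.i2)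
    (fun t s x h => ⟨h.1.setIdx x (by decide), h.2.1, ?_⟩)
    (fun t s x h => ⟨h.1.setIdx x (by decide), h.2.1, ?_⟩) ?_ (s := s.setIdx 5 1)
    ⟨hs', hL, ?_⟩).2.2
  · rw [State.setIdx_ne _ _ (by norm_num), h.2.2]
  · rw [State.setIdx_ne _ _ (by norm_num), h.2.2]
  · rintro a b s ⟨k1, k2, k3⟩ h8 h9
    have hcond : (BExp.rlt .zero (.cell 6 (iv 8) (iv 9))).Holds s ↔ L a b := by
      simp only [BExp.Holds, RExp.eval, IExp.eval, h8, h9, k2 a b]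
      split_ifs with h <;> simp [h]
    rw [Nat.count_succ, pairNumbers_iff, den]
    by_cases h : L a b
    · rw [if_pos (hcond.2 h), if_pos h]
      refine ⟨k1.setIdx _ (by decide), k2, ?_⟩
      rw [den, State.setIdx_self]
      simp only [IExp.eval, k3]
      ring
    · rw [if_neg (fun h' => h (hcond.1 h')), if_neg h]
      exact ⟨k1, k2, k3⟩
  · rw [State.setIdx_self, Nat.count_zero, pow_zero]

-- The counted pair numbers come from strict relations of `X` or of `Y`; only those between symbols
-- of positive probability are enumerated, hence an inequality.
open Classical in
theorem count_le (p : X → Y → ℝ) (eX : X ≃ Fin m) (eY : Y ≃ Fin n) (M : ℕ) :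
    Nat.count (pairNumbers (index eX eY) (suppLt p)) M ≤
      (strictRel X).ncard + (strictRel Y).ncard := by
  set S : Set ((X ⊕ Y) × (X ⊕ Y)) := Prod.map Sum.inl Sum.inl '' strictRel X ∪
    Prod.map Sum.inr Sum.inr '' strictRel Y with hS
  have hSf : S.Finite := Set.toFinite _
  have h1 : ∀ z z', suppLt p z z' → (z, z') ∈ S := by
    rintro (x | y) (x' | y') h
    · exact .inl ⟨(x, x'), h.1, rfl⟩
    · exact h.elim
    · exact h.elim
    · exact .inr ⟨(y, y'), h.1, rfl⟩
  have h2 : Nat.count (pairNumbers (index eX eY) (suppLt p)) M ≤ S.ncard := by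
    rw [Nat.count_eq_card_filter_range, Set.ncard_eq_toFinset_card S hSf]
    refine (Finset.card_le_card fun t ht => ?_).trans (Finset.card_image_le
      (f := fun q : (X ⊕ Y) × (X ⊕ Y) => (index eX eY q.1 : ℕ) * (m + n) + index eX eY q.2))
    obtain ⟨a, b, hab, hL⟩ := (Finset.mem_filter.1 ht).2
    exact Finset.mem_image.2 ⟨(a, b), hSf.mem_toFinset.2 (h1 a b hL), hab⟩
  exact h2.trans ((Set.ncard_union_le _ _).trans (add_le_add (Set.ncard_image_le (Set.toFinite _))
    (Set.ncard_image_le (Set.toFinite _))))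

end Setup

end Algo

end MonoCorr


namespace MonoCorr

namespace Algo

open Prog

/-! ### The whole program -/

section Final

/-- The search over all selections. -/
def searchProg : Prog := .loop 6 5 roundProg

/-- The complete program. -/
def cmcProg : Prog :=
  .seq indexProg (.seq tableProg (.seq countProg (.seq searchProg (.rset 0 o o (sc 8)))))

variable {X Y : Type*} [Fintype X] [Fintype Y] [PartialOrder X] [PartialOrder Y]
  {m n : ℕ} {p : X → Y → ℝ}

theorem input_indexProg (p : X → Y → ℝ) (eX : Fin m ≃ X) (eY : Fin n ≃ Y) :
    Input p eX.symm eY.symm (indexProg.den (inputState p eX eY)) := by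
  refine ⟨⟨⟨?_, ?_, ?_, ?_⟩, ?_, ?_, ?_, ?_, ?_, ?_, ?_, ?_, ?_⟩, ?_, ?_, ?_, ?_⟩
  iterate 13
    · simp [indexProg, Prog.den, State.setIdx, IExp.eval, inputState]
      try ring
  · intro x y
    rw [den_mem _ _ (by decide)]
    simp [inputState]
  · intro x x'
    have h : eX (eX.symm x) ≤ eX (eX.symm x') ↔ x ≤ x' := by simp
    rw [den_mem _ _ (by decide)]
    simp only [inputState, one_ne_zero, if_false, if_true, Fin.is_lt, and_self, dif_pos, Fin.eta]
    by_cases hx : x ≤ x'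
    · rw [if_pos (h.2 hx), if_pos hx]
    · rw [if_neg (fun h' => hx (h.1 h')), if_neg hx]
  · intro y y'
    have h : eY (eY.symm y) ≤ eY (eY.symm y') ↔ y ≤ y' := by simp
    rw [den_mem _ _ (by decide)]
    simp only [inputState, if_false, if_true, Fin.is_lt, and_self, dif_pos, OfNat.ofNat_ne_zero,
      OfNat.ofNat_ne_one, Fin.eta]
    by_cases hy : y ≤ y'
    · rw [if_pos (h.2 hy), if_pos hy]
    · rw [if_neg (fun h' => hy (h.1 h')), if_neg hy]
  · intro a ha
    rw [den_mem _ _ (by simp [indexProg, arrays])]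
    funext i j
    simp only [inputState]
    rw [if_neg (by omega), if_neg (by omega), if_neg (by omega)]
    rfl

/-- The pairs with equal values of `f`, respectively `g`. -/
def levelRel (f : X → ℝ) (g : Y → ℝ) : X ⊕ Y → X ⊕ Y → Prop
  | .inl x, .inl x' => f x = f x'
  | .inr y, .inr y' => g y = g y'
  | _, _ => False

theorem levelRel_equivalence (f : X → ℝ) (g : Y → ℝ) : Equivalence (levelRel f g) where
  refl := by rintro (x | y) <;> exact rfl
  symm := by rintro (x | y) (x' | y') h <;> first | exact h.elim | exact Eq.symm h
  trans := by
    rintro (x | y) (x' | y') (x'' | y'') h h' <;>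
      first | exact h.elim | exact h'.elim | exact Eq.trans h h'

theorem isMerging_of_levelRel {f : X → ℝ} {g : Y → ℝ} {κ : Type*} {lab : X ⊕ Y → κ}
    (h1 : ∀ z z', lab z = lab z' → levelRel f g z z')
    (h2 : ∀ z z', suppLt p z z' → levelRel f g z z' → lab z = lab z') : IsMerging p f g lab where
  ne _ _ h := h1 _ _ h
  eq_left _ _ h := h1 _ _ h
  eq_right _ _ h := h1 _ _ h
  merge_left x x' hlt hx hx' hf := h2 (.inl x) (.inl x') ⟨hlt, hx, hx'⟩ hf
  merge_right y y' hlt hy hy' hg := h2 (.inr y) (.inr y') ⟨hlt, hy, hy'⟩ hg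

-- The invariant bounds the result from above. From below, the selection number that encodes the
-- level sets of a tight pair is among the rounds.
open Classical in
theorem den_searchProg (hp : IsJointPMF p) (hnd : Nondegenerate p) {eX : X ≃ Fin m} {eY : Y ≃ Fin n}
    {s : State} (h : Inv p eX eY s) (h5 : s.idx 5 =
      2 ^ Nat.count (pairNumbers (index eX eY) (suppLt p)) ((m + n) * (m + n))) :
    (searchProg.den s).mem 8 0 0 = cmc p := by
  obtain ⟨f, g, ht⟩ := exists_tight_cmc hp hnd
  obtain ⟨a, ha, hlab⟩ := exists_labels (index eX eY) (suppLt p) (levelRel f g)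
    (levelRel_equivalence f g)
  set W := 2 ^ Nat.count (pairNumbers (index eX eY) (suppLt p)) ((m + n) * (m + n))
  have hsafe := safe_roundProg (eX := eX) (eY := eY) hp hnd
  refine le_antisymm ((hsafe.loop (by decide) (by decide)) s h).1.2 ?_
  refine den_loop_reach (by decide) (I := fun s => Inv p eX eY s ∧ s.idx 5 = W)
    (G := fun s => cmc p ≤ s.mem 8 0 0)
    (fun s x hs => ⟨hs.1.setIdx x (by decide), by rw [State.setIdx_ne _ _ (by norm_num), hs.2]⟩)
    (fun s x hs => hs)
    (fun s hs => ⟨(hsafe s hs.1).1, by rw [den_idx _ _ (by decide), hs.2]⟩)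
    (fun s hs hG => hG.trans (hsafe s hs.1).2) (k₀ := a) (by rw [h5]; exact ha) ?_ ⟨h, h5⟩
  rintro s ⟨hs, hs5⟩ hs6
  obtain ⟨lab, l1, l2, l3⟩ := hlab s hs.1.fixed hs.1.rel hs5 hs6
  exact reach_roundProg hp hnd ht (isMerging_of_levelRel l2 l3) hs l1

theorem den_cmcProg (hp : IsJointPMF p) (hnd : Nondegenerate p) (eX : Fin m ≃ X) (eY : Fin n ≃ Y) :
    (cmcProg.den (inputState p eX eY)).mem 0 0 0 = cmc p := by
  have h1 := den_tableProg hp hnd (input_indexProg p eX eY)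
  have h2 := den_countProg (index eX.symm eY.symm) (suppLt p) h1.1.fixed h1.1.rel
  have h3 : Inv p eX.symm eY.symm (countProg.den (tableProg.den
      (indexProg.den (inputState p eX eY)))) :=
    (safe_of_frame (by decide) (by decide) (by decide) (by decide) _ h1).1
  have h4 := den_searchProg hp hnd h3 h2
  rw [cmcProg, den_seq, den_seq, den_seq, den_seq]
  simp only [den, State.setMem, IExp.eval, RExp.eval]
  simpa using h4

/-- The index variables that bound loops. -/
def fixedIdx : List ℕ := [0, 1, 2, 3, 4, 14, 15, 16, 17]

theorem exec_of_fixed {P : Prog} (hwf : P.wf = true) (hb : ∀ u ∈ P.bounds, u ∈ fixedIdx)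
    (hw : ∀ u ∈ fixedIdx, u ∉ P.writes) {s : State} (hs : Fixed m n s) :
    ∃ t ≤ P.size * (2 * (m + n) + 4) ^ P.depth, Exec P.compile s t (P.den s) := by
  refine exec_den P hwf (2 * (m + n) + 3) s (fun u hu => ?_) fun u hu => hw u (hb u hu)
  have := hb u hu
  simp only [fixedIdx, List.mem_cons, List.not_mem_nil, or_false] at this
  rcases this with rfl | rfl | rfl | rfl | rfl | rfl | rfl | rfl | rfl
  · rw [hs.i0]; omega
  · rw [hs.i1]; omega
  · rw [hs.i2]; omega
  · rw [hs.i3]; omega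
  · rw [hs.i4]; omega
  · rw [hs.i14]; omega
  · rw [hs.i15]; omega
  · rw [hs.i16]; omega
  · rw [hs.i17]; omega

/-- The constant factor of the running time. -/
def timeFactor : ℕ := (indexProg.size + tableProg.size + countProg.size + roundProg.size + 30) *
  8 ^ (tableProg.depth + countProg.depth + roundProg.depth)

/-- The exponent of the running time. -/
def timeExponent : ℕ := tableProg.depth + countProg.depth + roundProg.depth

-- The bound on the loop over selections is exponential, so this loop is timed apart by `exec_loop`;
-- all other parts fall under the polynomial estimate for structured programs.
set_option maxRecDepth 8000 in
theorem exec_cmcProg (hp : IsJointPMF p) (hnd : Nondegenerate p) (eX : Fin m ≃ X) (eY : Fin n ≃ Y) :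
    ∃ t ≤ timeFactor * (m * n) ^ timeExponent * 2 ^ ((strictRel X).ncard + (strictRel Y).ncard),
      Exec cmcProg.compile (inputState p eX eY) t (cmcProg.den (inputState p eX eY)) := by
  have h1 := input_indexProg p eX eY
  obtain ⟨t1, ht1, x1⟩ := exec_den indexProg (by decide) 0 (inputState p eX eY)
    (by simp [indexProg, bounds]) (by decide)
  set s1 := indexProg.den (inputState p eX eY)
  obtain ⟨t2, ht2, x2⟩ := exec_of_fixed (P := tableProg) (by decide) (by decide) (by decide)
    h1.fixed
  have h2 := den_tableProg hp hnd h1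
  set s2 := tableProg.den s1
  obtain ⟨t3, ht3, x3⟩ := exec_of_fixed (P := countProg) (by decide) (by decide) (by decide)
    h2.1.fixed
  have h5 := den_countProg (index eX.symm eY.symm) (suppLt p) h2.1.fixed h2.1.rel
  have h3 : Fixed m n (countProg.den s2) := h2.1.fixed.den _ (by decide) (by decide)
  set s3 := countProg.den s2
  obtain ⟨t4, ht4, x4⟩ := exec_loop (v := 6) (u := 5) (P := roundProg) (I := Fixed m n)
    (by norm_num) (by decide) (by decide) (fun s x hs => hs.setIdx x (by decide))
    (fun s hs => ⟨hs.den _ (by decide) (by decide),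
      exec_of_fixed (P := roundProg) (by decide) (by decide) (by decide) hs⟩) h3
  refine ⟨_, ?_, Exec.seq x1 (Exec.seq x2 (Exec.seq x3 (Exec.seq x4 (Exec.rset 0 o o (sc 8) _))))⟩
  simp only [IExp.cost, RExp.cost, timeFactor, timeExponent]
  have hW : s3.idx 5 ≤ 2 ^ ((strictRel X).ncard + (strictRel Y).ncard) := by
    rw [h5]
    exact Nat.pow_le_pow_right (by norm_num) (count_le p _ _ _)
  have hW1 : 1 ≤ 2 ^ ((strictRel X).ncard + (strictRel Y).ncard) := Nat.one_le_two_pow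
  obtain ⟨⟨x, -⟩, y, -⟩ := hnd
  have hm : 1 ≤ m := (eX.symm x).pos
  have hn : 1 ≤ n := (eY.symm y).pos
  -- Nondegeneracy makes both alphabets nonempty, so sums of sizes are controlled by their product.
  have hB : 2 * (m + n) + 4 ≤ 8 * (m * n) := by nlinarith
  have hind : indexProg.size * (0 + 1) ^ indexProg.depth = indexProg.size := by
    rw [zero_add, one_pow, mul_one]
  rw [hind] at ht1
  set D := tableProg.depth + countProg.depth + roundProg.depth
  set V := (2 * (m + n) + 4) ^ D with hV
  have hpow : ∀ d ≤ D, (2 * (m + n) + 4) ^ d ≤ V := fun d hd => Nat.pow_le_pow_right (by omega) hd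
  have hV1 : 1 ≤ V := Nat.one_le_pow _ _ (by omega)
  have hVB : V ≤ 8 ^ D * (m * n) ^ D := by
    rw [← mul_pow]
    exact Nat.pow_le_pow_left hB D
  have b2 := ht2.trans (Nat.mul_le_mul_left _ (hpow tableProg.depth (by omega)))
  have b3 := ht3.trans (Nat.mul_le_mul_left _ (hpow countProg.depth (by omega)))
  have b4 : t4 ≤ 2 ^ ((strictRel X).ncard + (strictRel Y).ncard) * (roundProg.size * V + 7) + 7 :=
    ht4.trans (Nat.add_le_add_right (Nat.mul_le_mul hW (Nat.add_le_add_right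
      (Nat.mul_le_mul_left _ (hpow roundProg.depth (by omega))) _)) _)
  clear_value D V
  generalize 2 ^ ((strictRel X).ncard + (strictRel Y).ncard) = W at *
  generalize indexProg.size = S1 at *
  generalize tableProg.size = S2 at *
  generalize countProg.size = S3 at *
  generalize roundProg.size = S4 at *
  have hVW : V ≤ V * W := Nat.le_mul_of_pos_right _ hW1
  have hWV : W ≤ V * W := Nat.le_mul_of_pos_left _ hV1
  calc _ ≤ S1 + (S2 * V + (S3 * V + (W * (S4 * V + 7) + 7 + 9))) := by omega
    _ ≤ S1 * (V * W) + (S2 * (V * W) + (S3 * (V * W) + (S4 * (V * W) + 7 * (V * W) +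
        16 * (V * W)))) := by
      have a1 : S1 ≤ S1 * (V * W) := Nat.le_mul_of_pos_right _ (by omega)
      have a2 := Nat.mul_le_mul_left S2 hVW
      have a3 := Nat.mul_le_mul_left S3 hVW
      have a4 : W * (S4 * V + 7) = S4 * (V * W) + 7 * W := by ring
      omega
    _ ≤ (S1 + S2 + S3 + S4 + 30) * (V * W) := by
      ring_nf
      nlinarith [Nat.zero_le (V * W)]
    _ ≤ (S1 + S2 + S3 + S4 + 30) * (8 ^ D * (m * n) ^ D * W) :=
      Nat.mul_le_mul_left _ (Nat.mul_le_mul_right _ hVB)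
    _ = _ := by ring

end Final

end Algo

end MonoCorr

theorem theorem3 :
    ∃ (prog : MonoCorr.Cmd) (C k : ℕ),
      ∀ (X Y : Type*) [Fintype X] [Fintype Y] [PartialOrder X] [PartialOrder Y]
        (p : X → Y → ℝ), MonoCorr.IsJointPMF p → MonoCorr.Nondegenerate p →
      -- the maximum that defines the correlation is attained
      IsGreatest (MonoCorr.cmcSet p) (MonoCorr.cmc p) ∧
      -- every relaxed problem with a feasible point has an optimizer
      (∀ SX ⊆ MonoCorr.strictRel X, ∀ SY ⊆ MonoCorr.strictRel Y,
        (MonoCorr.feasible p SX SY).Nonempty → ∃ f g, MonoCorr.IsOptimizer p SX SY f g) ∧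
      -- whichever optimizers are found, the enumeration returns the global maximum
      (∀ F G, MonoCorr.IsSelection p F G →
        IsGreatest (MonoCorr.keptAllSigns p F G) (MonoCorr.cmc p) ∧
        (0 < MonoCorr.cmc p →
          IsGreatest (MonoCorr.keptCommonSign p F G) (MonoCorr.cmc p))) ∧
      -- the program computes the exact value within the time bound
      (∀ (m n : ℕ) (eX : Fin m ≃ X) (eY : Fin n ≃ Y),
        ∃ (t : ℕ) (s : MonoCorr.State),
          MonoCorr.Exec prog (MonoCorr.inputState p eX eY) t s ∧
          s.mem 0 0 0 = MonoCorr.cmc p ∧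
          t ≤ C * (m * n) ^ k *
            2 ^ ((MonoCorr.strictRel X).ncard + (MonoCorr.strictRel Y).ncard)) := by
  refine ⟨MonoCorr.Algo.cmcProg.compile, MonoCorr.Algo.timeFactor,
    MonoCorr.Algo.timeExponent, fun X Y _ _ _ _ p hp hnd =>
    ⟨MonoCorr.cmc_isGreatest hp hnd, fun SX _ SY _ hne => MonoCorr.exists_isOptimizer hp SX SY hne,
      fun F G hsel => MonoCorr.isGreatest_kept (hp := hp) hnd hsel, fun m n eX eY => ?_⟩⟩
  obtain ⟨t, ht, hx⟩ := MonoCorr.Algo.exec_cmcProg hp hnd eX eY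
  exact ⟨t, _, hx, MonoCorr.Algo.den_cmcProg hp hnd eX eY, ht⟩
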